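/- Let $r\ge 2$, $q=e^{i\pi/r}$, $q^x=e^{i\pi x/r}$ and $\{x\}=q^x-q^{-x}$ for $x\in\mathbb C$. Let $\overline{\mathcal U}$ be the $\mathbb C$-algebra generated by $E,F,K^{\pm1}$ with relations $KK^{-1}=K^{-1}K=1$, $KEK^{-1}=q^2E$, $KFK^{-1}=q^{-2}F$, $[E,F]=\frac{K-K^{-1}}{q-q^{-1}}$, $E^r=F^r=0$, with the Hopf structure $\Delta(E)=1\otimes E+E\otimes K$, $\Delta(F)=K^{-1}\otimes F+F\otimes 1$, $\Delta(K)=K\otimes K$, $\varepsilon(E)=\varepsilon(F)=0$, $\varepsilon(K)=1$, $S(E)=-EK^{-1}$, $S(F)=-KF$, $S(K)=K^{-1}$, and pivot $K^{1-r}$. Let $G=(\mathbb C/2\mathbb Z,+)$ and, for $\overline\alpha\in G$, let $\mathcal U_{\overline\alpha}$ be the quotient of $\overline{\mathcal U}$ by $K^r=q^{r\alpha}=e^{i\pi\alpha}$, with induced coproducts $\Delta_{\overline\alpha,\overline\beta}:\mathcal U_{\overline\alpha+\overline\beta}\to\mathcal U_{\overline\alpha}\otimes\mathcal U_{\overline\beta}$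 and pivot $g_{\overline\alpha}=q^{-r\alpha}K$. Let $\mu=(\mu_{\overline\alpha})$ be a right $G$-integral, i.e. a family of linear forms $\mu_{\overline\alpha}:\mathcal U_{\overline\alpha}\to\mathbb C$ with $(\mu_{\overline\alpha}\otimes\mathrm{Id})\Delta_{\overline\alpha,\overline\beta}(x)=\mu_{\overline\alpha+\overline\beta}(x)1_{\overline\beta}$ for all $x$; let $\eta=\mu_{\overline 0}(E^{r-1}F^{r-1}K)$ and let $\widetilde\mu_{\overline\alpha}(x)=\mu_{\overline\alpha}(g_{\overline\alpha}x)$ be the symmetrised $G$-integral. Let $\Omega=FE+\frac{qK+q^{-1}K^{-1}}{\{1\}^2}$ be the Casimir element, $w_\alpha=\frac{q^{\alpha+r}+q^{-\alpha-r}}{\{1\}^2}$, and, for $\alpha\in\mathbb C\setminus\mathbb Z$, $$L_\alpha(\Omega)=\frac{\prod_{k=1}^{r-1}(\Omega-w_{\alpha+2k})}{\prod_{k=1}^{r-1}(w_\alpha-w_{\alpha+2k})}.$$ Let $\mathcal C$ be the pivotal category of finite-dimensional $\overline{\mathcal U}$-modules on which $K$ is diagonalizable, and let $V_\alpha\in\mathcal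 C$ be the $r$-dimensional module of highest weight $\alpha+r-1$ (a highest weight vector $v$ satisfies $Ev=0$, $Kv=q^{\alpha+r-1}v$, and $v,Fv,\dots,F^{r-1}v$ is a basis). (1) For every $\overline\alpha\in G$, $\widetilde\mu_{\overline\alpha}(\Omega^k)=0$ for $0\le k\le r-2$, and $\widetilde\mu_{\overline\alpha}(\Omega^{r-1})=\eta$. (2) For $\alpha\in\mathbb C\setminus\mathbb Z$ the module $V_\alpha$ is projective in $\mathcal C$. For every (two-sided) modified trace $\mathsf t$ on the ideal of projective objects of $\mathcal C$ there is $d_0\in\mathbb C$ such that, for all $\alpha\in\mathbb C\setminus\mathbb Z$, the modified dimension $d(V_\alpha)=\mathsf t_{V_\alpha}(\mathrm{Id}_{V_\alpha})$ is $$d(V_\alpha)=d_0\prod_{k=1}^{r-1}\frac{\{k\}}{\{\alpha+r-k\}}=d_0\frac{r\{\alpha\}}{\{r\alpha\}},$$ and, for all $\alpha\in\mathbb C\setminus\mathbb Z$ and in every degree $\overline\beta\in G$ (in particular $\overline\beta=\overline\alpha$), if $d_0\neq0$ then $$\widetilde\mu_{\overline\beta}(L_\alpha(\Omega))=\frac{(-1)^{r-1}\{1\}^{2r-2}\eta}{r^3d_0}\;r\,d(V_\alpha).$$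 Moreover, if $\mathsf t$ is normalised by $d_0=\dfrac{(-1)^{r-1}\{1\}^{2r-2}\,\eta}{r^3}$, then $\widetilde\mu_{\overline\beta}(L_\alpha(\Omega))=r\,d(V_\alpha)$ for all $\alpha\in\mathbb C\setminus\mathbb Z$ and $\overline\beta\in G$. -/

import Mathlib

open scoped TensorProduct

namespace QuantumSl2

noncomputable section

/-- `q ^ x = exp (i π x / r)`; in particular `q = q ^ 1 = exp (i π / r)`. -/
def qPow (r : ℕ) (x : ℂ) : ℂ := Complex.exp (Real.pi * Complex.I * x / r)

/-- The quantum bracket `{x} = q ^ x - q ^ (-x)`. -/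
def qBr (r : ℕ) (x : ℂ) : ℂ := qPow r x - qPow r (-x)

theorem qPow_add (r : ℕ) (x y : ℂ) : qPow r (x + y) = qPow r x * qPow r y := by
  simp only [qPow, ← Complex.exp_add]; congr 1; ring

theorem qPow_zero (r : ℕ) : qPow r 0 = 1 := by simp [qPow]

theorem qPow_ne_zero (r : ℕ) (x : ℂ) : qPow r x ≠ 0 := Complex.exp_ne_zero _

theorem qPow_nat_mul (r n : ℕ) (x : ℂ) : qPow r (n * x) = qPow r x ^ n := by
  simp only [qPow, ← Complex.exp_nat_mul]; congr 1; ring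

theorem qPow_r (r : ℕ) [r.AtLeastTwo] : qPow r r = -1 := by
  have : (r : ℂ) ≠ 0 := by
    have := Nat.AtLeastTwo.prop (n := r)
    exact_mod_cast (by omega : r ≠ 0)
  simp [qPow, this, Complex.exp_pi_mul_I]

theorem q_sq_primitive (r : ℕ) [r.AtLeastTwo] : IsPrimitiveRoot (qPow r 1 ^ 2) r := by
  have := Nat.AtLeastTwo.prop (n := r)
  have h := Complex.isPrimitiveRoot_exp r (by omega)
  have e : qPow r 1 ^ 2 = Complex.exp (2 * Real.pi * Complex.I / r) := by
    rw [qPow, ← Complex.exp_nat_mul]; congr 1; push_cast; ring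
  rwa [e]

theorem qBr_one_ne_zero (r : ℕ) [r.AtLeastTwo] : qBr r 1 ≠ 0 := by
  have h2 := Nat.AtLeastTwo.prop (n := r)
  intro h
  have h1 : qPow r 1 = qPow r (-1) := sub_eq_zero.mp h
  have h3 : qPow r 1 ^ 2 = 1 := by
    rw [sq]; nth_rewrite 2 [h1]; rw [← qPow_add, add_neg_cancel, qPow_zero]
  have := (q_sq_primitive r).dvd_of_pow_eq_one 1 (by simpa using h3)
  have := Nat.le_of_dvd one_pos this
  omega

section QBinomial

/-- Gaussian binomial coefficients at `z`. -/
def gaussBinom (z : ℂ) : ℕ → ℕ → ℂ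
  | _, 0 => 1
  | 0, _ + 1 => 0
  | n + 1, k + 1 => gaussBinom z n k + z ^ (k + 1) * gaussBinom z n (k + 1)

theorem gaussBinom_zero (z : ℂ) (n : ℕ) : gaussBinom z n 0 = 1 := by cases n <;> rfl

theorem gaussBinom_gt (z : ℂ) : ∀ n k : ℕ, n < k → gaussBinom z n k = 0
  | _, 0, h => by omega
  | 0, _ + 1, _ => rfl
  | n + 1, k + 1, h => by
    rw [gaussBinom, gaussBinom_gt z n k (by omega), gaussBinom_gt z n (k + 1) (by omega)]; simp

theorem gaussBinom_absorb (z : ℂ) : ∀ n k : ℕ,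
    (z ^ (k + 1) - 1) * gaussBinom z (n + 1) (k + 1) = (z ^ (n + 1) - 1) * gaussBinom z n k
  | 0, 0 => by simp [gaussBinom]
  | 0, k + 1 => by simp [gaussBinom]
  | n + 1, 0 => by
    have := gaussBinom_absorb z n 0
    have e1 : gaussBinom z (n + 1 + 1) (0 + 1) =
      gaussBinom z (n + 1) 0 + z ^ (0 + 1) * gaussBinom z (n + 1) (0 + 1) := rfl
    rw [e1]
    simp only [gaussBinom_zero] at *
    linear_combination z * this
  | n + 1, k + 1 => by
    have h1 := gaussBinom_absorb z n k
    have h2 := gaussBinom_absorb z n (k + 1)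
    have e1 : gaussBinom z (n + 1 + 1) (k + 1 + 1) =
      gaussBinom z (n + 1) (k + 1) + z ^ (k + 2) * gaussBinom z (n + 1) (k + 1 + 1) := rfl
    have e2 : gaussBinom z (n + 1) (k + 1) =
      gaussBinom z n k + z ^ (k + 1) * gaussBinom z n (k + 1) := rfl
    rw [e1]
    linear_combination z ^ (k + 2) * h2 + z * h1 + (z - z ^ (n + 2)) * e2

variable {A : Type*} [Ring A] [Algebra ℂ A]

theorem pow_mul_qcomm {c : ℂ} {x y : A} (h : x * y = c • (y * x)) (n : ℕ) :
    x * y ^ n = c ^ n • (y ^ n * x) := by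
  induction n with
  | zero => simp
  | succ n ih =>
    rw [pow_succ, ← mul_assoc, ih, smul_mul_assoc, mul_assoc, h, mul_smul_comm, smul_smul,
      ← mul_assoc, ← pow_succ]

theorem qbinomial {c : ℂ} {x y : A} (h : x * y = c • (y * x)) (n : ℕ) :
    (x + y) ^ n = ∑ k ∈ Finset.range (n + 1), gaussBinom c n k • (y ^ k * x ^ (n - k)) := by
  induction n with
  | zero => simp [gaussBinom]
  | succ n ih =>
    rw [pow_succ', ih, add_mul, Finset.mul_sum, Finset.mul_sum, Finset.sum_range_succ' _ (n + 1)]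
    have e1 : ∑ i ∈ Finset.range (n + 1), x * gaussBinom c n i • (y ^ i * x ^ (n - i)) =
        ∑ i ∈ Finset.range (n + 1), (c ^ (i + 1) * gaussBinom c n (i + 1)) •
          (y ^ (i + 1) * x ^ (n + 1 - (i + 1))) + x ^ (n + 1) := by
      rw [Finset.sum_range_succ', Finset.sum_range_succ]
      rw [gaussBinom_gt c n (n + 1) (by omega), gaussBinom_zero]
      simp only [mul_zero, zero_smul, add_zero, pow_zero, one_mul, one_smul, Nat.sub_zero,
        ← pow_succ']
      congr 1
      refine Finset.sum_congr rfl fun i hi => ?_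
      have hi' := Finset.mem_range.mp hi
      rw [mul_smul_comm, ← mul_assoc, pow_mul_qcomm h, smul_mul_assoc, mul_assoc, ← pow_succ',
        smul_smul, mul_comm]
      congr 3
      omega
    rw [e1, gaussBinom_zero]
    simp only [gaussBinom, add_smul, Finset.sum_add_distrib, pow_zero, one_mul, one_smul,
      Nat.sub_zero]
    have e2 : ∀ i, y * gaussBinom c n i • (y ^ i * x ^ (n - i)) =
        gaussBinom c n i • (y ^ (i + 1) * x ^ (n + 1 - (i + 1))) := by
      intro i
      rw [mul_smul_comm, ← mul_assoc, ← pow_succ', Nat.add_sub_add_right]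
    simp only [e2]
    abel

/-- If `x y = c y x` with `c` a primitive `r`-th root of unity and `x ^ r = y ^ r = 0`, then
`(x + y) ^ r = 0`. -/
theorem add_pow_eq_zero_of_qcomm {c : ℂ} {r : ℕ} (hr : 0 < r) (hc : IsPrimitiveRoot c r) {x y : A}
    (h : x * y = c • (y * x)) (hx : x ^ r = 0) (hy : y ^ r = 0) : (x + y) ^ r = 0 := by
  rw [qbinomial h]
  refine Finset.sum_eq_zero fun k hk => ?_
  have hk' := Finset.mem_range.mp hk
  rcases Nat.eq_zero_or_pos k with rfl | hk0
  · simp [hx]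
  rcases eq_or_lt_of_le (Nat.lt_succ_iff.mp hk') with rfl | hlt
  · simp [hy]
  obtain ⟨j, rfl⟩ : ∃ j, k = j + 1 := ⟨k - 1, by omega⟩
  obtain ⟨m, rfl⟩ : ∃ m, r = m + 1 := ⟨r - 1, by omega⟩
  have := gaussBinom_absorb c m j
  rw [hc.pow_eq_one, sub_self, zero_mul] at this
  rcases mul_eq_zero.mp this with h0 | h0
  · exact absurd (sub_eq_zero.mp h0) (hc.pow_ne_one_of_pos_of_lt (by omega) hlt)
  · rw [h0, zero_smul]

theorem mul_pow_qcomm {c : ℂ} {x y : A} (h : y * x = c • (x * y)) (n : ℕ) :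
    ∃ s : ℂ, (x * y) ^ n = s • (x ^ n * y ^ n) := by
  induction n with
  | zero => exact ⟨1, by simp⟩
  | succ n ih =>
    obtain ⟨s, hs⟩ := ih
    have hy : ∀ m : ℕ, y ^ m * x = c ^ m • (x * y ^ m) := by
      intro m
      induction m with
      | zero => simp
      | succ m ihm =>
        rw [pow_succ, mul_assoc, h, mul_smul_comm, ← mul_assoc, ihm, smul_mul_assoc, smul_smul,
          mul_assoc, ← pow_succ, ← pow_succ']
    refine ⟨s * c ^ n, ?_⟩
    rw [pow_succ (x * y), hs, smul_mul_assoc, mul_assoc, ← mul_assoc (y ^ n), hy, smul_mul_assoc,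
      mul_smul_comm, smul_smul, mul_assoc, ← pow_succ, ← mul_assoc, ← pow_succ]

end QBinomial

/-- The generators. -/
inductive Gen
  | E | F | K | Kinv

/-- The defining relations of the algebra `U_q sl(2)` modulo `E ^ r = F ^ r = 0`. -/
inductive Rel (r : ℕ) : FreeAlgebra ℂ Gen → FreeAlgebra ℂ Gen → Prop
  | K_Kinv : Rel r (FreeAlgebra.ι ℂ Gen.K * FreeAlgebra.ι ℂ Gen.Kinv) 1
  | Kinv_K : Rel r (FreeAlgebra.ι ℂ Gen.Kinv * FreeAlgebra.ι ℂ Gen.K) 1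
  | K_E : Rel r (FreeAlgebra.ι ℂ Gen.K * FreeAlgebra.ι ℂ Gen.E * FreeAlgebra.ι ℂ Gen.Kinv)
      (qPow r 1 ^ 2 • FreeAlgebra.ι ℂ Gen.E)
  | K_F : Rel r (FreeAlgebra.ι ℂ Gen.K * FreeAlgebra.ι ℂ Gen.F * FreeAlgebra.ι ℂ Gen.Kinv)
      ((qPow r 1 ^ 2)⁻¹ • FreeAlgebra.ι ℂ Gen.F)
  | E_F : Rel r (FreeAlgebra.ι ℂ Gen.E * FreeAlgebra.ι ℂ Gen.F -
        FreeAlgebra.ι ℂ Gen.F * FreeAlgebra.ι ℂ Gen.E)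
      ((qBr r 1)⁻¹ • (FreeAlgebra.ι ℂ Gen.K - FreeAlgebra.ι ℂ Gen.Kinv))
  | E_pow : Rel r (FreeAlgebra.ι ℂ Gen.E ^ r) 0
  | F_pow : Rel r (FreeAlgebra.ι ℂ Gen.F ^ r) 0

/-- The algebra `Ū = Ū_q sl(2)`. -/
def Ubar (r : ℕ) : Type := RingQuot (Rel r)

instance (r : ℕ) : Ring (Ubar r) := inferInstanceAs (Ring (RingQuot (Rel r)))
instance (r : ℕ) : Algebra ℂ (Ubar r) := inferInstanceAs (Algebra ℂ (RingQuot (Rel r)))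

namespace Ubar

/-- The quotient map from the free algebra. -/
def mk (r : ℕ) : FreeAlgebra ℂ Gen →ₐ[ℂ] Ubar r := RingQuot.mkAlgHom ℂ (Rel r)

def E (r : ℕ) : Ubar r := mk r (FreeAlgebra.ι ℂ Gen.E)
def F (r : ℕ) : Ubar r := mk r (FreeAlgebra.ι ℂ Gen.F)
def K (r : ℕ) : Ubar r := mk r (FreeAlgebra.ι ℂ Gen.K)
def Kinv (r : ℕ) : Ubar r := mk r (FreeAlgebra.ι ℂ Gen.Kinv)

variable (r : ℕ)

theorem mk_rel {x y : FreeAlgebra ℂ Gen} (h : Rel r x y) : mk r x = mk r y :=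
  RingQuot.mkAlgHom_rel ℂ h

theorem K_mul_Kinv : K r * Kinv r = 1 := by simpa [K, Kinv] using mk_rel r Rel.K_Kinv
theorem Kinv_mul_K : Kinv r * K r = 1 := by simpa [K, Kinv] using mk_rel r Rel.Kinv_K
theorem K_E_Kinv : K r * E r * Kinv r = qPow r 1 ^ 2 • E r := by
  simpa [K, Kinv, E] using mk_rel r Rel.K_E
theorem K_F_Kinv : K r * F r * Kinv r = (qPow r 1 ^ 2)⁻¹ • F r := by
  simpa [K, Kinv, F] using mk_rel r Rel.K_F
theorem E_F_comm : E r * F r - F r * E r = (qBr r 1)⁻¹ • (K r - Kinv r) := by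
  simpa [K, Kinv, E, F] using mk_rel r Rel.E_F
theorem E_pow : E r ^ r = 0 := by simpa [E] using mk_rel r Rel.E_pow
theorem F_pow : F r ^ r = 0 := by simpa [F] using mk_rel r Rel.F_pow

theorem K_E : K r * E r = qPow r 1 ^ 2 • (E r * K r) := by
  have := congrArg (· * K r) (K_E_Kinv r)
  simpa [mul_assoc, Kinv_mul_K] using this
theorem K_F : K r * F r = (qPow r 1 ^ 2)⁻¹ • (F r * K r) := by
  have := congrArg (· * K r) (K_F_Kinv r)
  simpa [mul_assoc, Kinv_mul_K] using this
theorem E_Kinv : E r * Kinv r = qPow r 1 ^ 2 • (Kinv r * E r) := by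
  have := congrArg (Kinv r * ·) (K_E_Kinv r)
  simpa [← mul_assoc, Kinv_mul_K] using this
theorem F_Kinv : F r * Kinv r = (qPow r 1 ^ 2)⁻¹ • (Kinv r * F r) := by
  have := congrArg (Kinv r * ·) (K_F_Kinv r)
  simpa [← mul_assoc, Kinv_mul_K] using this
theorem Kinv_E : Kinv r * E r = (qPow r 1 ^ 2)⁻¹ • (E r * Kinv r) := by
  rw [E_Kinv, inv_smul_smul₀ (pow_ne_zero _ (qPow_ne_zero r 1))]
theorem Kinv_F : Kinv r * F r = qPow r 1 ^ 2 • (F r * Kinv r) := by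
  rw [F_Kinv, smul_inv_smul₀ (pow_ne_zero _ (qPow_ne_zero r 1))]

theorem mk_surjective : Function.Surjective (mk r) := RingQuot.mkAlgHom_surjective ℂ (Rel r)

/-- Two algebra maps out of `Ū` agree when they agree on generators. -/
theorem algHom_ext {A : Type*} [Semiring A] [Algebra ℂ A] {f g : Ubar r →ₐ[ℂ] A}
    (hE : f (E r) = g (E r)) (hF : f (F r) = g (F r)) (hK : f (K r) = g (K r))
    (hKi : f (Kinv r) = g (Kinv r)) : f = g := by
  have : f.comp (mk r) = g.comp (mk r) := by
    apply FreeAlgebra.hom_ext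
    funext x
    cases x
    exacts [hE, hF, hK, hKi]
  ext x
  obtain ⟨y, rfl⟩ := mk_surjective r x
  exact DFunLike.congr_fun this y

/-- An induction principle: a subalgebra that contains the generators is everything. -/
theorem mem_of_gens (B : Subalgebra ℂ (Ubar r)) (hE : E r ∈ B) (hF : F r ∈ B) (hK : K r ∈ B)
    (hKi : Kinv r ∈ B) (x : Ubar r) : x ∈ B := by
  obtain ⟨y, rfl⟩ := mk_surjective r x
  induction y using FreeAlgebra.induction with
  | grade0 c => rw [AlgHom.commutes]; exact B.algebraMap_mem c
  | grade1 g => cases g <;> assumption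
  | mul a b ha hb => rw [map_mul]; exact B.mul_mem ha hb
  | add a b ha hb => rw [map_add]; exact B.add_mem ha hb

variable {r} in
/-- The algebra map out of `Ū` given by images of the generators that satisfy the relations. -/
def lift {A : Type*} [Ring A] [Algebra ℂ A] (e f k l : A) (h1 : k * l = 1) (h2 : l * k = 1)
    (h3 : k * e * l = qPow r 1 ^ 2 • e) (h4 : k * f * l = (qPow r 1 ^ 2)⁻¹ • f)
    (h5 : e * f - f * e = (qBr r 1)⁻¹ • (k - l)) (h6 : e ^ r = 0) (h7 : f ^ r = 0) :
    Ubar r →ₐ[ℂ] A :=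
  RingQuot.liftAlgHom ℂ (s := Rel r) ⟨FreeAlgebra.lift ℂ fun
    | Gen.E => e | Gen.F => f | Gen.K => k | Gen.Kinv => l, by
      intro x y h
      cases h <;> simp [h1, h2, h3, h4, h5, h6, h7]⟩

section
variable {r} {A : Type*} [Ring A] [Algebra ℂ A] {e f k l : A} (h1 : k * l = 1) (h2 : l * k = 1)
    (h3 : k * e * l = qPow r 1 ^ 2 • e) (h4 : k * f * l = (qPow r 1 ^ 2)⁻¹ • f)
    (h5 : e * f - f * e = (qBr r 1)⁻¹ • (k - l)) (h6 : e ^ r = 0) (h7 : f ^ r = 0)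

@[simp] theorem lift_E : lift e f k l h1 h2 h3 h4 h5 h6 h7 (E r) = e := by
  unfold lift E mk; erw [RingQuot.liftAlgHom_mkAlgHom_apply]; simp
@[simp] theorem lift_F : lift e f k l h1 h2 h3 h4 h5 h6 h7 (F r) = f := by
  unfold lift F mk; erw [RingQuot.liftAlgHom_mkAlgHom_apply]; simp
@[simp] theorem lift_K : lift e f k l h1 h2 h3 h4 h5 h6 h7 (K r) = k := by
  unfold lift K mk; erw [RingQuot.liftAlgHom_mkAlgHom_apply]; simp
@[simp] theorem lift_Kinv : lift e f k l h1 h2 h3 h4 h5 h6 h7 (Kinv r) = l := by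
  unfold lift Kinv mk; erw [RingQuot.liftAlgHom_mkAlgHom_apply]; simp
end

/-- The counit: `ε(E) = ε(F) = 0`, `ε(K) = 1`. -/
def counit [r.AtLeastTwo] : Ubar r →ₐ[ℂ] ℂ :=
  have hr : r ≠ 0 := by have := Nat.AtLeastTwo.prop (n := r); omega
  lift 0 0 1 1 (by simp) (by simp) (by simp) (by simp) (by simp) (by simp [hr]) (by simp [hr])

/-- The coproduct: `Δ(E) = 1 ⊗ E + E ⊗ K`, `Δ(F) = K⁻¹ ⊗ F + F ⊗ 1`, `Δ(K) = K ⊗ K`. -/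
def comul [r.AtLeastTwo] : Ubar r →ₐ[ℂ] Ubar r ⊗[ℂ] Ubar r :=
  have hr : 0 < r := by have := Nat.AtLeastTwo.prop (n := r); omega
  have hq : qPow r 1 ≠ 0 := qPow_ne_zero r 1
  lift (E r ⊗ₜ K r + 1 ⊗ₜ E r) (Kinv r ⊗ₜ F r + F r ⊗ₜ 1) (K r ⊗ₜ K r) (Kinv r ⊗ₜ Kinv r)
    (by simp [K_mul_Kinv, Algebra.TensorProduct.one_def])
    (by simp [Kinv_mul_K, Algebra.TensorProduct.one_def])
    (by
      simp only [mul_add, add_mul, Algebra.TensorProduct.tmul_mul_tmul, K_E_Kinv, mul_one,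
        K_mul_Kinv, smul_add, TensorProduct.tmul_smul, TensorProduct.smul_tmul']
      simp [mul_assoc, K_mul_Kinv])
    (by
      simp only [mul_add, add_mul, Algebra.TensorProduct.tmul_mul_tmul, K_F_Kinv, mul_one,
        K_mul_Kinv, smul_add, TensorProduct.tmul_smul, TensorProduct.smul_tmul']
      simp)
    (by
      have hEF : E r * F r = F r * E r + (qBr r 1)⁻¹ • (K r - Kinv r) := by
        rw [← E_F_comm]; abel
      simp only [mul_add, add_mul, Algebra.TensorProduct.tmul_mul_tmul, mul_one, one_mul,
        E_Kinv, K_F, hEF, TensorProduct.tmul_smul, TensorProduct.smul_tmul', TensorProduct.tmul_add,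
        TensorProduct.add_tmul, TensorProduct.tmul_sub, TensorProduct.sub_tmul, smul_sub,
        smul_smul]
      rw [inv_mul_cancel₀ (pow_ne_zero 2 hq), one_smul]
      abel)
    (add_pow_eq_zero_of_qcomm hr (q_sq_primitive r)
      (by simp [K_E, TensorProduct.tmul_smul])
      (by simp [Algebra.TensorProduct.tmul_pow, E_pow])
      (by simp [Algebra.TensorProduct.tmul_pow, E_pow]))
    (add_pow_eq_zero_of_qcomm hr (q_sq_primitive r)
      (by simp [Kinv_F, TensorProduct.smul_tmul'])
      (by simp [Algebra.TensorProduct.tmul_pow, F_pow])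
      (by simp [Algebra.TensorProduct.tmul_pow, F_pow]))

open MulOpposite in
/-- The antipode, an anti-homomorphism: `S(E) = -E K⁻¹`, `S(F) = -K F`, `S(K) = K⁻¹`. -/
def antipode [r.AtLeastTwo] : Ubar r →ₐ[ℂ] (Ubar r)ᵐᵒᵖ :=
  have hr : r ≠ 0 := by have := Nat.AtLeastTwo.prop (n := r); omega
  have hq : qPow r 1 ≠ 0 := qPow_ne_zero r 1
  lift (op (-(E r * Kinv r))) (op (-(K r * F r))) (op (Kinv r)) (op (K r))
    (by rw [← op_mul, K_mul_Kinv, op_one]) (by rw [← op_mul, Kinv_mul_K, op_one])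
    (by
      rw [← op_mul, ← op_mul, ← op_smul]; congr 1
      simp only [mul_neg, neg_mul, smul_neg, neg_inj]
      rw [← mul_assoc, ← mul_assoc, K_E_Kinv, smul_mul_assoc])
    (by
      rw [← op_mul, ← op_mul, ← op_smul]; congr 1
      simp only [mul_neg, neg_mul, smul_neg, neg_inj]
      rw [mul_assoc, F_Kinv, mul_smul_comm, mul_smul_comm, ← mul_assoc (K r) (Kinv r), K_mul_Kinv,
        one_mul])
    (by
      rw [← op_mul, ← op_mul, ← op_sub, ← op_sub, ← op_smul]; congr 1
      have e1 : K r * F r * (E r * Kinv r) = F r * E r := by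
        rw [E_Kinv, K_F, smul_mul_assoc, mul_smul_comm, smul_smul,
          inv_mul_cancel₀ (pow_ne_zero 2 hq), one_smul, mul_assoc, ← mul_assoc (K r), K_mul_Kinv,
          one_mul]
      have e2 : E r * Kinv r * (K r * F r) = E r * F r := by
        rw [mul_assoc, ← mul_assoc (Kinv r), Kinv_mul_K, one_mul]
      rw [neg_mul_neg, neg_mul_neg, e1, e2, ← neg_sub, E_F_comm, ← smul_neg, neg_sub])
    (by
      rw [← op_pow, neg_pow]
      obtain ⟨s, hs⟩ := mul_pow_qcomm (Kinv_E r) r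
      rw [hs, E_pow]; simp)
    (by
      rw [← op_pow, neg_pow]
      obtain ⟨s, hs⟩ := mul_pow_qcomm (x := K r) (y := F r) (c := qPow r 1 ^ 2)
        (by rw [K_F, smul_inv_smul₀ (pow_ne_zero 2 hq)]) r
      rw [hs, F_pow]; simp)


section
variable [r.AtLeastTwo]

@[simp] theorem counit_E : counit r (E r) = 0 := by simp [counit]
@[simp] theorem counit_F : counit r (F r) = 0 := by simp [counit]
@[simp] theorem counit_K : counit r (K r) = 1 := by simp [counit]
@[simp] theorem counit_Kinv : counit r (Kinv r) = 1 := by simp [counit]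
@[simp] theorem comul_E : comul r (E r) = E r ⊗ₜ K r + 1 ⊗ₜ E r := by simp [comul]
@[simp] theorem comul_F : comul r (F r) = Kinv r ⊗ₜ F r + F r ⊗ₜ 1 := by simp [comul]
@[simp] theorem comul_K : comul r (K r) = K r ⊗ₜ K r := by simp [comul]
@[simp] theorem comul_Kinv : comul r (Kinv r) = Kinv r ⊗ₜ Kinv r := by simp [comul]
open MulOpposite in
@[simp] theorem antipode_E : antipode r (E r) = op (-(E r * Kinv r)) := by simp [antipode]
open MulOpposite in
@[simp] theorem antipode_F : antipode r (F r) = op (-(K r * F r)) := by simp [antipode]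
open MulOpposite in
@[simp] theorem antipode_K : antipode r (K r) = op (Kinv r) := by simp [antipode]
open MulOpposite in
@[simp] theorem antipode_Kinv : antipode r (Kinv r) = op (K r) := by simp [antipode]

end

/-- The pivot `g = K ^ (1 - r)` of `Ū`. -/
def pivot : Ubar r := Kinv r ^ (r - 1)

/-- The inverse `g⁻¹ = K ^ (r - 1)` of the pivot. -/
def pivotInv : Ubar r := K r ^ (r - 1)

theorem pow_K_E (n : ℕ) : K r ^ n * E r = (qPow r 1 ^ 2) ^ n • (E r * K r ^ n) := by
  induction n with
  | zero => simp
  | succ n ih =>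
    rw [pow_succ, mul_assoc, K_E, mul_smul_comm, ← mul_assoc, ih, smul_mul_assoc, smul_smul,
      mul_assoc, ← pow_succ, ← pow_succ']
theorem pow_K_F (n : ℕ) : F r * K r ^ n = (qPow r 1 ^ 2) ^ n • (K r ^ n * F r) := by
  have h : F r * K r = qPow r 1 ^ 2 • (K r * F r) := by
    rw [K_F, smul_inv_smul₀ (pow_ne_zero _ (qPow_ne_zero r 1))]
  exact pow_mul_qcomm h n
theorem pow_E_Kinv (n : ℕ) : E r * Kinv r ^ n = (qPow r 1 ^ 2) ^ n • (Kinv r ^ n * E r) :=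
  pow_mul_qcomm (E_Kinv r) n
theorem pow_Kinv_F (n : ℕ) : Kinv r ^ n * F r = (qPow r 1 ^ 2) ^ n • (F r * Kinv r ^ n) := by
  induction n with
  | zero => simp
  | succ n ih =>
    rw [pow_succ, mul_assoc, Kinv_F, mul_smul_comm, ← mul_assoc, ih, smul_mul_assoc, smul_smul,
      mul_assoc, ← pow_succ, ← pow_succ']

section
variable [r.AtLeastTwo]

theorem r_pred : r - 1 + 1 = r := by have := Nat.AtLeastTwo.prop (n := r); omega

theorem K_mul_pivotInv : K r * pivotInv r = K r ^ r := by
  rw [pivotInv, ← pow_succ', r_pred]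
theorem pivotInv_mul_K : pivotInv r * K r = K r ^ r := by
  rw [pivotInv, ← pow_succ, r_pred]
theorem Kinv_mul_pivot : Kinv r * pivot r = Kinv r ^ r := by
  rw [pivot, ← pow_succ', r_pred]
theorem pivot_mul_Kinv : pivot r * Kinv r = Kinv r ^ r := by
  rw [pivot, ← pow_succ, r_pred]
theorem Kr_E : K r ^ r * E r = E r * K r ^ r := by
  rw [pow_K_E, (q_sq_primitive r).pow_eq_one, one_smul]
theorem Kr_F : K r ^ r * F r = F r * K r ^ r := by
  rw [pow_K_F, (q_sq_primitive r).pow_eq_one, one_smul]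
theorem Kinvr_E : Kinv r ^ r * E r = E r * Kinv r ^ r := by
  rw [pow_E_Kinv, (q_sq_primitive r).pow_eq_one, one_smul]
theorem Kinvr_F : Kinv r ^ r * F r = F r * Kinv r ^ r := by
  rw [pow_Kinv_F, (q_sq_primitive r).pow_eq_one, one_smul]

end

/-- The quantum Casimir element `Ω = F E + (q K + q⁻¹ K⁻¹) / {1}²`. -/
def casimir : Ubar r :=
  F r * E r + ((qBr r 1) ^ 2)⁻¹ • (qPow r 1 • K r + qPow r (-1) • Kinv r)

end Ubar

/-! ### The graded algebras -/

/-- The group `G = ℂ / 2ℤ`. -/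
abbrev G : Type := ℂ ⧸ AddSubgroup.zmultiples (2 : ℂ)

theorem exp_periodic : Function.Periodic (fun α : ℂ => Complex.exp (Real.pi * Complex.I * α)) 2 := by
  intro α
  have : Real.pi * Complex.I * (α + 2) = Real.pi * Complex.I * α + 2 * Real.pi * Complex.I := by ring
  simp only [this, Complex.exp_add, Complex.exp_two_pi_mul_I, mul_one]

/-- The character `ᾱ ↦ q ^ (r α) = exp (i π α)` of `G`. -/
def chi : G → ℂ := exp_periodic.lift

theorem chi_mk (α : ℂ) : chi (α : G) = Complex.exp (Real.pi * Complex.I * α) := rfl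

theorem chi_eq_qPow (r : ℕ) [r.AtLeastTwo] (α : ℂ) : chi (α : G) = qPow r (r * α) := by
  have : (r : ℂ) ≠ 0 := by
    have := Nat.AtLeastTwo.prop (n := r)
    exact_mod_cast (by omega : r ≠ 0)
  rw [chi_mk, qPow]; congr 1; field_simp

theorem chi_add (a b : G) : chi (a + b) = chi a * chi b := by
  induction a using QuotientAddGroup.induction_on with | H a => ?_
  induction b using QuotientAddGroup.induction_on with | H b => ?_
  rw [← QuotientAddGroup.mk_add, chi_mk, chi_mk, chi_mk, ← Complex.exp_add]; congr 1; ring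

/-- The relation `K ^ r = q ^ (r α)`. -/
inductive GRel (r : ℕ) (a : G) : Ubar r → Ubar r → Prop
  | K_pow : GRel r a (Ubar.K r ^ r) (chi a • 1)

/-- The algebra `U_ᾱ`, the quotient of `Ū` by the relation `K ^ r = q ^ (r α)`. -/
def U (r : ℕ) (a : G) : Type := RingQuot (GRel r a)

instance (r : ℕ) (a : G) : Ring (U r a) := inferInstanceAs (Ring (RingQuot (GRel r a)))
instance (r : ℕ) (a : G) : Algebra ℂ (U r a) := inferInstanceAs (Algebra ℂ (RingQuot (GRel r a)))

namespace U

/-- The projection `p_ᾱ : Ū → U_ᾱ`. -/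
def proj (r : ℕ) (a : G) : Ubar r →ₐ[ℂ] U r a := RingQuot.mkAlgHom ℂ (GRel r a)

theorem proj_K_pow (r : ℕ) (a : G) : proj r a (Ubar.K r) ^ r = chi a • 1 := by
  rw [← map_pow]
  have := RingQuot.mkAlgHom_rel ℂ (GRel.K_pow (r := r) (a := a))
  refine Eq.trans this ?_
  erw [map_smul, map_one]
  rfl

variable (r : ℕ) [r.AtLeastTwo]

/-- The coproduct `Δ_{a,b} : U_{a+b} → U_a ⊗ U_b` induced by that of `Ū`. -/
def comul (a b : G) : U r (a + b) →ₐ[ℂ] U r a ⊗[ℂ] U r b :=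
  RingQuot.liftAlgHom ℂ (s := GRel r (a + b))
    ⟨(Algebra.TensorProduct.map (proj r a) (proj r b)).comp (Ubar.comul r), by
      intro x y h
      cases h
      simp only [map_pow, AlgHom.comp_apply, Ubar.comul_K, Algebra.TensorProduct.map_tmul,
        Algebra.TensorProduct.tmul_pow, proj_K_pow, map_smul, map_one, chi_add,
        TensorProduct.tmul_smul, TensorProduct.smul_tmul', Algebra.TensorProduct.one_def, smul_smul]
      rw [mul_comm]⟩

/-- `Δ_{a,b} ∘ p_{a+b} = (p_a ⊗ p_b) ∘ Δ`. -/
theorem comul_proj (a b : G) (x : Ubar r) : comul r a b (proj r (a + b) x) =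
    Algebra.TensorProduct.map (proj r a) (proj r b) (Ubar.comul r x) := by
  unfold comul proj
  erw [RingQuot.liftAlgHom_mkAlgHom_apply]
  rfl

/-- The pivot `g_ᾱ = q ^ (- r α) K`. -/
def pivot (a : G) : U r a := (chi a)⁻¹ • proj r a (Ubar.K r)

/-- A right `G`-integral: `(μ_a ⊗ id) Δ_{a,b}(x) = μ_{a+b}(x) 1_b`. -/
def IsRightGIntegral (μ : ∀ a : G, U r a →ₗ[ℂ] ℂ) : Prop :=
  ∀ (a b : G) (x : U r (a + b)),
    TensorProduct.lid ℂ (U r b) ((μ a).rTensor (U r b) (comul r a b x)) = μ (a + b) x • 1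

/-- The symmetrised form `μ̃_a(x) = μ_a(g_a x)`. -/
def symmetrised (μ : ∀ a : G, U r a →ₗ[ℂ] ℂ) (a : G) : U r a →ₗ[ℂ] ℂ :=
  (μ a).comp (LinearMap.mulLeft ℂ (pivot r a))

end U

/-- The scalar `w_α = (q ^ (α + r) + q ^ (- α - r)) / {1}²`. -/
def casimirScalar (r : ℕ) (α : ℂ) : ℂ := (qPow r (α + r) + qPow r (-α - r)) / qBr r 1 ^ 2

open Polynomial in
/-- The Lagrange interpolation polynomial `L_α`, with `L_α(w_{α+2k}) = δ_{0,k}`. -/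
def lagrangePoly (r : ℕ) (α : ℂ) : ℂ[X] :=
  C (∏ k ∈ Finset.Icc 1 (r - 1), (casimirScalar r α - casimirScalar r (α + 2 * k)))⁻¹ *
    ∏ k ∈ Finset.Icc 1 (r - 1), (X - C (casimirScalar r (α + 2 * k)))

/-! ### Weight modules -/

/-- Objects of the category `𝒞`: finite-dimensional representations of `Ū` on which `K` is
diagonalizable. -/
structure WeightModule (r : ℕ) where
  /-- the underlying space -/
  V : Type
  [addCommGroup : AddCommGroup V]
  [module : Module ℂ V]
  [finite : FiniteDimensional ℂ V]
  /-- the action -/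
  ρ : Ubar r →ₐ[ℂ] Module.End ℂ V
  diagonalizable : ⨆ c : ℂ, Module.End.eigenspace (ρ (Ubar.K r)) c = ⊤

attribute [instance] WeightModule.addCommGroup WeightModule.module WeightModule.finite


section Diagonalizable

variable {V W : Type*} [AddCommGroup V] [Module ℂ V] [AddCommGroup W] [Module ℂ W]

open Module.End Polynomial

theorem exists_squarefree_of_diagonalizable [FiniteDimensional ℂ V] {f : Module.End ℂ V}
    (h : ⨆ c : ℂ, eigenspace f c = ⊤) : ∃ p : ℂ[X], Squarefree p ∧ aeval f p = 0 := by
  classical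
  let s := (Module.End.finite_hasEigenvalue f).toFinset
  refine ⟨∏ c ∈ s, (X - C c), ?_, ?_⟩
  · exact (separable_prod_X_sub_C_iff' (f := fun c : ℂ => c)).mpr (fun _ _ _ _ h => h) |>.squarefree
  · ext v
    have hv : v ∈ ⨆ c : ℂ, eigenspace f c := h ▸ Submodule.mem_top
    refine Submodule.iSup_induction _ (motive := fun v => aeval f (∏ c ∈ s, (X - C c)) v = 0)
      hv ?_ (map_zero _) ?_
    · intro c x hx
      by_cases hx0 : x = 0
      · simp [hx0]
      have hc : c ∈ s := by
        simp only [s, Set.Finite.mem_toFinset]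
        exact hasEigenvalue_of_hasEigenvector ⟨hx, hx0⟩
      rw [aeval_apply_of_hasEigenvector ⟨hx, hx0⟩, eval_prod, Finset.prod_eq_zero hc (by simp),
        zero_smul]
    · intro x y hx hy
      rw [map_add, hx, hy, add_zero]

theorem diagonalizable_of_squarefree [FiniteDimensional ℂ V] {f : Module.End ℂ V} {p : ℂ[X]}
    (hp : Squarefree p) (h : aeval f p = 0) : ⨆ c : ℂ, eigenspace f c = ⊤ :=
  (isSemisimple_of_squarefree_aeval_eq_zero hp h).iSup_eigenspace_eq_top

theorem diagonalizable_inv {f g : Module.End ℂ V} (hgf : g * f = 1)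
    (h : ⨆ c : ℂ, eigenspace f c = ⊤) : ⨆ c : ℂ, eigenspace g c = ⊤ := by
  rw [eq_top_iff, ← h]
  refine iSup_le fun c x hx => ?_
  rw [mem_eigenspace_iff] at hx
  have h1 : x = c • g x := by
    have := DFunLike.congr_fun hgf x
    rw [Module.End.mul_apply, hx, map_smul, Module.End.one_apply] at this
    exact this.symm
  refine Submodule.mem_iSup_of_mem c⁻¹ ?_
  rw [mem_eigenspace_iff]
  by_cases hc : c = 0
  · rw [hc, zero_smul] at h1
    simp [h1]
  · nth_rewrite 2 [h1]
    rw [inv_smul_smul₀ hc]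

theorem diagonalizable_dual [FiniteDimensional ℂ V] {f : Module.End ℂ V}
    (h : ⨆ c : ℂ, eigenspace f c = ⊤) :
    ⨆ c : ℂ, eigenspace (Module.Dual.transpose (R := ℂ) f : Module.End ℂ (Module.Dual ℂ V)) c = ⊤ := by
  obtain ⟨p, hp, hf⟩ := exists_squarefree_of_diagonalizable h
  refine diagonalizable_of_squarefree hp ?_
  have key : ∀ q : ℂ[X], aeval (Module.Dual.transpose (R := ℂ) f : Module.End ℂ (Module.Dual ℂ V)) q =
      Module.Dual.transpose (R := ℂ) (aeval f q) := by
    intro q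
    induction q using Polynomial.induction_on' with
    | add a b ha hb => rw [map_add, map_add, map_add, ha, hb]
    | monomial n a =>
      rw [aeval_monomial, aeval_monomial, ← Algebra.smul_def, ← Algebra.smul_def, map_smul]
      congr 1
      induction n with
      | zero => rfl
      | succ n ih => rw [pow_succ, ih, pow_succ']; rfl
  rw [key, hf, map_zero]

theorem diagonalizable_tensor {f : Module.End ℂ V} {g : Module.End ℂ W}
    (hf : ⨆ c : ℂ, eigenspace f c = ⊤) (hg : ⨆ c : ℂ, eigenspace g c = ⊤) :
    ⨆ c : ℂ, eigenspace (TensorProduct.map f g : Module.End ℂ (V ⊗[ℂ] W)) c = ⊤ := by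
  rw [eq_top_iff]
  rintro z -
  induction z using TensorProduct.induction_on with
  | zero => exact zero_mem _
  | add x y hx hy => exact add_mem hx hy
  | tmul v w =>
    have hv : v ∈ ⨆ c : ℂ, eigenspace f c := hf ▸ Submodule.mem_top
    have hw : w ∈ ⨆ c : ℂ, eigenspace g c := hg ▸ Submodule.mem_top
    induction hv using Submodule.iSup_induction' with
    | zero => simp
    | add x y _ _ hx hy => rw [TensorProduct.add_tmul]; exact add_mem hx hy
    | mem c x hx =>
      induction hw using Submodule.iSup_induction' with
      | zero => simp
      | add y y' _ _ hy hy' => rw [TensorProduct.tmul_add]; exact add_mem hy hy'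
      | mem d y hy =>
        refine Submodule.mem_iSup_of_mem (c * d) ?_
        rw [mem_eigenspace_iff] at *
        rw [TensorProduct.map_tmul, hx, hy, TensorProduct.smul_tmul_smul]

end Diagonalizable

namespace WeightModule

variable {r : ℕ}

/-- The space of morphisms of `𝒞`: the `Ū`-linear maps. -/
def homs (M N : WeightModule r) : Submodule ℂ (M.V →ₗ[ℂ] N.V) where
  carrier := {f | ∀ h : Ubar r, f ∘ₗ M.ρ h = N.ρ h ∘ₗ f}
  add_mem' {f g} hf hg h := by rw [LinearMap.add_comp, LinearMap.comp_add, hf h, hg h]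
  zero_mem' h := by simp
  smul_mem' c f hf h := by rw [LinearMap.smul_comp, LinearMap.comp_smul, hf h]

/-- Morphisms of `𝒞`. -/
abbrev Hom (M N : WeightModule r) : Type := homs M N

/-- Endomorphisms. -/
abbrev End (M : WeightModule r) : Type := Hom M M

/-- The identity morphism. -/
def Hom.id (M : WeightModule r) : End M := ⟨LinearMap.id, fun _ => rfl⟩

/-- Composition `g ∘ f`. -/
def Hom.comp {L M N : WeightModule r} (g : Hom M N) (f : Hom L M) : Hom L N :=
  ⟨g.1 ∘ₗ f.1, fun h => by
    rw [LinearMap.comp_assoc, f.2 h, ← LinearMap.comp_assoc, g.2 h, LinearMap.comp_assoc]⟩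

/-- It suffices to check `Ū`-linearity on generators. -/
def Hom.ofGens {M N : WeightModule r} (f : M.V →ₗ[ℂ] N.V)
    (hE : f ∘ₗ M.ρ (Ubar.E r) = N.ρ (Ubar.E r) ∘ₗ f)
    (hF : f ∘ₗ M.ρ (Ubar.F r) = N.ρ (Ubar.F r) ∘ₗ f)
    (hK : f ∘ₗ M.ρ (Ubar.K r) = N.ρ (Ubar.K r) ∘ₗ f)
    (hKi : f ∘ₗ M.ρ (Ubar.Kinv r) = N.ρ (Ubar.Kinv r) ∘ₗ f) : Hom M N :=
  ⟨f, by
    let B : Subalgebra ℂ (Ubar r) :=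
      { carrier := {h | f ∘ₗ M.ρ h = N.ρ h ∘ₗ f}
        mul_mem' := fun {a b} ha hb => by
          simp only [Set.mem_ofPred_eq, map_mul, Module.End.mul_eq_comp] at *
          rw [← LinearMap.comp_assoc, ha, LinearMap.comp_assoc, hb, LinearMap.comp_assoc]
        add_mem' := fun {a b} ha hb => by
          simp only [Set.mem_ofPred_eq, map_add, LinearMap.add_comp, LinearMap.comp_add] at *
          rw [ha, hb]
        algebraMap_mem' := fun c => by
          simp only [Set.mem_ofPred_eq, AlgHom.commutes]
          ext x
          simp [Module.algebraMap_end_apply] }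
    exact Ubar.mem_of_gens r B hE hF hK hKi⟩

/-- Projective objects of `𝒞` (the epimorphisms of `𝒞` are the surjective morphisms). -/
def IsProjective (P : WeightModule r) : Prop :=
  ∀ (M N : WeightModule r) (p : Hom M N), Function.Surjective p.1 →
    ∀ f : Hom P N, ∃ l : Hom P M, p.comp l = f

variable [r.AtLeastTwo]

variable (r) in
/-- The unit object `ℂ`, with `Ū` acting through the counit. -/
abbrev unit : WeightModule r where
  V := ℂ
  ρ := (Algebra.lsmul ℂ ℂ ℂ).comp (Ubar.counit r)
  diagonalizable := by
    rw [eq_top_iff]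
    intro x _
    refine Submodule.mem_iSup_of_mem 1 ?_
    rw [Module.End.mem_eigenspace_iff]
    simp

/-- The representation `h ↦ (ρ ⊗ σ)(Δ(h))` on `V ⊗ W`. -/
def tensorRep {V W : Type} [AddCommGroup V] [Module ℂ V] [AddCommGroup W] [Module ℂ W]
    (ρ : Ubar r →ₐ[ℂ] Module.End ℂ V) (σ : Ubar r →ₐ[ℂ] Module.End ℂ W) :
    Ubar r →ₐ[ℂ] Module.End ℂ (V ⊗[ℂ] W) :=
  (Module.endTensorEndAlgHom (R := ℂ) (S := ℂ) (A := ℂ)).comp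
    ((Algebra.TensorProduct.map ρ σ).comp (Ubar.comul r))

/-- The dual representation, with `(h f)(x) = f (S(h) x)`. -/
def dualRep {V : Type} [AddCommGroup V] [Module ℂ V] (ρ : Ubar r →ₐ[ℂ] Module.End ℂ V) :
    Ubar r →ₐ[ℂ] Module.End ℂ (Module.Dual ℂ V) where
  toFun h := Module.Dual.transpose (R := ℂ) (ρ (Ubar.antipode r h).unop)
  map_one' := by simp; rfl
  map_mul' a b := by simp; rfl
  map_zero' := by simp
  map_add' a b := by simp
  commutes' c := by
    rw [AlgHom.commutes, MulOpposite.algebraMap_apply, MulOpposite.unop_op, AlgHom.commutes]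
    ext f x
    simp [Module.Dual.transpose_apply, Module.algebraMap_end_apply]

section
variable {V W : Type} [AddCommGroup V] [Module ℂ V] [AddCommGroup W] [Module ℂ W]
    (ρ : Ubar r →ₐ[ℂ] Module.End ℂ V) (σ : Ubar r →ₐ[ℂ] Module.End ℂ W)

theorem tensorRep_of_comul {h : Ubar r} {z} (hz : Ubar.comul r h = z) :
    tensorRep ρ σ h = Module.endTensorEndAlgHom (R := ℂ) (S := ℂ) (A := ℂ)
      (Algebra.TensorProduct.map ρ σ z) := by
  rw [← hz]; rfl

theorem tensorRep_E : tensorRep ρ σ (Ubar.E r) = TensorProduct.map (ρ (Ubar.E r)) (σ (Ubar.K r)) +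
    TensorProduct.map LinearMap.id (σ (Ubar.E r)) := by
  rw [tensorRep_of_comul ρ σ (Ubar.comul_E r), map_add, map_add, Algebra.TensorProduct.map_tmul,
    Algebra.TensorProduct.map_tmul, map_one]
  rfl
theorem tensorRep_F : tensorRep ρ σ (Ubar.F r) = TensorProduct.map (ρ (Ubar.Kinv r)) (σ (Ubar.F r)) +
    TensorProduct.map (ρ (Ubar.F r)) LinearMap.id := by
  rw [tensorRep_of_comul ρ σ (Ubar.comul_F r), map_add, map_add, Algebra.TensorProduct.map_tmul,
    Algebra.TensorProduct.map_tmul, map_one]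
  rfl
theorem tensorRep_K : tensorRep ρ σ (Ubar.K r) =
    TensorProduct.map (ρ (Ubar.K r)) (σ (Ubar.K r)) := by
  rw [tensorRep_of_comul ρ σ (Ubar.comul_K r), Algebra.TensorProduct.map_tmul]
  rfl
theorem tensorRep_Kinv : tensorRep ρ σ (Ubar.Kinv r) =
    TensorProduct.map (ρ (Ubar.Kinv r)) (σ (Ubar.Kinv r)) := by
  rw [tensorRep_of_comul ρ σ (Ubar.comul_Kinv r), Algebra.TensorProduct.map_tmul]
  rfl

theorem dualRep_E : dualRep ρ (Ubar.E r) =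
    Module.Dual.transpose (R := ℂ) (-(ρ (Ubar.E r) * ρ (Ubar.Kinv r))) := by
  simp [dualRep]
theorem dualRep_F : dualRep ρ (Ubar.F r) =
    Module.Dual.transpose (R := ℂ) (-(ρ (Ubar.K r) * ρ (Ubar.F r))) := by
  simp [dualRep]
theorem dualRep_K : dualRep ρ (Ubar.K r) = Module.Dual.transpose (R := ℂ) (ρ (Ubar.Kinv r)) := by
  simp [dualRep]
theorem dualRep_Kinv : dualRep ρ (Ubar.Kinv r) = Module.Dual.transpose (R := ℂ) (ρ (Ubar.K r)) := by
  simp [dualRep]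

end

/-- The tensor product, with `h · (v ⊗ w) = Δ(h) (v ⊗ w)`. -/
abbrev tensor (M N : WeightModule r) : WeightModule r where
  V := M.V ⊗[ℂ] N.V
  ρ := tensorRep M.ρ N.ρ
  diagonalizable := by
    rw [tensorRep_K]
    exact diagonalizable_tensor M.diagonalizable N.diagonalizable

/-- The dual, with `(h f)(x) = f (S(h) x)`. -/
abbrev dual (M : WeightModule r) : WeightModule r where
  V := Module.Dual ℂ M.V
  ρ := dualRep M.ρ
  diagonalizable := by
    rw [dualRep_K]
    have h : M.ρ (Ubar.Kinv r) * M.ρ (Ubar.K r) = 1 := by rw [← map_mul, Ubar.Kinv_mul_K, map_one]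
    exact diagonalizable_dual (diagonalizable_inv h M.diagonalizable)

/-- The tensor product of two morphisms. -/
def Hom.tensor {M M' N N' : WeightModule r} (f : Hom M M') (g : Hom N N') :
    Hom (M.tensor N) (M'.tensor N') :=
  have hf : ∀ h v, f.1 (M.ρ h v) = M'.ρ h (f.1 v) := fun h v => DFunLike.congr_fun (f.2 h) v
  have hg : ∀ h v, g.1 (N.ρ h v) = N'.ρ h (g.1 v) := fun h v => DFunLike.congr_fun (g.2 h) v
  Hom.ofGens (TensorProduct.map f.1 g.1)
    (TensorProduct.ext' fun v w => by simp [tensorRep_E, hf, hg])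
    (TensorProduct.ext' fun v w => by simp [tensorRep_F, hf, hg])
    (TensorProduct.ext' fun v w => by simp [tensorRep_K, hf, hg])
    (TensorProduct.ext' fun v w => by simp [tensorRep_Kinv, hf, hg])

/-- The associativity morphism. -/
def assocHom (L M N : WeightModule r) : Hom ((L.tensor M).tensor N) (L.tensor (M.tensor N)) :=
  Hom.ofGens (TensorProduct.assoc ℂ L.V M.V N.V).toLinearMap
    (TensorProduct.ext_threefold fun u v w => by
      simp [tensorRep_E, tensorRep_K, TensorProduct.add_tmul, TensorProduct.tmul_add, add_assoc])
    (TensorProduct.ext_threefold fun u v w => by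
      simp [tensorRep_F, tensorRep_Kinv, TensorProduct.add_tmul, TensorProduct.tmul_add, add_assoc])
    (TensorProduct.ext_threefold fun u v w => by simp [tensorRep_K])
    (TensorProduct.ext_threefold fun u v w => by simp [tensorRep_Kinv])

/-- The inverse of a bijective morphism. -/
def Hom.inv {M N : WeightModule r} (e : M.V ≃ₗ[ℂ] N.V) (he : e.toLinearMap ∈ homs M N) : Hom N M :=
  ⟨e.symm.toLinearMap, fun h => by
    ext x
    have := DFunLike.congr_fun (he h) (e.symm x)
    simp only [LinearMap.comp_apply, LinearEquiv.coe_coe, LinearEquiv.apply_symm_apply] at this ⊢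
    rw [← this, LinearEquiv.symm_apply_apply]⟩

/-- The inverse associativity morphism. -/
def assocInv (L M N : WeightModule r) : Hom (L.tensor (M.tensor N)) ((L.tensor M).tensor N) :=
  Hom.inv (TensorProduct.assoc ℂ L.V M.V N.V) (assocHom L M N).2

/-- The right unit morphism `M ⊗ ℂ → M`. -/
def ridHom (M : WeightModule r) : Hom (M.tensor (unit r)) M :=
  Hom.ofGens (TensorProduct.rid ℂ M.V).toLinearMap
    (TensorProduct.ext' fun v w => by simp [tensorRep_E])
    (TensorProduct.ext' fun v w => by simp [tensorRep_F])
    (TensorProduct.ext' fun v w => by simp [tensorRep_K])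
    (TensorProduct.ext' fun v w => by simp [tensorRep_Kinv])

/-- The inverse right unit morphism `M → M ⊗ ℂ`. -/
def ridInv (M : WeightModule r) : Hom M (M.tensor (unit r)) :=
  Hom.inv (TensorProduct.rid ℂ M.V) (ridHom M).2

/-- The left unit morphism `ℂ ⊗ M → M`. -/
def lidHom (M : WeightModule r) : Hom ((unit r).tensor M) M :=
  Hom.ofGens (TensorProduct.lid ℂ M.V).toLinearMap
    (TensorProduct.ext' fun v w => by simp [tensorRep_E])
    (TensorProduct.ext' fun v w => by simp [tensorRep_F])
    (TensorProduct.ext' fun v w => by simp [tensorRep_K])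
    (TensorProduct.ext' fun v w => by simp [tensorRep_Kinv])

/-- The inverse left unit morphism `M → ℂ ⊗ M`. -/
def lidInv (M : WeightModule r) : Hom M ((unit r).tensor M) :=
  Hom.inv (TensorProduct.lid ℂ M.V) (lidHom M).2

/-- The evaluation `W* ⊗ W → ℂ`, `f ⊗ v ↦ f(v)`. -/
def evLeft (W : WeightModule r) : Hom (W.dual.tensor W) (unit r) :=
  have h1 : ∀ v, W.ρ (Ubar.Kinv r) (W.ρ (Ubar.K r) v) = v := fun v => by
    rw [← Module.End.mul_apply, ← map_mul, Ubar.Kinv_mul_K, map_one, Module.End.one_apply]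
  have h2 : ∀ v, W.ρ (Ubar.K r) (W.ρ (Ubar.Kinv r) v) = v := fun v => by
    rw [← Module.End.mul_apply, ← map_mul, Ubar.K_mul_Kinv, map_one, Module.End.one_apply]
  Hom.ofGens (contractLeft ℂ W.V)
    (TensorProduct.ext' fun v w => by
      simp [tensorRep_E, dualRep_E, Module.Dual.transpose_apply, h1])
    (TensorProduct.ext' fun v w => by
      simp [tensorRep_F, dualRep_F, dualRep_Kinv, Module.Dual.transpose_apply])
    (TensorProduct.ext' fun v w => by
      simp [tensorRep_K, dualRep_K, Module.Dual.transpose_apply, h1])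
    (TensorProduct.ext' fun v w => by
      simp [tensorRep_Kinv, dualRep_Kinv, Module.Dual.transpose_apply, h2])

/-- The evaluation `W ⊗ W* → ℂ`, `v ⊗ f ↦ f(g v)`. -/
def evRight (W : WeightModule r) : Hom (W.tensor W.dual) (unit r) :=
  have hm : ∀ a b v, W.ρ a (W.ρ b v) = W.ρ (a * b) v := fun a b v => by
    rw [map_mul, Module.End.mul_apply]
  Hom.ofGens (contractRight ℂ W.V ∘ₗ TensorProduct.map (W.ρ (Ubar.pivot r)) LinearMap.id)
    (TensorProduct.ext' fun v f => by
      have e : Ubar.Kinv r * (Ubar.pivot r * Ubar.E r) =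
          Ubar.E r * (Ubar.Kinv r * Ubar.pivot r) := by
        rw [← mul_assoc, Ubar.Kinv_mul_pivot, Ubar.Kinvr_E]
      simp [tensorRep_E, dualRep_E, dualRep_K, Module.Dual.transpose_apply, hm, e, -map_mul])
    (TensorProduct.ext' fun v f => by
      have e : Ubar.K r * (Ubar.F r * (Ubar.pivot r * Ubar.Kinv r)) =
          Ubar.pivot r * Ubar.F r := by
        rw [Ubar.pivot_mul_Kinv, ← Ubar.Kinvr_F, ← Ubar.Kinv_mul_pivot, ← mul_assoc, ← mul_assoc,
          Ubar.K_mul_Kinv, one_mul]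
      simp [tensorRep_F, dualRep_F, Module.Dual.transpose_apply, hm, e, -map_mul])
    (TensorProduct.ext' fun v f => by
      have e : Ubar.Kinv r * (Ubar.pivot r * Ubar.K r) = Ubar.pivot r := by
        rw [← mul_assoc, Ubar.Kinv_mul_pivot, ← Ubar.pivot_mul_Kinv, mul_assoc, Ubar.Kinv_mul_K,
          mul_one]
      simp [tensorRep_K, dualRep_K, Module.Dual.transpose_apply, hm, e, -map_mul])
    (TensorProduct.ext' fun v f => by
      have e : Ubar.K r * (Ubar.pivot r * Ubar.Kinv r) = Ubar.pivot r := by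
        rw [Ubar.pivot_mul_Kinv, ← Ubar.Kinv_mul_pivot, ← mul_assoc, Ubar.K_mul_Kinv, one_mul]
      simp [tensorRep_Kinv, dualRep_Kinv, Module.Dual.transpose_apply, hm, e, -map_mul])

section
variable {V : Type} [AddCommGroup V] [Module ℂ V] [FiniteDimensional ℂ V]

theorem map_transpose_coev (A B : Module.End ℂ V) :
    TensorProduct.map A (Module.Dual.transpose (R := ℂ) B) (coevaluation ℂ V 1) =
      TensorProduct.map (A * B) LinearMap.id (coevaluation ℂ V 1) := by
  let b := Module.Basis.ofVectorSpace ℂ V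
  simp only [coevaluation_apply_one, map_sum, TensorProduct.map_tmul, LinearMap.id_apply,
    Module.End.mul_apply]
  have h1 : ∀ i, Module.Dual.transpose (R := ℂ) B (b.coord i) =
      ∑ j, (b.coord i (B (b j))) • b.coord j := fun i => b.ext fun k => by
    simp only [Module.Dual.transpose_apply, LinearMap.comp_apply, Module.Basis.coord_apply,
      LinearMap.sum_apply, LinearMap.smul_apply, Module.Basis.repr_self, smul_eq_mul]
    rw [Finset.sum_eq_single k (fun j _ hj => by rw [Finsupp.single_eq_of_ne hj, mul_zero])
      (fun h => absurd (Finset.mem_univ _) h), Finsupp.single_eq_same, mul_one]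
  have h2 : ∀ j, A (B (b j)) = ∑ i, (b.coord i (B (b j))) • A (b i) := fun j => by
    conv_lhs => rw [← b.sum_repr (B (b j)), map_sum]
    simp
  change ∑ i, A (b i) ⊗ₜ[ℂ] Module.Dual.transpose (R := ℂ) B (b.coord i) =
    ∑ j, A (B (b j)) ⊗ₜ[ℂ] b.coord j
  simp_rw [h1, h2, TensorProduct.tmul_sum, TensorProduct.sum_tmul]
  rw [Finset.sum_comm]
  simp_rw [TensorProduct.tmul_smul, TensorProduct.smul_tmul']

end

/-- The coevaluation `ℂ → W ⊗ W*`, `1 ↦ ∑ v_j ⊗ v^j`. -/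
def coevLeft (W : WeightModule r) : Hom (unit r) (W.tensor W.dual) :=
  Hom.ofGens (coevaluation ℂ W.V)
    (LinearMap.ext_ring (by
      simp only [LinearMap.comp_apply, tensorRep_E, LinearMap.add_apply, dualRep_E, dualRep_K,
        map_transpose_coev]
      rw [← LinearMap.add_apply, ← TensorProduct.map_add_left, ← Module.End.one_eq_id, one_mul]
      simp))
    (LinearMap.ext_ring (by
      simp only [LinearMap.comp_apply, tensorRep_F, LinearMap.add_apply, dualRep_F,
        map_transpose_coev]
      rw [← LinearMap.add_apply, ← TensorProduct.map_add_left, mul_neg, ← mul_assoc, ← map_mul,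
        Ubar.Kinv_mul_K]
      simp))
    (LinearMap.ext_ring (by
      simp only [LinearMap.comp_apply, tensorRep_K, dualRep_K, map_transpose_coev, ← map_mul,
        Ubar.K_mul_Kinv]
      simp [← Module.End.one_eq_id]))
    (LinearMap.ext_ring (by
      simp only [LinearMap.comp_apply, tensorRep_Kinv, dualRep_Kinv, map_transpose_coev, ← map_mul,
        Ubar.Kinv_mul_K]
      simp [← Module.End.one_eq_id]))

/-- The linear map `ℂ → W* ⊗ W`, `1 ↦ ∑ v^i ⊗ g⁻¹ v_i`. -/
def coevRightAux (W : WeightModule r) : ℂ →ₗ[ℂ] Module.Dual ℂ W.V ⊗[ℂ] W.V :=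
  (TensorProduct.comm ℂ W.V (Module.Dual ℂ W.V)).toLinearMap ∘ₗ
    TensorProduct.map (W.ρ (Ubar.pivotInv r)) LinearMap.id ∘ₗ coevaluation ℂ W.V

theorem map_coevRightAux (W : WeightModule r) (A B : Module.End ℂ W.V) :
    TensorProduct.map (Module.Dual.transpose (R := ℂ) B) A (coevRightAux W 1) =
      TensorProduct.comm ℂ W.V (Module.Dual ℂ W.V) (TensorProduct.map
        (A * W.ρ (Ubar.pivotInv r) * B) LinearMap.id (coevaluation ℂ W.V 1)) := by
  rw [← map_transpose_coev, coevRightAux, LinearMap.comp_apply, LinearMap.comp_apply,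
    LinearEquiv.coe_coe, TensorProduct.map_comm, ← LinearMap.comp_apply, ← TensorProduct.map_comp]
  rfl

theorem transpose_one (V : Type) [AddCommGroup V] [Module ℂ V] :
    Module.Dual.transpose (R := ℂ) (1 : Module.End ℂ V) = LinearMap.id := rfl

/-- The coevaluation `ℂ → W* ⊗ W`, `1 ↦ ∑ v^i ⊗ g⁻¹ v_i`. -/
def coevRight (W : WeightModule r) : Hom (unit r) (W.dual.tensor W) :=
  Hom.ofGens (coevRightAux W)
    (LinearMap.ext_ring (by
      simp only [LinearMap.comp_apply, tensorRep_E, LinearMap.add_apply, dualRep_E,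
        map_coevRightAux, ← transpose_one W.V]
      rw [← map_add, ← LinearMap.add_apply, ← TensorProduct.map_add_left]
      simp only [mul_neg, ← map_mul, mul_one]
      have e : Ubar.K r * Ubar.pivotInv r * (Ubar.E r * Ubar.Kinv r) =
          Ubar.E r * Ubar.pivotInv r := by
        rw [Ubar.K_mul_pivotInv, ← mul_assoc, Ubar.Kr_E, mul_assoc, ← Ubar.pivotInv_mul_K,
          mul_assoc, Ubar.K_mul_Kinv, mul_one]
      rw [e]
      simp))
    (LinearMap.ext_ring (by
      simp only [LinearMap.comp_apply, tensorRep_F, LinearMap.add_apply, dualRep_F, dualRep_Kinv,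
        map_coevRightAux, ← Module.End.one_eq_id]
      rw [← map_add, ← LinearMap.add_apply, ← TensorProduct.map_add_left]
      simp only [mul_neg, ← map_mul, one_mul]
      have e : Ubar.pivotInv r * (Ubar.K r * Ubar.F r) =
          Ubar.F r * Ubar.pivotInv r * Ubar.K r := by
        rw [← mul_assoc, Ubar.pivotInv_mul_K, Ubar.Kr_F, mul_assoc, Ubar.pivotInv_mul_K]
      rw [e]
      simp))
    (LinearMap.ext_ring (by
      simp only [LinearMap.comp_apply, tensorRep_K, dualRep_K, map_coevRightAux, ← map_mul]
      rw [Ubar.K_mul_pivotInv, ← Ubar.pivotInv_mul_K, mul_assoc, Ubar.K_mul_Kinv]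
      simp [coevRightAux]))
    (LinearMap.ext_ring (by
      simp only [LinearMap.comp_apply, tensorRep_Kinv, dualRep_Kinv, map_coevRightAux, ← map_mul]
      rw [mul_assoc, Ubar.pivotInv_mul_K, ← Ubar.K_mul_pivotInv, ← mul_assoc, Ubar.Kinv_mul_K]
      simp [coevRightAux]))

/-- The right partial trace
`tr_W^r(f) = (id_V ⊗ evRight_W) (f ⊗ id_{W*}) (id_U ⊗ coevLeft_W)`. -/
def partialTraceRight {U V : WeightModule r} (W : WeightModule r)
    (f : Hom (U.tensor W) (V.tensor W)) : Hom U V :=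
  (ridHom V).comp <| ((Hom.id V).tensor (evRight W)).comp <| (assocHom V W W.dual).comp <|
    (f.tensor (Hom.id W.dual)).comp <| (assocInv U W W.dual).comp <|
      ((Hom.id U).tensor (coevLeft W)).comp <| ridInv U

/-- The left partial trace
`tr_W^l(f) = (evLeft_W ⊗ id_V) (id_{W*} ⊗ f) (coevRight_W ⊗ id_U)`. -/
def partialTraceLeft {U V : WeightModule r} (W : WeightModule r)
    (f : Hom (W.tensor U) (W.tensor V)) : Hom U V :=
  (lidHom V).comp <| ((evLeft W).tensor (Hom.id V)).comp <| (assocInv W.dual W V).comp <|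
    ((Hom.id W.dual).tensor f).comp <| (assocHom W.dual W U).comp <|
      ((coevRight W).tensor (Hom.id U)).comp <| lidInv U

variable (r) in
/-- A (two-sided) modified trace on the ideal of projective objects of `𝒞`: a family of linear
forms on the endomorphism spaces of the projective objects with the cyclicity property and the
right and left partial trace properties. -/
structure ModifiedTrace where
  /-- the linear forms -/
  tr : ∀ P : WeightModule r, P.IsProjective → (End P →ₗ[ℂ] ℂ)
  cyclic : ∀ (P Q : WeightModule r) (hP : P.IsProjective) (hQ : Q.IsProjective)
    (f : Hom P Q) (g : Hom Q P), tr P hP (g.comp f) = tr Q hQ (f.comp g)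
  right_partial : ∀ (P W : WeightModule r) (hP : P.IsProjective)
    (hPW : (P.tensor W).IsProjective) (f : End (P.tensor W)),
    tr (P.tensor W) hPW f = tr P hP (partialTraceRight W f)
  left_partial : ∀ (P W : WeightModule r) (hP : P.IsProjective)
    (hWP : (W.tensor P).IsProjective) (f : End (W.tensor P)),
    tr (W.tensor P) hWP f = tr P hP (partialTraceLeft W f)

end WeightModule

/-! ### The highest weight modules -/

section highestWeight

variable (r : ℕ) (α : ℂ)

/-- `K v_i = q ^ (α + r - 1 - 2 i) v_i`; the vectors `v_0, …, v_{r-1}` are the standard basis. -/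
def vK : Module.End ℂ (Fin r → ℂ) where
  toFun x i := qPow r (α + r - 1 - 2 * (i : ℕ)) * x i
  map_add' x y := by ext i; simp [mul_add]
  map_smul' c x := by ext i; simp; ring

/-- `K⁻¹`. -/
def vKinv : Module.End ℂ (Fin r → ℂ) where
  toFun x i := qPow r (-(α + r - 1 - 2 * (i : ℕ))) * x i
  map_add' x y := by ext i; simp [mul_add]
  map_smul' c x := by ext i; simp; ring

/-- `F v_i = v_{i+1}`, with `v_r = 0`. -/
def vF : Module.End ℂ (Fin r → ℂ) where
  toFun x i := if _ : 0 < (i : ℕ) then x ⟨i - 1, by omega⟩ else 0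
  map_add' x y := by ext i; by_cases h : 0 < (i : ℕ) <;> simp [h]
  map_smul' c x := by ext i; by_cases h : 0 < (i : ℕ) <;> simp [h]

/-- The coefficient `{i} {α + r - i} / {1}²` in `E v_i = ({i} {α + r - i} / {1}²) v_{i-1}`. -/
def vCoeff (i : ℕ) : ℂ := qBr r i * qBr r (α + r - i) / qBr r 1 ^ 2

/-- `E v_i = ({i} {α + r - i} / {1}²) v_{i-1}`. -/
def vE : Module.End ℂ (Fin r → ℂ) where
  toFun x i := if h : (i : ℕ) + 1 < r then vCoeff r α (i + 1) * x ⟨i + 1, h⟩ else 0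
  map_add' x y := by ext i; by_cases h : (i : ℕ) + 1 < r <;> simp [h, mul_add]
  map_smul' c x := by ext i; by_cases h : (i : ℕ) + 1 < r <;> simp [h]; ring

theorem vK_apply (x : Fin r → ℂ) (i) :
    vK r α x i = qPow r (α + r - 1 - 2 * (i : ℕ)) * x i := rfl
theorem vKinv_apply (x : Fin r → ℂ) (i) :
    vKinv r α x i = qPow r (-(α + r - 1 - 2 * (i : ℕ))) * x i := rfl
theorem vF_apply (x : Fin r → ℂ) (i : Fin r) :
    vF r x i = if _ : 0 < (i : ℕ) then x ⟨i - 1, by omega⟩ else 0 := rfl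
theorem vE_apply (x : Fin r → ℂ) (i : Fin r) : vE r α x i =
    if h : (i : ℕ) + 1 < r then vCoeff r α (i + 1) * x ⟨i + 1, h⟩ else 0 := rfl

theorem vK_mul_vKinv : vK r α * vKinv r α = 1 := by
  refine LinearMap.ext fun x => funext fun i => ?_
  rw [Module.End.mul_apply, vK_apply, vKinv_apply, ← mul_assoc, ← qPow_add, add_neg_cancel,
    qPow_zero, one_mul]; rfl

theorem vKinv_mul_vK : vKinv r α * vK r α = 1 := by
  refine LinearMap.ext fun x => funext fun i => ?_
  rw [Module.End.mul_apply, vKinv_apply, vK_apply, ← mul_assoc, ← qPow_add, neg_add_cancel,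
    qPow_zero, one_mul]; rfl

theorem vF_pow_apply (n : ℕ) (x : Fin r → ℂ) (i : Fin r) (h : (i : ℕ) < n) :
    (vF r ^ n) x i = 0 := by
  induction n generalizing i with
  | zero => omega
  | succ n ih =>
    rw [pow_succ', Module.End.mul_apply, vF_apply]
    split_ifs with h0
    · exact ih _ (by simp only; omega)
    · rfl

theorem vE_pow_apply (n : ℕ) (x : Fin r → ℂ) (i : Fin r) (h : r ≤ i + n) :
    (vE r α ^ n) x i = 0 := by
  induction n generalizing i with
  | zero => omega
  | succ n ih =>
    rw [pow_succ', Module.End.mul_apply, vE_apply]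
    split_ifs with h0
    · rw [ih _ (by simp only; omega), mul_zero]
    · rfl

end highestWeight

theorem qBr_r (r : ℕ) [r.AtLeastTwo] : qBr r r = 0 := by
  have h : qPow r r * qPow r (-r) = 1 := by rw [← qPow_add, add_neg_cancel, qPow_zero]
  rw [qPow_r] at h
  rw [qBr, qPow_r]
  linear_combination h

theorem vE_vF_comm (r : ℕ) [r.AtLeastTwo] (α : ℂ) : vE r α * vF r - vF r * vE r α =
    (qBr r 1)⁻¹ • (vK r α - vKinv r α) := by
  have h1 := qBr_one_ne_zero r
  refine LinearMap.ext fun x => funext fun i => ?_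
  have e1 : (vE r α * vF r) x i = vCoeff r α (i + 1) * x i := by
    rw [Module.End.mul_apply, vE_apply]
    split_ifs with h
    · rw [vF_apply]; simp
    · have : ((i : ℕ) + 1 : ℕ) = r := by omega
      rw [this, vCoeff, qBr_r]; simp
  have e2 : (vF r * vE r α) x i = vCoeff r α i * x i := by
    rw [Module.End.mul_apply, vF_apply]
    split_ifs with h
    · have h' : (i : ℕ) - 1 + 1 = i := by omega
      rw [vE_apply, dif_pos (by simp only; omega)]
      simp only [h']
    · have : (i : ℕ) = 0 := by omega
      rw [this, vCoeff]; simp [qBr]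
  have e3 : vCoeff r α (i + 1) - vCoeff r α i =
      (qBr r 1)⁻¹ * (qPow r (α + r - 1 - 2 * (i : ℕ)) - qPow r (-(α + r - 1 - 2 * (i : ℕ)))) := by
    have : qBr r ((i : ℕ) + 1) * qBr r (α + r - ((i : ℕ) + 1)) - qBr r (i : ℕ) * qBr r (α + r - (i : ℕ)) =
        qBr r 1 * (qPow r (α + r - 1 - 2 * (i : ℕ)) - qPow r (-(α + r - 1 - 2 * (i : ℕ)))) := by
      simp only [qBr, mul_sub, sub_mul, ← qPow_add]
      ring_nf
    rw [vCoeff, vCoeff, ← sub_div, Nat.cast_add, Nat.cast_one, this]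
    field_simp
  have e4 : (vE r α * vF r - vF r * vE r α) x i = (vCoeff r α (i + 1) - vCoeff r α i) * x i := by
    rw [sub_mul, ← e1, ← e2]; rfl
  rw [e4, e3]
  simp only [LinearMap.smul_apply, LinearMap.sub_apply, Pi.smul_apply, Pi.sub_apply, vK_apply,
    vKinv_apply, smul_eq_mul]
  ring

/-- The `r`-dimensional module `V_α` of highest weight `α + r - 1`. -/
def WeightModule.highestWeight (r : ℕ) [r.AtLeastTwo] (α : ℂ) : WeightModule r where
  V := Fin r → ℂ
  ρ := Ubar.lift (vE r α) (vF r) (vK r α) (vKinv r α) (vK_mul_vKinv r α) (vKinv_mul_vK r α)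
    (by
      refine LinearMap.ext fun x => funext fun i => ?_
      simp only [Module.End.mul_apply, vK_apply, vE_apply, vKinv_apply, LinearMap.smul_apply,
        Pi.smul_apply, smul_eq_mul]
      split_ifs with h
      · rw [← qPow_nat_mul]
        have : qPow r (((2 : ℕ) : ℂ) * 1) = qPow r (α + r - 1 - 2 * (i : ℕ)) *
            qPow r (-(α + r - 1 - 2 * (((i : ℕ) + 1 : ℕ) : ℂ))) := by
          rw [← qPow_add]; congr 1; push_cast; ring
        rw [this]; ring
      · simp)
    (by
      refine LinearMap.ext fun x => funext fun i => ?_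
      simp only [Module.End.mul_apply, vK_apply, vF_apply, vKinv_apply, LinearMap.smul_apply,
        Pi.smul_apply, smul_eq_mul]
      split_ifs with h
      · have h2 : qPow r (-2) * qPow r 1 ^ 2 = 1 := by
          rw [← qPow_nat_mul, ← qPow_add]; norm_num [qPow_zero]
        rw [← eq_inv_of_mul_eq_one_left h2]
        have : qPow r (-2) = qPow r (α + r - 1 - 2 * (i : ℕ)) *
            qPow r (-(α + r - 1 - 2 * (((i : ℕ) - 1 : ℕ) : ℂ))) := by
          rw [← qPow_add, Nat.cast_sub (by omega)]; congr 1; push_cast; ring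
        rw [this]; ring
      · simp)
    (vE_vF_comm r α)
    (by refine LinearMap.ext fun x => funext fun i => ?_; exact vE_pow_apply r α r x i (by omega))
    (by refine LinearMap.ext fun x => funext fun i => ?_; exact vF_pow_apply r r x i i.2)
  diagonalizable := by
    rw [Ubar.lift_K, eq_top_iff]
    intro x _
    rw [← Finset.univ_sum_single x]
    refine Submodule.sum_mem _ fun i _ => ?_
    refine Submodule.mem_iSup_of_mem (qPow r (α + r - 1 - 2 * (i : ℕ))) ?_
    rw [Module.End.mem_eigenspace_iff]
    funext j
    rw [vK_apply]
    by_cases h : j = i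
    · subst h; simp
    · simp [h]

end
end QuantumSl2

/-!
The integral and the modified trace are computed separately, and both answers are explicit products
of quantum brackets; the theorem compares them.

*The integral.* Let `f` be a matrix coefficient of a module `V_α` that factors through `U_b`, and
apply `id ⊗ f` to `Δ(x)`. The equation of a `G`-integral becomes `μ_a((id ⊗ f) Δ(x)) = f(1)
μ_{a+b}(x)` (`U.integral_slice`). The coefficient `f = ⟨v_0^*, · v_1⟩` vanishes on `F Ū` and at
`1`, and `(id ⊗ f) Δ(F ^ n E ^ (m+1) K ^ l)` is a nonzero multiple of `F ^ n E ^ m K ^ l` as long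
as `m + 1 < r`, because a geometric sum in a primitive `r`-th root of unity does not vanish. So
`μ_a` kills all `F ^ n E ^ m K ^ l` with `m ≤ r - 2` (`U.integral_eq_zero`), without any appeal to
a PBW basis. The coefficient `⟨v_0^*, · v_0⟩` shows that the value at `F ^ (r-1) E ^ (r-1) K`
depends on `a` through the character `χ` (`U.integral_top`). Since `F E` and `E F` differ from the
central element `Ω` by linear combinations of `K` and `K⁻¹`, both `F ^ k E ^ k` and `E ^ k F ^ k`
equal `Ω ^ k` up to terms `Ω ^ i K ^ l`, `i < k` (`Ubar.pow_mul_pow_sub_mem_casimirLow`). Hence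
the symmetrised integral of a polynomial of degree less than `r` in `Ω` is `η` times its
coefficient of degree `r - 1` (`U.symmetrised_aeval`). For `L_α` that coefficient is the inverse
of `∏ (w_α - w_{α+2k}) = ∏ {k} {α+r-k} / {1} ^ (2r-2)`.

*The modified trace.* The element `E ^ (r-1) F ^ (r-1)` turns a lift of a highest weight vector into
a highest weight vector and acts on `v_0 ∈ V_α` by a nonzero scalar, so `V_α` is projective
(`WeightModule.highestWeight_isProjective`). For `γ = α + β + r - 1` the module `V_γ` is the direct
summand of `V_α ⊗ V_β` generated by `v_0 ⊗ v_0`. Its projection has a right partial trace that is a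
scalar given by a telescoping sum (`partialTrace_scalar`):
`{γ} {r α} / ({r γ} {α})`. Cyclicity and the partial trace property then say that
`d(V_α) {r α} / {α}` takes the same value at `α` and at `γ` (`WeightModule.modifiedDim_step`). Here
`β` is determined by `α` and `γ` and may be any complex number, since projectivity of `V_α ⊗ V_β`
comes from that of `V_α` alone; so the value is a constant.

The two answers match because `(∏ {k}) ^ 2 = (-1) ^ (r-1) r ^ 2` (`prod_qBr_nat`, `prodConst_sq`).
The second form of the modified dimension comes from `∏ {k} = i ^ (r-1) r` and
`∏_{0 ≤ j < r} {α + j} = i ^ (r-1) {r α}` (`prod_qBr_add`, `prod_ratio`).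
-/

namespace QuantumSl2

noncomputable section

/-! ### Quantum brackets -/

section Brackets

theorem qPow_neg (r : ℕ) (x : ℂ) : qPow r (-x) = (qPow r x)⁻¹ :=
  eq_inv_of_mul_eq_one_left (by rw [← qPow_add, neg_add_cancel, qPow_zero])

theorem half_notMem_int : (1 / 2 : ℂ) ∉ Set.range (Int.cast : ℤ → ℂ) := by
  rintro ⟨n, hn⟩
  have h : (2 * n : ℂ) = 1 := by rw [hn]; norm_num
  have : 2 * n = 1 := by exact_mod_cast h
  omega

variable (r : ℕ) [r.AtLeastTwo]

theorem cast_r_ne_zero : (r : ℂ) ≠ 0 := by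
  have := Nat.AtLeastTwo.prop (n := r)
  exact_mod_cast (by omega : r ≠ 0)

theorem qPow_add_r (x : ℂ) : qPow r (x + r) = -qPow r x := by
  rw [qPow_add, qPow_r, mul_neg_one]

theorem qBr_add_r (x : ℂ) : qBr r (x + r) = -qBr r x := by
  have h : qPow r (-(x + r)) = -qPow r (-x) := by
    rw [← neg_neg (qPow r (-(x + r))), ← qPow_add_r]; ring_nf
  rw [qBr, qBr, qPow_add_r, h]; ring

theorem qBr_eq_zero {x : ℂ} (h : qBr r x = 0) : ∃ n : ℤ, x = n * r := by
  have h1 : qPow r (2 * x) = 1 := by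
    have h2 : qPow r x = qPow r (-x) := sub_eq_zero.mp h
    rw [two_mul, qPow_add]; nth_rewrite 2 [h2]; rw [← qPow_add, add_neg_cancel, qPow_zero]
  obtain ⟨n, hn⟩ := Complex.exp_eq_one_iff.mp h1
  refine ⟨n, ?_⟩
  have hr := cast_r_ne_zero r
  have hp : (2 * Real.pi * Complex.I : ℂ) ≠ 0 := Complex.two_pi_I_ne_zero
  rw [div_eq_iff hr] at hn
  apply mul_left_cancel₀ hp
  linear_combination hn

theorem qBr_ne_zero {x : ℂ} (hx : x ∉ Set.range (Int.cast : ℤ → ℂ)) : qBr r x ≠ 0 := by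
  intro h
  obtain ⟨n, rfl⟩ := qBr_eq_zero r h
  exact hx ⟨n * r, by push_cast; rfl⟩

theorem qBr_nat_ne_zero {k : ℕ} (h0 : 0 < k) (hk : k < r) : qBr r k ≠ 0 := by
  intro h
  obtain ⟨n, hn⟩ := qBr_eq_zero r h
  have hn' : (k : ℤ) = n * r := by exact_mod_cast hn
  have := Int.le_of_dvd (by exact_mod_cast h0) (Dvd.intro_left n hn'.symm)
  omega

omit [r.AtLeastTwo] in
theorem notMem_int_add {x : ℂ} (hx : x ∉ Set.range (Int.cast : ℤ → ℂ)) (n : ℤ) :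
    x + n ∉ Set.range (Int.cast : ℤ → ℂ) := by
  rintro ⟨m, hm⟩
  exact hx ⟨m - n, by push_cast; rw [hm]; ring⟩

theorem qBr_mul_r_ne_zero {x : ℂ} (hx : x ∉ Set.range (Int.cast : ℤ → ℂ)) : qBr r (r * x) ≠ 0 := by
  intro h
  obtain ⟨n, hn⟩ := qBr_eq_zero r h
  exact hx ⟨n, mul_left_cancel₀ (cast_r_ne_zero r) (by rw [hn]; ring)⟩

theorem qBr_add_r_sub_ne_zero {x : ℂ} (hx : x ∉ Set.range (Int.cast : ℤ → ℂ)) (k : ℕ) :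
    qBr r (x + r - k) ≠ 0 := by
  have := notMem_int_add hx (r - k)
  push_cast at this
  rw [← add_sub_assoc] at this
  exact qBr_ne_zero r this

/-- The constant `(-1) ^ (r + 1) ∏_{j < r} q ^ (-j)` (a power of `i`), which relates the product of
the `{x + j}`, `0 ≤ j < r`, to `{r x}`. -/
def prodConst (r : ℕ) : ℂ := (-1) ^ (r + 1) * ∏ j ∈ Finset.range r, qPow r (-(j : ℂ))

omit [r.AtLeastTwo] in
theorem qPow_two_nat (j : ℕ) : qPow r (2 * j) = (qPow r 1 ^ 2) ^ j := by
  rw [← pow_mul, ← qPow_nat_mul]; congr 1; push_cast; ring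

theorem prodConst_sq : prodConst r ^ 2 = (-1) ^ (r - 1) := by
  have h2 := Nat.AtLeastTwo.prop (n := r)
  have h : (∏ j ∈ Finset.range r, qPow r (-(j : ℂ))) ^ 2 = (-1) ^ (r - 1) := by
    have e : ∀ n : ℕ, (∏ j ∈ Finset.range n, qPow r (-(j : ℂ))) ^ 2 =
        qPow r (-(n * (n - 1) : ℂ)) := by
      intro n
      induction n with
      | zero => simp [qPow_zero]
      | succ n ih =>
        rw [Finset.prod_range_succ, mul_pow, ih, ← qPow_nat_mul, ← qPow_add]
        congr 1; push_cast; ring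
    obtain ⟨m, rfl⟩ : ∃ m, r = m + 1 := ⟨r - 1, by omega⟩
    rw [e, qPow_neg, add_tsub_cancel_right]
    have : (((m + 1 : ℕ) : ℂ) * (((m + 1 : ℕ) : ℂ) - 1)) = (m : ℕ) * ((m + 1 : ℕ) : ℂ) := by
      push_cast; ring
    rw [this, qPow_nat_mul, qPow_r, ← inv_pow, inv_neg_one]
  rw [prodConst, mul_pow, h, ← pow_mul, mul_comm (r + 1) 2, pow_mul]
  simp

theorem prodConst_ne_zero : prodConst r ≠ 0 := by
  intro h
  have := prodConst_sq r
  rw [h, zero_pow two_ne_zero] at this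
  exact pow_ne_zero _ (neg_ne_zero.mpr one_ne_zero) this.symm

theorem prod_qBr_add (x : ℂ) :
    ∏ j ∈ Finset.range r, qBr r (x + j) = prodConst r * qBr r (r * x) := by
  have h2 := Nat.AtLeastTwo.prop (n := r)
  have e : ∀ j : ℕ, qBr r (x + j) =
      (-1) * qPow r (-(j : ℂ)) * (qPow r (-x) - (qPow r 1 ^ 2) ^ j * qPow r x) := by
    intro j
    rw [← qPow_two_nat, qBr, mul_sub, ← mul_assoc, mul_assoc (-1), ← qPow_add, mul_assoc,
      mul_assoc (-1), ← qPow_add, ← qPow_add]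
    ring_nf
  have key := (q_sq_primitive r).pow_sub_pow_eq_prod_sub_mul (qPow r (-x)) (qPow r x) (by omega)
  rw [← qPow_nat_mul, ← qPow_nat_mul] at key
  have key2 : ∏ ζ ∈ Polynomial.nthRootsFinset r (1 : ℂ), (qPow r (-x) - ζ * qPow r x) =
      ∏ j ∈ Finset.range r, (qPow r (-x) - (qPow r 1 ^ 2) ^ j * qPow r x) := by
    symm
    refine Finset.prod_nbij (fun j => (qPow r 1 ^ 2) ^ j) (fun j _ => ?_) ?_ ?_ (fun _ _ => rfl)
    · rw [Polynomial.mem_nthRootsFinset (by omega), ← pow_mul, mul_comm, pow_mul,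
        (q_sq_primitive r).pow_eq_one, one_pow]
    · simpa using (q_sq_primitive r).injOn_pow
    · intro z hz
      rw [Finset.mem_coe, Polynomial.mem_nthRootsFinset (by omega)] at hz
      have : NeZero r := ⟨by omega⟩
      obtain ⟨i, hi, rfl⟩ := (q_sq_primitive r).eq_pow_of_pow_eq_one hz
      exact ⟨i, by simpa using hi, rfl⟩
  rw [Finset.prod_congr rfl fun j _ => e j, Finset.prod_mul_distrib, Finset.prod_mul_distrib,
    Finset.prod_const, Finset.card_range, ← key2, ← key, prodConst, qBr, mul_neg]
  ring

theorem prod_qBr_nat : ∏ k ∈ Finset.Icc 1 (r - 1), qBr r (k : ℂ) = prodConst r * r := by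
  have h2 := Nat.AtLeastTwo.prop (n := r)
  have hz := q_sq_primitive r
  have e : ∀ j : ℕ, qBr r ((j : ℂ)) =
      (-1) * qPow r (-(j : ℂ)) * (1 - (qPow r 1 ^ 2) ^ j) := by
    intro j
    rw [← qPow_two_nat, qBr, mul_sub, mul_assoc (-1) _ (qPow r (2 * j)), ← qPow_add]
    ring_nf
  have hs : ∀ f : ℕ → ℂ, ∏ k ∈ Finset.Icc 1 (r - 1), f k =
      ∏ k ∈ Finset.range (r - 1), f (k + 1) := by
    intro f
    rw [Finset.range_eq_Ico, Finset.prod_Ico_add' f 0 (r - 1) 1]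
    rfl
  have hc : prodConst r =
      (-1) ^ (r - 1) * ∏ k ∈ Finset.range (r - 1), qPow r (-((k + 1 : ℕ) : ℂ)) := by
    rw [prodConst]
    nth_rewrite 2 [← Nat.sub_add_cancel (show 1 ≤ r by omega)]
    rw [Finset.prod_range_succ', Nat.cast_zero, neg_zero, qPow_zero, mul_one,
      show r + 1 = r - 1 + 2 by omega, pow_add]
    simp
  obtain ⟨m, hm⟩ : ∃ m, r = m + 1 := ⟨r - 1, by omega⟩
  have hm' : r - 1 = m := by omega
  rw [hs, hc, Finset.prod_congr rfl fun j _ => e (j + 1), Finset.prod_mul_distrib,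
    Finset.prod_mul_distrib, Finset.prod_const, Finset.card_range]
  congr 1
  have := IsPrimitiveRoot.prod_one_sub_pow_eq_order (n := m) (μ := qPow r 1 ^ 2) (by rwa [← hm])
  rw [hm', this, hm]
  push_cast; rfl

theorem prod_qBr_sub (α : ℂ) : (∏ k ∈ Finset.Icc 1 (r - 1), qBr r (α + r - k)) * qBr r α =
    prodConst r * qBr r (r * α) := by
  have h2 := Nat.AtLeastTwo.prop (n := r)
  rw [← prod_qBr_add]
  obtain ⟨m, hm⟩ : ∃ m, r = m + 1 := ⟨r - 1, by omega⟩
  have hm' : r - 1 = m := by omega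
  have : Finset.range r = Finset.range (m + 1) := by rw [hm]
  rw [this, Finset.prod_range_succ', Nat.cast_zero, add_zero, hm']
  congr 1
  refine Finset.prod_bij' (fun k _ => m - k) (fun j _ => m - j) ?_ ?_ ?_ ?_ ?_
  · intro k hk; simp only [Finset.mem_Icc, Finset.mem_range] at *; omega
  · intro k hk; simp only [Finset.mem_Icc, Finset.mem_range] at *; omega
  · intro k hk; simp only [Finset.mem_Icc] at *; omega
  · intro k hk; simp only [Finset.mem_range] at *; omega
  · intro k hk
    simp only [Finset.mem_Icc] at hk
    congr 1
    have : (r : ℂ) = m + 1 := by rw [hm]; push_cast; rfl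
    rw [this]
    push_cast [Nat.cast_sub hk.2]
    ring

/-- The two forms of the modified dimension. -/
theorem prod_ratio {α : ℂ} (hα : α ∉ Set.range (Int.cast : ℤ → ℂ)) :
    ∏ k ∈ Finset.Icc 1 (r - 1), qBr r k / qBr r (α + r - k) = r * qBr r α / qBr r (r * α) := by
  have h1 := qBr_ne_zero r hα
  have h2 := qBr_mul_r_ne_zero r hα
  have h3 := prodConst_ne_zero r
  have h4 : ∏ k ∈ Finset.Icc 1 (r - 1), qBr r (α + r - k) ≠ 0 :=
    Finset.prod_ne_zero_iff.mpr fun k _ => qBr_add_r_sub_ne_zero r hα k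
  rw [Finset.prod_div_distrib, prod_qBr_nat, div_eq_div_iff h4 h2]
  linear_combination -(r : ℂ) * prod_qBr_sub r α

/-- `w_α - w_{α+2k} = -{k} {α+r+k} / {1}²`, written with `{α + k} = -{α + r + k}`. -/
theorem casimirScalar_sub (α : ℂ) (k : ℂ) :
    casimirScalar r α - casimirScalar r (α + 2 * k) = qBr r k * qBr r (α + k) / qBr r 1 ^ 2 := by
  rw [casimirScalar, casimirScalar, ← sub_div, ← neg_neg (qBr r (α + k)), ← qBr_add_r]
  congr 1
  simp only [qBr, sub_mul, mul_sub, neg_sub, ← qPow_add]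
  ring_nf

theorem prod_casimirScalar_sub (α : ℂ) :
    ∏ k ∈ Finset.Icc 1 (r - 1), (casimirScalar r α - casimirScalar r (α + 2 * k)) =
      (∏ k ∈ Finset.Icc 1 (r - 1), qBr r k) * (∏ k ∈ Finset.Icc 1 (r - 1), qBr r (α + r - k)) /
        qBr r 1 ^ (2 * r - 2) := by
  have h2 := Nat.AtLeastTwo.prop (n := r)
  have hrefl : ∏ k ∈ Finset.Icc 1 (r - 1), qBr r (α + r - k) =
      ∏ k ∈ Finset.Icc 1 (r - 1), qBr r (α + k) := by
    refine Finset.prod_bij' (fun k _ => r - k) (fun k _ => r - k) ?_ ?_ ?_ ?_ ?_ <;> intro k hk <;>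
      simp only [Finset.mem_Icc] at *
    · omega
    · omega
    · omega
    · omega
    · rw [Nat.cast_sub (by omega), add_sub_assoc]
  rw [hrefl, ← Finset.prod_mul_distrib]
  simp only [casimirScalar_sub]
  rw [Finset.prod_div_distrib, Finset.prod_const, Nat.card_Icc, ← pow_mul]
  congr 2
  omega

/-- The telescoping sum behind the partial trace of the projection of `V_α ⊗ V_β` onto its summand
of highest weight: up to the factor `-q ^ (b - 1) {c - b + 1}`, the terms are the differences
`T_{i+1} - T_i` for `T_i = q ^ (-i (c - b + 1)) {c - i} ∏_{j < i} ({b - 1 - j} / {c - 1 - j})`. -/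
theorem sum_qBr_telescope (b c : ℂ) (hc : c ∉ Set.range (Int.cast : ℤ → ℂ)) (n : ℕ) :
    -qPow r (b - 1) * qBr r (c - b + 1) * ∑ i ∈ Finset.range n, qPow r (-(i * (c - b + 2))) *
        ∏ j ∈ Finset.range i, (qBr r (b - 1 - j) / qBr r (c - 1 - j)) =
      qPow r (-(n * (c - b + 1))) * qBr r (c - n) *
        ∏ j ∈ Finset.range n, (qBr r (b - 1 - j) / qBr r (c - 1 - j)) - qBr r c := by
  induction n with
  | zero => simp [qPow_zero]
  | succ n ih =>
    rw [Finset.sum_range_succ, mul_add, ih, Finset.prod_range_succ]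
    have hne : qBr r (c - 1 - n) ≠ 0 := by
      have := notMem_int_add hc (-1 - n)
      push_cast at this
      rw [show c + (-1 - (n : ℂ)) = c - 1 - n by ring] at this
      exact qBr_ne_zero r this
    have e : c - ((n + 1 : ℕ) : ℂ) = c - 1 - n := by push_cast; ring
    rw [e]
    generalize ∏ j ∈ Finset.range n, (qBr r (b - 1 - j) / qBr r (c - 1 - j)) = P
    have key : -qPow r (b - 1) * qBr r (c - b + 1) * qPow r (-(n * (c - b + 2))) +
        qPow r (-(n * (c - b + 1))) * qBr r (c - n) =
        qPow r (-((n + 1 : ℕ) * (c - b + 1))) * qBr r (b - 1 - n) := by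
      simp only [qBr, mul_sub, sub_mul, neg_mul, ← qPow_add]
      push_cast
      ring_nf
    generalize qPow r (-((n + 1 : ℕ) * (c - b + 1))) = X at *
    have hX : X * qBr r (c - 1 - n) * (P * (qBr r (b - 1 - n) / qBr r (c - 1 - n))) =
        X * P * qBr r (b - 1 - n) := by field_simp
    rw [hX]
    linear_combination P * key

/-- The scalar of the partial trace over `V_β` of the projection of `V_α ⊗ V_β` onto `V_γ`, where
`γ = α + β + r - 1`. -/
theorem partialTrace_scalar {α β γ : ℂ} (hα : α ∉ Set.range (Int.cast : ℤ → ℂ))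
    (hγ : γ ∉ Set.range (Int.cast : ℤ → ℂ)) (h : γ = α + β + r - 1) :
    ∑ i ∈ Finset.range r, qPow r (-(r - 1) * (β + r - 1 - 2 * i)) * qPow r (-(i * (α + r - 1))) *
        ∏ j ∈ Finset.range i, (qBr r (β + r - 1 - j) / qBr r (γ + r - 1 - j)) =
      qBr r γ * qBr r (r * α) / (qBr r (r * γ) * qBr r α) := by
  have h2 := Nat.AtLeastTwo.prop (n := r)
  have key := sum_qBr_telescope r (β + r) (γ + r) (by simpa using notMem_int_add hγ r) r
  have hprod : ∀ x : ℂ, ∏ j ∈ Finset.range r, qBr r (x + r - 1 - j) =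
      prodConst r * qBr r (r * x) := by
    intro x
    rw [← prod_qBr_add, ← Finset.prod_range_reflect]
    refine Finset.prod_congr rfl fun j hj => ?_
    have := Finset.mem_range.mp hj
    rw [Nat.cast_sub (by omega), Nat.cast_sub (by omega)]
    push_cast; ring_nf
  have hpow : ∀ (x : ℂ) (m : ℕ), qPow r (x + 2 * (m * r)) = qPow r x := by
    intro x m
    rw [qPow_add, mul_left_comm, qPow_nat_mul, two_mul, qPow_add, qPow_r]; simp
  have hs : ∑ i ∈ Finset.range r, qPow r (-(r - 1) * (β + r - 1 - 2 * i)) *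
        qPow r (-(i * (α + r - 1))) *
        ∏ j ∈ Finset.range i, (qBr r (β + r - 1 - j) / qBr r (γ + r - 1 - j)) =
      qPow r (-(r - 1) * (β + r - 1)) *
        ∑ i ∈ Finset.range r, qPow r (-(i * (γ + r - (β + r) + 2))) *
        ∏ j ∈ Finset.range i, (qBr r (β + r - 1 - j) / qBr r (γ + r - 1 - j)) := by
    rw [Finset.mul_sum]
    refine Finset.sum_congr rfl fun i _ => ?_
    rw [← mul_assoc, ← qPow_add, ← qPow_add]
    congr 1
    rw [← hpow (_ + -(i * (γ + r - (β + r) + 2))) i, h]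
    congr 1
    ring
  rw [hs]
  generalize ∑ i ∈ Finset.range r, qPow r (-(i * (γ + r - (β + r) + 2))) *
        ∏ j ∈ Finset.range i, (qBr r (β + r - 1 - j) / qBr r (γ + r - 1 - j)) = S at key
  rw [Finset.prod_div_distrib, hprod, hprod, mul_div_mul_left _ _ (prodConst_ne_zero r),
    add_sub_cancel_right, qBr_add_r, show γ + r - (β + r) + 1 = α + r by rw [h]; ring,
    qBr_add_r] at key
  have hα' := qBr_ne_zero r hα
  have hrγ := qBr_mul_r_ne_zero r hγ
  have hA : qPow r (-(r - 1) * (β + r - 1)) = qPow r (-r * β - r * r + r) * qPow r (β + r - 1) := by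
    rw [← qPow_add]; ring_nf
  have hn : ∀ x : ℂ, qPow r x = -qPow r (x + r) := fun x => by rw [qPow_add_r, neg_neg]
  have e1 : qPow r (-r * β - r * r + r) * (qPow r (-(r * (α + r))) * qBr r (r * β)) =
      qPow r (-(r * α) - 2 * (r * β)) - qPow r (-(r * α)) := by
    simp only [qBr, mul_sub, ← qPow_add]
    rw [← hpow (-r * β - r * r + r + (-(r * (α + r)) + r * β)) r,
      ← hpow (-r * β - r * r + r + (-(r * (α + r)) + -(r * β))) r, hn (-(r * α) - 2 * (r * β)),
      hn (-(r * α))]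
    ring_nf
  have e2 : qPow r (-r * β - r * r + r) * qBr r (r * γ) =
      qPow r (r * α) - qPow r (-(r * α) - 2 * (r * β)) := by
    simp only [qBr, mul_sub, ← qPow_add]
    rw [← hpow (-r * β - r * r + r + -(r * γ)) (r - 1), Nat.cast_sub (by omega), h]
    push_cast
    ring_nf
  have e3 : qPow r (-r * β - r * r + r) * (qPow r (-(r * (α + r))) * qBr r (r * β) +
      qBr r (r * γ)) = qBr r (r * α) := by
    rw [mul_add, e1, e2, qBr]; ring
  have e4 : qPow r (β + r - 1) * qBr r α * S * qBr r (r * γ) =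
      qBr r γ * (qPow r (-(r * (α + r))) * qBr r (r * β) + qBr r (r * γ)) := by
    have hk : qBr r (r * β) / qBr r (r * γ) * qBr r (r * γ) = qBr r (r * β) := by field_simp
    linear_combination qBr r (r * γ) * key + qPow r (-(r * (α + r))) * qBr r γ * hk
  rw [hA, eq_div_iff (mul_ne_zero hrγ hα'), ← e3]
  linear_combination qPow r (-r * β - r * r + r) * e4
end Brackets

/-! ### The standard basis of a highest weight module -/

section StandardBasis

variable (r : ℕ)

/-- The standard basis vector `v_i` of `V_α`, with the convention `v_i = 0` for `i ≥ r`. -/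
def hwVec (i : ℕ) : Fin r → ℂ := fun j => if (j : ℕ) = i then 1 else 0

theorem hwVec_apply (i : ℕ) (j : Fin r) : hwVec r i j = if (j : ℕ) = i then 1 else 0 := rfl

theorem hwVec_self (j : Fin r) : hwVec r j j = 1 := if_pos rfl

theorem hwVec_coe (j : Fin r) : hwVec r j = Pi.single j 1 := by
  funext i
  rw [hwVec_apply, Pi.single_apply]
  simp only [Fin.ext_iff]

theorem hwVec_of_le {i : ℕ} (h : r ≤ i) : hwVec r i = 0 := by
  funext j
  rw [hwVec_apply, if_neg (by omega)]; rfl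

theorem vF_hwVec (i : ℕ) : vF r (hwVec r i) = hwVec r (i + 1) := by
  funext j
  rw [vF_apply]
  split_ifs with h
  · simp only [hwVec_apply]
    congr 1
    apply propext
    omega
  · rw [hwVec_apply, if_neg (by omega)]

theorem vF_pow_hwVec (i k : ℕ) : (vF r ^ k) (hwVec r i) = hwVec r (i + k) := by
  induction k with
  | zero => rfl
  | succ k ih => rw [pow_succ', Module.End.mul_apply, ih, vF_hwVec]; rfl

variable (α : ℂ)

theorem vK_hwVec (i : ℕ) :
    vK r α (hwVec r i) = qPow r (α + r - 1 - 2 * i) • hwVec r i := by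
  funext j
  rw [vK_apply, Pi.smul_apply, smul_eq_mul, hwVec_apply]
  split_ifs with h
  · rw [h]
  · simp

theorem vKinv_hwVec (i : ℕ) :
    vKinv r α (hwVec r i) = qPow r (-(α + r - 1 - 2 * i)) • hwVec r i := by
  funext j
  rw [vKinv_apply, Pi.smul_apply, smul_eq_mul, hwVec_apply]
  split_ifs with h
  · rw [h]
  · simp

theorem vE_hwVec_zero : vE r α (hwVec r 0) = 0 := by
  funext j
  rw [vE_apply]
  split_ifs with h
  · simp [hwVec_apply]
  · rfl

theorem vE_hwVec_succ [r.AtLeastTwo] (i : ℕ) :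
    vE r α (hwVec r (i + 1)) = vCoeff r α (i + 1) • hwVec r i := by
  funext j
  rw [vE_apply, Pi.smul_apply, smul_eq_mul]
  split_ifs with h
  · simp only [hwVec_apply, Nat.add_right_cancel_iff]
    split_ifs with h'
    · rw [h']
    · simp
  · rw [hwVec_apply]
    split_ifs with h'
    · have : i + 1 = r := by omega
      rw [this, vCoeff, qBr_r]; simp
    · simp

variable [r.AtLeastTwo]

theorem vCoeff_ne_zero {α : ℂ} (hα : α ∉ Set.range (Int.cast : ℤ → ℂ)) {i : ℕ} (h0 : 0 < i)
    (hi : i < r) : vCoeff r α i ≠ 0 :=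
  div_ne_zero (mul_ne_zero (qBr_nat_ne_zero r h0 hi) (qBr_add_r_sub_ne_zero r hα i))
    (pow_ne_zero _ (qBr_one_ne_zero r))

theorem vE_pow_hwVec (k : ℕ) : (vE r α ^ k) (hwVec r k) =
    (∏ j ∈ Finset.range k, vCoeff r α (j + 1)) • hwVec r 0 := by
  induction k with
  | zero => simp
  | succ k ih =>
    rw [pow_succ, Module.End.mul_apply, vE_hwVec_succ, map_smul, ih, smul_smul,
      Finset.prod_range_succ, mul_comm]

/-- The action of `Ū` on `V_α`, on the underlying space `Fin r → ℂ`. -/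
def hwRep : Ubar r →ₐ[ℂ] Module.End ℂ (Fin r → ℂ) := (WeightModule.highestWeight r α).ρ

theorem hwRep_E : hwRep r α (Ubar.E r) = vE r α := by
  unfold hwRep WeightModule.highestWeight; dsimp only; rw [Ubar.lift_E]
theorem hwRep_F : hwRep r α (Ubar.F r) = vF r := by
  unfold hwRep WeightModule.highestWeight; dsimp only; rw [Ubar.lift_F]
theorem hwRep_K : hwRep r α (Ubar.K r) = vK r α := by
  unfold hwRep WeightModule.highestWeight; dsimp only; rw [Ubar.lift_K]
theorem hwRep_Kinv : hwRep r α (Ubar.Kinv r) = vKinv r α := by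
  unfold hwRep WeightModule.highestWeight; dsimp only; rw [Ubar.lift_Kinv]

end StandardBasis

/-! ### Slices of the coproduct -/

namespace Ubar

variable (r : ℕ)

section sliceT

variable {A : Type*} [Ring A] [Algebra ℂ A]

/-- The map `id ⊗ f : A ⊗ A → A` for a linear form `f`. -/
def sliceT (f : A →ₗ[ℂ] ℂ) : A ⊗[ℂ] A →ₗ[ℂ] A :=
  (TensorProduct.rid ℂ A).toLinearMap ∘ₗ f.lTensor A

theorem sliceT_tmul (f : A →ₗ[ℂ] ℂ) (x y : A) : sliceT f (x ⊗ₜ y) = f y • x := by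
  simp [sliceT]

theorem sliceT_mul_tmul (f : A →ₗ[ℂ] ℂ) (z : A ⊗[ℂ] A) (u v : A) :
    sliceT f (z * u ⊗ₜ v) = sliceT (f ∘ₗ LinearMap.mulRight ℂ v) z * u := by
  induction z using TensorProduct.induction_on with
  | zero => simp
  | add x y hx hy => rw [add_mul, map_add, hx, hy, map_add, add_mul]
  | tmul x y => simp [sliceT_tmul, Algebra.TensorProduct.tmul_mul_tmul]

theorem sliceT_tmul_mul (f : A →ₗ[ℂ] ℂ) (z : A ⊗[ℂ] A) (u v : A) :
    sliceT f (u ⊗ₜ v * z) = u * sliceT (f ∘ₗ LinearMap.mulLeft ℂ v) z := by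
  induction z using TensorProduct.induction_on with
  | zero => simp
  | add x y hx hy => rw [mul_add, map_add, hx, hy, map_add, mul_add]
  | tmul x y => simp [sliceT_tmul, Algebra.TensorProduct.tmul_mul_tmul]

theorem sliceT_smul (c : ℂ) (f : A →ₗ[ℂ] ℂ) (z : A ⊗[ℂ] A) :
    sliceT (c • f) z = c • sliceT f z := by
  simp [sliceT]

theorem sliceT_zero (z : A ⊗[ℂ] A) : sliceT (0 : A →ₗ[ℂ] ℂ) z = 0 := by
  simp [sliceT]

end sliceT

variable [r.AtLeastTwo]

/-- The map `x ↦ (id ⊗ f) (Δ x)`. -/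
def slice (f : Ubar r →ₗ[ℂ] ℂ) : Ubar r →ₗ[ℂ] Ubar r := sliceT f ∘ₗ (comul r).toLinearMap

variable {r} (f g : Ubar r →ₗ[ℂ] ℂ)

theorem slice_one : slice r f 1 = f 1 • 1 := by
  simp [slice, Algebra.TensorProduct.one_def, sliceT_tmul]

theorem slice_F_mul (hf : ∀ y, f (F r * y) = 0) (x : Ubar r) :
    slice r f (F r * x) = F r * slice r f x := by
  have h1 : f ∘ₗ LinearMap.mulLeft ℂ (F r) = 0 := LinearMap.ext fun y => hf y
  simp [slice, add_mul, sliceT_tmul_mul, h1, sliceT_zero]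

theorem slice_mul_E {c d : ℂ} (hK : ∀ y, f (y * K r) = c * f y) (hE : ∀ y, f (y * E r) = d * g y)
    (x : Ubar r) : slice r f (x * E r) = c • (slice r f x * E r) + d • slice r g x := by
  have h1 : f ∘ₗ LinearMap.mulRight ℂ (K r) = c • f := LinearMap.ext fun y => hK y
  have h2 : f ∘ₗ LinearMap.mulRight ℂ (E r) = d • g := LinearMap.ext fun y => hE y
  simp [slice, mul_add, sliceT_mul_tmul, h1, h2, sliceT_smul]

theorem slice_mul_K {c : ℂ} (hK : ∀ y, f (y * K r) = c * f y) (x : Ubar r) :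
    slice r f (x * K r) = c • (slice r f x * K r) := by
  have h1 : f ∘ₗ LinearMap.mulRight ℂ (K r) = c • f := LinearMap.ext fun y => hK y
  simp [slice, sliceT_mul_tmul, h1, sliceT_smul]

theorem slice_mul_Kinv {c : ℂ} (hK : ∀ y, f (y * Kinv r) = c * f y) (x : Ubar r) :
    slice r f (x * Kinv r) = c • (slice r f x * Kinv r) := by
  have h1 : f ∘ₗ LinearMap.mulRight ℂ (Kinv r) = c • f := LinearMap.ext fun y => hK y
  simp [slice, sliceT_mul_tmul, h1, sliceT_smul]

variable (r)

theorem r_pos : 0 < r := by have := Nat.AtLeastTwo.prop (n := r); omega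

/-- The matrix coefficient `x ↦ ⟨v_0^*, x v_j⟩` of `V_α`. -/
def topCoeff (α : ℂ) (j : ℕ) : Ubar r →ₗ[ℂ] ℂ :=
  LinearMap.proj (⟨0, r_pos r⟩ : Fin r) ∘ₗ LinearMap.applyₗ (R := ℂ) (hwVec r j) ∘ₗ
    (hwRep r α).toLinearMap

variable (α : ℂ)

theorem topCoeff_apply (j : ℕ) (x : Ubar r) : topCoeff r α j x =
    hwRep r α x (hwVec r j) ⟨0, r_pos r⟩ := rfl

theorem topCoeff_one (j : ℕ) : topCoeff r α j 1 = if j = 0 then 1 else 0 := by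
  rw [topCoeff_apply, map_one, Module.End.one_apply, hwVec_apply]
  simp [eq_comm]

theorem topCoeff_F_mul (j : ℕ) (y : Ubar r) : topCoeff r α j (F r * y) = 0 := by
  rw [topCoeff_apply, map_mul, Module.End.mul_apply, hwRep_F]
  exact vF_pow_apply r 1 _ _ one_pos

theorem topCoeff_mul_K (j : ℕ) (y : Ubar r) :
    topCoeff r α j (y * K r) = qPow r (α + r - 1 - 2 * j) * topCoeff r α j y := by
  rw [topCoeff_apply, map_mul, Module.End.mul_apply, hwRep_K, vK_hwVec, map_smul]
  rfl

theorem topCoeff_mul_Kinv (j : ℕ) (y : Ubar r) :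
    topCoeff r α j (y * Kinv r) = qPow r (-(α + r - 1 - 2 * j)) * topCoeff r α j y := by
  rw [topCoeff_apply, map_mul, Module.End.mul_apply, hwRep_Kinv, vKinv_hwVec, map_smul]
  rfl

theorem topCoeff_zero_mul_E (y : Ubar r) : topCoeff r α 0 (y * E r) = 0 * topCoeff r α 0 y := by
  rw [topCoeff_apply, map_mul, Module.End.mul_apply, hwRep_E, vE_hwVec_zero, map_zero]
  simp

theorem topCoeff_one_mul_E (y : Ubar r) :
    topCoeff r α 1 (y * E r) = vCoeff r α 1 * topCoeff r α 0 y := by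
  rw [topCoeff_apply, map_mul, Module.End.mul_apply, hwRep_E, vE_hwVec_succ, map_smul]
  rfl

theorem slice_topCoeff_F_pow_mul (j n : ℕ) (x : Ubar r) :
    slice r (topCoeff r α j) (F r ^ n * x) = F r ^ n * slice r (topCoeff r α j) x := by
  induction n with
  | zero => simp
  | succ n ih => rw [pow_succ', mul_assoc, slice_F_mul _ (topCoeff_F_mul r α j), ih, mul_assoc]

theorem slice_topCoeff_mul_K_pow (j l m : ℕ) (x : Ubar r) :
    slice r (topCoeff r α j) (x * (K r ^ l * Kinv r ^ m)) =
      (qPow r (α + r - 1 - 2 * j) ^ l * qPow r (-(α + r - 1 - 2 * j)) ^ m) •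
        (slice r (topCoeff r α j) x * (K r ^ l * Kinv r ^ m)) := by
  have h1 : ∀ (l : ℕ) (x : Ubar r), slice r (topCoeff r α j) (x * K r ^ l) =
      qPow r (α + r - 1 - 2 * j) ^ l • (slice r (topCoeff r α j) x * K r ^ l) := by
    intro l
    induction l with
    | zero => simp
    | succ l ih =>
      intro x
      rw [pow_succ, ← mul_assoc, slice_mul_K _ (topCoeff_mul_K r α j), ih, smul_mul_assoc,
        smul_smul, mul_assoc, ← pow_succ']
  have h2 : ∀ (l : ℕ) (x : Ubar r), slice r (topCoeff r α j) (x * Kinv r ^ l) =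
      qPow r (-(α + r - 1 - 2 * j)) ^ l • (slice r (topCoeff r α j) x * Kinv r ^ l) := by
    intro l
    induction l with
    | zero => simp
    | succ l ih =>
      intro x
      rw [pow_succ, ← mul_assoc, slice_mul_Kinv _ (topCoeff_mul_Kinv r α j), ih, smul_mul_assoc,
        smul_smul, mul_assoc, ← pow_succ']
  rw [← mul_assoc, h2, h1, smul_mul_assoc, smul_smul, mul_assoc, mul_comm]

theorem slice_topCoeff_zero_E_pow (m : ℕ) : slice r (topCoeff r α 0) (E r ^ m) =
    qPow r (α + r - 1) ^ m • E r ^ m := by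
  induction m with
  | zero => simp [slice_one, topCoeff_one]
  | succ m ih =>
    rw [pow_succ, slice_mul_E _ _ (topCoeff_mul_K r α 0) (topCoeff_zero_mul_E r α), ih,
      smul_mul_assoc, smul_smul, pow_succ']
    simp

theorem slice_topCoeff_one_E_pow (m : ℕ) : slice r (topCoeff r α 1) (E r ^ (m + 1)) =
    (vCoeff r α 1 * qPow r (α + r - 1) ^ m * ∑ i ∈ Finset.range (m + 1), qPow r (-2) ^ i) •
      E r ^ m := by
  have h1 : qPow r (α + r - 1 - 2 * (1 : ℕ)) = qPow r (-2) * qPow r (α + r - 1) := by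
    rw [← qPow_add]; push_cast; ring_nf
  induction m with
  | zero =>
    have := slice_mul_E _ _ (topCoeff_mul_K r α 1) (topCoeff_one_mul_E r α) 1
    rw [one_mul] at this
    simp [this, slice_one, topCoeff_one]
  | succ m ih =>
    rw [pow_succ, slice_mul_E _ _ (topCoeff_mul_K r α 1) (topCoeff_one_mul_E r α), ih,
      slice_topCoeff_zero_E_pow, smul_mul_assoc, ← pow_succ, smul_smul, smul_smul, ← add_smul, h1,
      Finset.sum_range_succ' _ (m + 1), pow_zero]
    simp only [pow_succ _ (_ : ℕ), ← Finset.sum_mul]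
    congr 1
    ring

end Ubar

/-! ### Powers of the Casimir element -/

namespace Ubar

variable (r : ℕ) [r.AtLeastTwo]

omit [r.AtLeastTwo] in
theorem K_comm_Kinv : Commute (K r) (Kinv r) := by
  rw [Commute, SemiconjBy, K_mul_Kinv, Kinv_mul_K]

omit [r.AtLeastTwo] in
theorem F_mul_E : F r * E r = casimir r - (((qBr r 1) ^ 2)⁻¹ * qPow r 1) • K r -
    (((qBr r 1) ^ 2)⁻¹ * qPow r (-1)) • Kinv r := by
  rw [casimir, smul_add, smul_smul, smul_smul]; abel

theorem E_mul_F : E r * F r = casimir r - (((qBr r 1) ^ 2)⁻¹ * qPow r (-1)) • K r -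
    (((qBr r 1) ^ 2)⁻¹ * qPow r 1) • Kinv r := by
  have h1 := qBr_one_ne_zero r
  have h := E_F_comm r
  rw [sub_eq_iff_eq_add, F_mul_E] at h
  have e : (qBr r 1)⁻¹ = ((qBr r 1) ^ 2)⁻¹ * qPow r 1 - ((qBr r 1) ^ 2)⁻¹ * qPow r (-1) := by
    rw [← mul_sub, ← qBr, sq, mul_inv, inv_mul_cancel_right₀ h1]
  rw [h, e]
  module

omit [r.AtLeastTwo] in
theorem casimir_comm_K : Commute (casimir r) (K r) := by
  have h : Commute (F r * E r) (K r) := by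
    rw [Commute, SemiconjBy, ← mul_assoc, K_F, smul_mul_assoc, mul_assoc (F r) (K r), K_E,
      mul_smul_comm, inv_smul_smul₀ (pow_ne_zero _ (qPow_ne_zero r 1)), mul_assoc]
  exact h.add_left ((((Commute.refl _).smul_left _).add_left
    ((K_comm_Kinv r).symm.smul_left _)).smul_left _)

omit [r.AtLeastTwo] in
theorem casimir_comm_Kinv : Commute (casimir r) (Kinv r) := by
  have h := casimir_comm_K r
  calc casimir r * Kinv r = Kinv r * (K r * casimir r) * Kinv r := by
        rw [← mul_assoc, Kinv_mul_K, one_mul]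
    _ = Kinv r * casimir r := by
        rw [← h.eq, mul_assoc, mul_assoc, K_mul_Kinv, mul_one]

theorem casimir_comm_E : Commute (casimir r) (E r) := by
  have h1 : casimir r = F r * E r + (((qBr r 1) ^ 2)⁻¹ * qPow r 1) • K r +
    (((qBr r 1) ^ 2)⁻¹ * qPow r (-1)) • Kinv r := by rw [F_mul_E]; abel
  have h2 : casimir r = E r * F r + (((qBr r 1) ^ 2)⁻¹ * qPow r (-1)) • K r +
    (((qBr r 1) ^ 2)⁻¹ * qPow r 1) • Kinv r := by rw [E_mul_F]; abel
  have hq : qPow r (-1) * qPow r 1 ^ 2 = qPow r 1 := by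
    rw [sq, ← mul_assoc, ← qPow_add, neg_add_cancel, qPow_zero, one_mul]
  have e : casimir r * E r = E r * casimir r := by
    nth_rewrite 1 [h2]
    rw [h1]
    simp only [add_mul, mul_add, smul_mul_assoc, mul_smul_comm, K_E, E_Kinv, smul_smul, mul_assoc,
      hq]
  exact e

theorem casimir_comm_F : Commute (casimir r) (F r) := by
  have h1 : casimir r = F r * E r + (((qBr r 1) ^ 2)⁻¹ * qPow r 1) • K r +
    (((qBr r 1) ^ 2)⁻¹ * qPow r (-1)) • Kinv r := by rw [F_mul_E]; abel
  have h2 : casimir r = E r * F r + (((qBr r 1) ^ 2)⁻¹ * qPow r (-1)) • K r +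
    (((qBr r 1) ^ 2)⁻¹ * qPow r 1) • Kinv r := by rw [E_mul_F]; abel
  have hq : qPow r (-1) * qPow r 1 ^ 2 = qPow r 1 := by
    rw [sq, ← mul_assoc, ← qPow_add, neg_add_cancel, qPow_zero, one_mul]
  have hK : F r * K r = qPow r 1 ^ 2 • (K r * F r) := by simpa using pow_K_F r 1
  have e : casimir r * F r = F r * casimir r := by
    nth_rewrite 1 [h1]
    rw [h2]
    simp only [add_mul, mul_add, smul_mul_assoc, mul_smul_comm, hK, Kinv_F, smul_smul, mul_assoc,
      hq]
  exact e

/-- The span of the elements `Ω ^ i K ^ l K ^ (-m)` with `i < k`. -/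
def casimirLow (k : ℕ) : Submodule ℂ (Ubar r) :=
  Submodule.span ℂ {x | ∃ i l m : ℕ, i < k ∧ x = casimir r ^ i * (K r ^ l * Kinv r ^ m)}

variable {r}

omit [r.AtLeastTwo] in
theorem casimirLow_mono {k k' : ℕ} (h : k ≤ k') : casimirLow r k ≤ casimirLow r k' :=
  Submodule.span_mono fun _ ⟨i, l, m, hi, hx⟩ => ⟨i, l, m, hi.trans_le h, hx⟩

omit [r.AtLeastTwo] in
theorem mul_mem_casimirLow {k k' : ℕ} {y : Ubar r}
    (hy : ∀ i l m : ℕ, i < k → casimir r ^ i * (K r ^ l * Kinv r ^ m) * y ∈ casimirLow r k')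
    {x : Ubar r} (hx : x ∈ casimirLow r k) : x * y ∈ casimirLow r k' := by
  induction hx using Submodule.span_induction with
  | mem x h => obtain ⟨i, l, m, hi, rfl⟩ := h; exact hy i l m hi
  | zero => rw [zero_mul]; exact zero_mem _
  | add a b _ _ ha hb => rw [add_mul]; exact add_mem ha hb
  | smul c a _ ha => rw [smul_mul_assoc]; exact Submodule.smul_mem _ _ ha

omit [r.AtLeastTwo] in
theorem mul_K_mem_casimirLow {k : ℕ} {x : Ubar r} (hx : x ∈ casimirLow r k) :
    x * K r ∈ casimirLow r k := by
  refine mul_mem_casimirLow (fun i l m hi => Submodule.subset_span ⟨i, l + 1, m, hi, ?_⟩) hx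
  rw [mul_assoc, mul_assoc, ← ((K_comm_Kinv r).pow_right m).eq, ← mul_assoc (K r ^ l), ← pow_succ]

omit [r.AtLeastTwo] in
theorem mul_Kinv_mem_casimirLow {k : ℕ} {x : Ubar r} (hx : x ∈ casimirLow r k) :
    x * Kinv r ∈ casimirLow r k :=
  mul_mem_casimirLow (fun i l m hi => Submodule.subset_span ⟨i, l, m + 1, hi, by
    rw [mul_assoc, mul_assoc, ← pow_succ]⟩) hx

omit [r.AtLeastTwo] in
theorem mul_K_pow_mem_casimirLow {k : ℕ} {x : Ubar r} (hx : x ∈ casimirLow r k) (l m : ℕ) :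
    x * (K r ^ l * Kinv r ^ m) ∈ casimirLow r k := by
  have h1 : ∀ l : ℕ, x * K r ^ l ∈ casimirLow r k := by
    intro l
    induction l with
    | zero => simpa using hx
    | succ l ih => rw [pow_succ, ← mul_assoc]; exact mul_K_mem_casimirLow ih
  induction m with
  | zero => simpa using h1 l
  | succ m ih =>
    rw [pow_succ, ← mul_assoc, ← mul_assoc, mul_assoc x]
    exact mul_Kinv_mem_casimirLow ih

omit [r.AtLeastTwo] in
theorem mul_casimir_mem_casimirLow {k : ℕ} {x : Ubar r} (hx : x ∈ casimirLow r k) :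
    x * casimir r ∈ casimirLow r (k + 1) := by
  refine mul_mem_casimirLow (fun i l m hi =>
    Submodule.subset_span ⟨i + 1, l, m, Nat.succ_lt_succ hi, ?_⟩) hx
  rw [mul_assoc, ← (((casimir_comm_K r).pow_right l).mul_right
    ((casimir_comm_Kinv r).pow_right m)).eq, ← mul_assoc, ← pow_succ]

omit [r.AtLeastTwo] in
/-- If `X Y = Ω - a K - b K⁻¹` and `Y` is an eigenvector of the conjugation by `K`, then
`X ^ k Y ^ k` is a polynomial in `Ω` with leading term `Ω ^ k`. -/
theorem pow_mul_pow_sub_mem_casimirLow {X Y : Ubar r} {a b c d : ℂ}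
    (h : X * Y = casimir r - a • K r - b • Kinv r) (hY : Commute (casimir r) Y)
    (hK : K r * Y = c • (Y * K r)) (hKi : Kinv r * Y = d • (Y * Kinv r)) (k : ℕ) :
    X ^ k * Y ^ k - casimir r ^ k ∈ casimirLow r k := by
  have hmem : ∀ k, X ^ k * Y ^ k - casimir r ^ k ∈ casimirLow r k →
      X ^ k * Y ^ k ∈ casimirLow r (k + 1) := by
    intro k hk
    rw [← sub_add_cancel (X ^ k * Y ^ k) (casimir r ^ k)]
    exact add_mem (casimirLow_mono k.le_succ hk)
      (Submodule.subset_span ⟨k, 0, 0, k.lt_succ_self, by simp⟩)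
  induction k with
  | zero => simp
  | succ k ih =>
    have e : X ^ (k + 1) * Y ^ (k + 1) - casimir r ^ (k + 1) =
        (X ^ k * Y ^ k - casimir r ^ k) * casimir r - (a * c ^ k) • (X ^ k * Y ^ k * K r) -
          (b * d ^ k) • (X ^ k * Y ^ k * Kinv r) := by
      have e1 : X ^ (k + 1) * Y ^ (k + 1) = X ^ k * ((X * Y) * Y ^ k) := by
        rw [pow_succ, pow_succ']; simp only [mul_assoc]
      rw [e1, h, sub_mul, sub_mul, (hY.pow_right k).eq, smul_mul_assoc, smul_mul_assoc,
        pow_mul_qcomm hK, pow_mul_qcomm hKi, sub_mul, smul_smul, smul_smul, mul_sub, mul_sub,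
        mul_smul_comm, mul_smul_comm, ← mul_assoc, ← mul_assoc, ← mul_assoc, ← pow_succ]
      abel
    rw [e]
    exact sub_mem (sub_mem (mul_casimir_mem_casimirLow ih)
      (Submodule.smul_mem _ _ (mul_K_mem_casimirLow (hmem k ih))))
      (Submodule.smul_mem _ _ (mul_Kinv_mem_casimirLow (hmem k ih)))

theorem F_pow_mul_E_pow_sub (k : ℕ) :
    F r ^ k * E r ^ k - casimir r ^ k ∈ casimirLow r k :=
  pow_mul_pow_sub_mem_casimirLow (F_mul_E r) (casimir_comm_E r) (K_E r) (Kinv_E r) k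

theorem E_pow_mul_F_pow_sub (k : ℕ) :
    E r ^ k * F r ^ k - casimir r ^ k ∈ casimirLow r k :=
  pow_mul_pow_sub_mem_casimirLow (E_mul_F r) (casimir_comm_F r) (K_F r) (Kinv_F r) k

end Ubar

/-! ### The values of a `G`-integral on powers of the Casimir element -/

namespace U

open Ubar

variable (r : ℕ) [r.AtLeastTwo]

theorem hwRep_K_pow (β : ℂ) : hwRep r (β - r + 1) (K r ^ r) = chi (β : G) • 1 := by
  rw [map_pow, hwRep_K]
  have hz : ∀ i : ℕ, qPow r (β - r + 1 + r - 1 - 2 * i) ^ r = chi (β : G) := by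
    intro i
    rw [← qPow_nat_mul, chi_eq_qPow r, show (r : ℂ) * (β - r + 1 + r - 1 - 2 * i) =
      r * β + -((2 * i : ℕ) * r) by push_cast; ring, qPow_add, qPow_neg,
      qPow_nat_mul r (2 * i), qPow_r]
    simp
  have h : ∀ (n : ℕ) (x : Fin r → ℂ) (i : Fin r), (vK r (β - r + 1) ^ n) x i =
      qPow r (β - r + 1 + r - 1 - 2 * (i : ℕ)) ^ n * x i := by
    intro n x i
    induction n with
    | zero => simp
    | succ n ih => rw [pow_succ', Module.End.mul_apply, vK_apply, ih, pow_succ', mul_assoc]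
  refine LinearMap.ext fun x => funext fun i => ?_
  rw [h, hz]; rfl

/-- The action on the highest weight module of highest weight `β` factors through `U_β`, so its
matrix coefficients are linear forms on `U_β`. -/
theorem exists_topCoeff (β : ℂ) (j : ℕ) : ∃ f : U r (β : G) →ₗ[ℂ] ℂ,
    ∀ x, f (proj r β x) = topCoeff r (β - r + 1) j x := by
  let φ : U r (β : G) →ₐ[ℂ] Module.End ℂ (Fin r → ℂ) :=
    RingQuot.liftAlgHom ℂ (s := GRel r (β : G)) ⟨hwRep r (β - r + 1), by
      intro x y h
      cases h
      rw [hwRep_K_pow, map_smul, map_one]⟩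
  have hφ : ∀ x, φ (proj r β x) = hwRep r (β - r + 1) x := fun x => by
    unfold φ proj
    erw [RingQuot.liftAlgHom_mkAlgHom_apply]
  refine ⟨LinearMap.proj (⟨0, r_pos r⟩ : Fin r) ∘ₗ
    LinearMap.applyₗ (R := ℂ) (hwVec r j) ∘ₗ φ.toLinearMap, fun x => ?_⟩
  rw [topCoeff_apply, ← hφ]
  rfl

section integral

variable {r} {μ : ∀ a : G, U r a →ₗ[ℂ] ℂ} (hμ : IsRightGIntegral r μ)
include hμ

/-- A linear form on the second factor, applied to the equation of a `G`-integral. -/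
theorem integral_slice (a b : G) (f : U r b →ₗ[ℂ] ℂ) (x : Ubar r) :
    μ a (proj r a (slice r (f ∘ₗ (proj r b).toLinearMap) x)) =
      f 1 * μ (a + b) (proj r (a + b) x) := by
  have h := congrArg f (hμ a b (proj r (a + b) x))
  rw [comul_proj, map_smul, smul_eq_mul, mul_comm] at h
  rw [← h, slice, LinearMap.comp_apply, AlgHom.toLinearMap_apply]
  generalize Ubar.comul r x = y
  induction y using TensorProduct.induction_on with
  | zero => simp
  | add y z hy hz => rw [map_add, map_add, map_add, hy, hz, map_add, map_add, map_add, map_add]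
  | tmul y z => simp [sliceT_tmul, mul_comm]

omit hμ in
theorem geom_sum_qPow_ne_zero {n : ℕ} (h0 : 0 < n) (hn : n < r) :
    ∑ i ∈ Finset.range n, qPow r (-2) ^ i ≠ 0 := by
  intro h
  have hz : IsPrimitiveRoot (qPow r (-2)) r := by
    have := (q_sq_primitive r).inv
    rwa [← qPow_nat_mul, ← qPow_neg, Nat.cast_ofNat, mul_one] at this
  have := geom_sum_mul (qPow r (-2)) n
  rw [h, zero_mul] at this
  exact hz.pow_ne_one_of_pos_of_lt h0.ne' hn (sub_eq_zero.mp this.symm)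

/-- A `G`-integral vanishes on `F ^ n E ^ m K ^ l` for `m ≤ r - 2`: slicing the coproduct of
`F ^ n E ^ (m + 1) K ^ l` by the matrix coefficient of a module `V_α` at `(v_0, v_1)`, which
vanishes at `1`, gives a nonzero multiple of `F ^ n E ^ m K ^ l`. -/
theorem integral_eq_zero (a : G) (n m l l' : ℕ) (hm : m < r - 1) :
    μ a (proj r a (F r ^ n * E r ^ m * (K r ^ l * Kinv r ^ l'))) = 0 := by
  have hr := Nat.AtLeastTwo.prop (n := r)
  -- any highest weight `β` for which `α = β - r + 1` is not an integer serves here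
  obtain ⟨f, hf⟩ := exists_topCoeff r (1 / 2 + r - 1) 1
  rw [show (1 / 2 + r - 1 - r + 1 : ℂ) = 1 / 2 by ring] at hf
  have h := integral_slice hμ a _ f (F r ^ n * E r ^ (m + 1) * (K r ^ l * Kinv r ^ l'))
  have hf1 : f 1 = 0 := by rw [← map_one (proj r _), hf, topCoeff_one, if_neg one_ne_zero]
  have hc : f ∘ₗ (proj r _).toLinearMap = topCoeff r (1 / 2) 1 := LinearMap.ext hf
  rw [hf1, zero_mul, hc, slice_topCoeff_mul_K_pow, slice_topCoeff_F_pow_mul,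
    slice_topCoeff_one_E_pow, mul_smul_comm, smul_mul_assoc, smul_smul, map_smul, map_smul,
    smul_eq_mul] at h
  refine (mul_eq_zero.mp h).resolve_left (mul_ne_zero
    (mul_ne_zero (pow_ne_zero _ (qPow_ne_zero _ _))
    (pow_ne_zero _ (qPow_ne_zero _ _))) (mul_ne_zero (mul_ne_zero
      (vCoeff_ne_zero r half_notMem_int one_pos (by omega)) (pow_ne_zero _ (qPow_ne_zero _ _)))
      (geom_sum_qPow_ne_zero m.succ_pos (by omega))))

/-- A `G`-integral vanishes on the elements of degree at most `r - 2` in the Casimir element. -/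
theorem integral_casimirLow (a : G) {k : ℕ} (hk : k ≤ r - 1) {x : Ubar r}
    (hx : x ∈ casimirLow r k) : μ a (proj r a x) = 0 := by
  induction k generalizing x with
  | zero =>
    have : casimirLow r 0 = ⊥ := by
      rw [casimirLow, Submodule.span_eq_bot]
      rintro _ ⟨i, l, m, hi, -⟩
      omega
    rw [this, Submodule.mem_bot] at hx
    rw [hx, map_zero, map_zero]
  | succ k ih =>
    induction hx using Submodule.span_induction with
    | zero => rw [map_zero, map_zero]
    | add x y _ _ hx hy => rw [map_add, map_add, hx, hy, add_zero]
    | smul c x _ hx => rw [map_smul, map_smul, hx, smul_zero]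
    | mem x h =>
      obtain ⟨i, l, m, hi, rfl⟩ := h
      rcases Nat.lt_succ_iff_lt_or_eq.mp hi with hi | rfl
      · exact ih (by omega) (Submodule.subset_span ⟨i, l, m, hi, rfl⟩)
      · have h1 := ih (by omega) (mul_K_pow_mem_casimirLow (F_pow_mul_E_pow_sub (r := r) i) l m)
        rw [sub_mul, map_sub, map_sub, integral_eq_zero hμ a i i l m (by omega), zero_sub,
          neg_eq_zero] at h1
        exact h1

theorem integral_casimir_pow_top (a : G) {x : Ubar r}
    (hx : x - casimir r ^ (r - 1) ∈ casimirLow r (r - 1)) :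
    μ a (proj r a (casimir r ^ (r - 1) * K r)) = μ a (proj r a (x * K r)) := by
  have h := integral_casimirLow hμ a le_rfl (mul_K_mem_casimirLow hx)
  rw [sub_mul, map_sub, map_sub, sub_eq_zero] at h
  exact h.symm

/-- The value of a `G`-integral at `F ^ (r - 1) E ^ (r - 1) K` is a multiple of the character `χ`
of `G`. -/
theorem integral_top (a : G) : μ a (proj r a (F r ^ (r - 1) * E r ^ (r - 1) * K r)) =
    chi a * μ 0 (proj r 0 (F r ^ (r - 1) * E r ^ (r - 1) * K r)) := by
  induction a using QuotientAddGroup.induction_on with | H β => ?_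
  obtain ⟨f, hf⟩ := exists_topCoeff r β 0
  have h := integral_slice hμ 0 _ f (F r ^ (r - 1) * E r ^ (r - 1) * K r)
  have hf1 : f 1 = 1 := by rw [← map_one (proj r _), hf, topCoeff_one, if_pos rfl]
  have hc : f ∘ₗ (proj r _).toLinearMap = topCoeff r (β - r + 1) 0 := LinearMap.ext hf
  have hr : r - 1 + 1 = r := r_pred r
  have hx : qPow r (β - r + 1 + r - 1) * qPow r (β - r + 1 + r - 1) ^ (r - 1) =
      chi (β : G) := by
    rw [← pow_succ', hr, ← qPow_nat_mul, chi_eq_qPow r]; ring_nf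
  rw [zero_add, hf1, one_mul, hc, slice_mul_K _ (topCoeff_mul_K r _ 0), slice_topCoeff_F_pow_mul,
    slice_topCoeff_zero_E_pow, mul_smul_comm, smul_mul_assoc, smul_smul, map_smul, map_smul,
    smul_eq_mul, Nat.cast_zero, mul_zero, sub_zero, hx] at h
  exact h.symm

theorem symmetrised_casimir_pow (a : G) {k : ℕ} (hk : k < r - 1) :
    symmetrised r μ a (proj r a (casimir r) ^ k) = 0 := by
  have h := integral_casimirLow hμ a le_rfl
    (Submodule.subset_span ⟨k, 1, 0, hk, rfl⟩ : _ ∈ casimirLow r (r - 1))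
  rw [pow_one, pow_zero, mul_one, ((casimir_comm_K r).pow_left k).eq] at h
  rw [symmetrised, LinearMap.comp_apply, LinearMap.mulLeft_apply, pivot, smul_mul_assoc, map_smul,
    ← map_pow, ← map_mul, h, smul_zero]

theorem symmetrised_casimir_pow_top (a : G) :
    symmetrised r μ a (proj r a (casimir r) ^ (r - 1)) =
      μ 0 (proj r 0 (E r ^ (r - 1) * F r ^ (r - 1) * K r)) := by
  have hchi : chi a ≠ 0 := by
    induction a using QuotientAddGroup.induction_on with | H β => ?_
    rw [chi_mk]; exact Complex.exp_ne_zero _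
  rw [symmetrised, LinearMap.comp_apply, LinearMap.mulLeft_apply, pivot, smul_mul_assoc, map_smul,
    ← map_pow, ← map_mul, ← ((casimir_comm_K r).pow_left _).eq,
    integral_casimir_pow_top hμ a (F_pow_mul_E_pow_sub _), integral_top hμ, smul_eq_mul,
    inv_mul_cancel_left₀ hchi, ← integral_casimir_pow_top hμ 0 (F_pow_mul_E_pow_sub _),
    integral_casimir_pow_top hμ 0 (E_pow_mul_F_pow_sub _)]

open Polynomial in
/-- The symmetrised integral of a polynomial of degree less than `r` in the Casimir element is
determined by its coefficient of degree `r - 1`. -/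
theorem symmetrised_aeval (a : G) {p : ℂ[X]} (hp : p.natDegree ≤ r - 1) :
    symmetrised r μ a (aeval (proj r a (casimir r)) p) =
      p.coeff (r - 1) * μ 0 (proj r 0 (E r ^ (r - 1) * F r ^ (r - 1) * K r)) := by
  rw [aeval_eq_sum_range' (Nat.lt_succ_of_le hp), map_sum, Finset.sum_range_succ,
    Finset.sum_eq_zero, zero_add, map_smul, symmetrised_casimir_pow_top hμ, smul_eq_mul]
  intro k hk
  rw [map_smul, symmetrised_casimir_pow hμ a (Finset.mem_range.mp hk), smul_zero]

end integral

end U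

open Polynomial in
theorem lagrangePoly_natDegree_le (r : ℕ) (α : ℂ) : (lagrangePoly r α).natDegree ≤ r - 1 := by
  refine (natDegree_C_mul_le _ _).trans ?_
  rw [natDegree_prod_of_monic _ _ fun k _ => monic_X_sub_C _]
  simp

open Polynomial in
theorem lagrangePoly_coeff (r : ℕ) (α : ℂ) : (lagrangePoly r α).coeff (r - 1) =
    (∏ k ∈ Finset.Icc 1 (r - 1), (casimirScalar r α - casimirScalar r (α + 2 * k)))⁻¹ := by
  have h := (monic_prod_of_monic (Finset.Icc 1 (r - 1))
    (fun k => X - C (casimirScalar r (α + 2 * (k : ℕ)))) fun k _ => monic_X_sub_C _).coeff_natDegree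
  rw [natDegree_prod_of_monic _ _ fun k _ => monic_X_sub_C _] at h
  simp only [natDegree_X_sub_C, Finset.sum_const, Nat.card_Icc, smul_eq_mul, mul_one,
    add_tsub_cancel_right] at h
  rw [lagrangePoly, coeff_C_mul, h, mul_one]

/-! ### Maps from and to highest weight modules -/

section Representations

variable (r : ℕ)

theorem hwVec_ext {V : Type*} [AddCommGroup V] [Module ℂ V] {f g : (Fin r → ℂ) →ₗ[ℂ] V}
    (h : ∀ i : ℕ, f (hwVec r i) = g (hwVec r i)) : f = g := by
  refine (Pi.basisFun ℂ (Fin r)).ext fun i => ?_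
  rw [Pi.basisFun_apply, ← hwVec_coe, h]

variable [r.AtLeastTwo]

omit [r.AtLeastTwo] in
theorem vCoeff_zero (α : ℂ) : vCoeff r α 0 = 0 := by simp [vCoeff, qBr]

theorem vCoeff_succ (α : ℂ) (i : ℕ) : vCoeff r α (i + 1) = vCoeff r α i +
    (qBr r 1)⁻¹ * (qPow r (α + r - 1 - 2 * i) - qPow r (-(α + r - 1 - 2 * i))) := by
  have h1 := qBr_one_ne_zero r
  have : qBr r ((i : ℂ) + 1) * qBr r (α + r - ((i : ℂ) + 1)) =
      qBr r i * qBr r (α + r - i) +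
        qBr r 1 * (qPow r (α + r - 1 - 2 * i) - qPow r (-(α + r - 1 - 2 * i))) := by
    simp only [qBr, mul_sub, sub_mul, ← qPow_add]
    ring_nf
  rw [vCoeff, vCoeff, Nat.cast_add, Nat.cast_one, this]
  field_simp

variable {r} {V : Type*} [AddCommGroup V] [Module ℂ V] (σ : Ubar r →ₐ[ℂ] Module.End ℂ V)

omit [r.AtLeastTwo] in
theorem act_E_F (v : V) : σ (Ubar.E r) (σ (Ubar.F r) v) = σ (Ubar.F r) (σ (Ubar.E r) v) +
    (qBr r 1)⁻¹ • (σ (Ubar.K r) v - σ (Ubar.Kinv r) v) := by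
  have h := DFunLike.congr_fun (congrArg σ (Ubar.E_F_comm r)) v
  simp only [map_sub, map_mul, map_smul, LinearMap.sub_apply, Module.End.mul_apply,
    LinearMap.smul_apply] at h
  rw [← h]; abel

omit [r.AtLeastTwo] in
theorem act_Kinv_of_K {v : V} {x : ℂ} (h : σ (Ubar.K r) v = qPow r x • v) :
    σ (Ubar.Kinv r) v = qPow r (-x) • v := by
  have h1 : σ (Ubar.Kinv r) (σ (Ubar.K r) v) = v := by
    rw [← Module.End.mul_apply, ← map_mul, Ubar.Kinv_mul_K, map_one, Module.End.one_apply]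
  rw [h, map_smul] at h1
  rw [qPow_neg, eq_inv_smul_iff₀ (qPow_ne_zero _ _), h1]

omit [r.AtLeastTwo] in
theorem qPow_neg_two : qPow r (-2) = (qPow r 1 ^ 2)⁻¹ := by
  rw [← qPow_nat_mul, ← qPow_neg]; norm_num

omit [r.AtLeastTwo] in
theorem act_K_F_pow {v : V} {x : ℂ} (h : σ (Ubar.K r) v = qPow r x • v) (i : ℕ) :
    σ (Ubar.K r) ((σ (Ubar.F r) ^ i) v) = qPow r (x - 2 * i) • (σ (Ubar.F r) ^ i) v := by
  induction i with
  | zero => simpa using h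
  | succ i ih =>
    have hKF : ∀ w, σ (Ubar.K r) (σ (Ubar.F r) w) =
        (qPow r 1 ^ 2)⁻¹ • σ (Ubar.F r) (σ (Ubar.K r) w) := fun w => by
      rw [← Module.End.mul_apply, ← map_mul, Ubar.K_F, map_smul, map_mul]; rfl
    rw [pow_succ', Module.End.mul_apply, hKF, ih, map_smul, smul_smul, ← qPow_neg_two, ← qPow_add]
    congr 2
    push_cast; ring

theorem act_E_F_pow {v : V} {α : ℂ} (hE : σ (Ubar.E r) v = 0)
    (hK : σ (Ubar.K r) v = qPow r (α + r - 1) • v) (i : ℕ) :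
    σ (Ubar.E r) ((σ (Ubar.F r) ^ (i + 1)) v) =
      vCoeff r α (i + 1) • (σ (Ubar.F r) ^ i) v := by
  have key : ∀ i : ℕ, σ (Ubar.E r) ((σ (Ubar.F r) ^ (i + 1)) v) =
      σ (Ubar.F r) (σ (Ubar.E r) ((σ (Ubar.F r) ^ i) v)) +
        ((qBr r 1)⁻¹ * (qPow r (α + r - 1 - 2 * i) - qPow r (-(α + r - 1 - 2 * i)))) •
          (σ (Ubar.F r) ^ i) v := by
    intro i
    rw [pow_succ', Module.End.mul_apply, act_E_F, act_K_F_pow σ hK,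
      act_Kinv_of_K σ (act_K_F_pow σ hK i), ← sub_smul, smul_smul]
  induction i with
  | zero => rw [key, pow_zero, Module.End.one_apply, hE, map_zero, vCoeff_succ, vCoeff_zero,
      zero_add, zero_add]
  | succ i ih =>
    rw [key, ih, map_smul, ← Module.End.mul_apply, ← pow_succ', ← add_smul, ← vCoeff_succ]

/-- The linear map `V_α → V` with `v_i ↦ F ^ i v`. -/
def hwLin (v : V) : (Fin r → ℂ) →ₗ[ℂ] V :=
  ∑ i : Fin r, (LinearMap.proj i).smulRight ((σ (Ubar.F r) ^ (i : ℕ)) v)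

omit [r.AtLeastTwo] in
theorem hwLin_hwVec (v : V) (i : ℕ) : hwLin σ v (hwVec r i) = (σ (Ubar.F r) ^ i) v := by
  simp only [hwLin, LinearMap.sum_apply, LinearMap.smulRight_apply, LinearMap.proj_apply]
  rcases lt_or_ge i r with hi | hi
  · rw [Finset.sum_eq_single ⟨i, hi⟩]
    · rw [hwVec_apply, if_pos rfl, one_smul]
    · intro j _ hj
      rw [hwVec_apply, if_neg (fun h => hj (Fin.ext h)), zero_smul]
    · exact fun h => absurd (Finset.mem_univ _) h
  · have : σ (Ubar.F r) ^ i = 0 := by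
      rw [← map_pow, ← Nat.sub_add_cancel hi, pow_add, Ubar.F_pow, mul_zero, map_zero]
    rw [this, hwVec_of_le r hi]; simp

theorem hwLin_comp_E {v : V} {α : ℂ} (hE : σ (Ubar.E r) v = 0)
    (hK : σ (Ubar.K r) v = qPow r (α + r - 1) • v) :
    hwLin σ v ∘ₗ hwRep r α (Ubar.E r) = σ (Ubar.E r) ∘ₗ hwLin σ v := by
  refine hwVec_ext r fun i => ?_
  rw [LinearMap.comp_apply, LinearMap.comp_apply, hwLin_hwVec, hwRep_E]
  cases i with
  | zero => rw [vE_hwVec_zero, map_zero, pow_zero, Module.End.one_apply, hE]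
  | succ i => rw [vE_hwVec_succ, map_smul, hwLin_hwVec, act_E_F_pow σ hE hK]

theorem hwLin_comp_F (v : V) (α : ℂ) :
    hwLin σ v ∘ₗ hwRep r α (Ubar.F r) = σ (Ubar.F r) ∘ₗ hwLin σ v := by
  refine hwVec_ext r fun i => ?_
  rw [LinearMap.comp_apply, LinearMap.comp_apply, hwLin_hwVec, hwRep_F, vF_hwVec, hwLin_hwVec,
    pow_succ', Module.End.mul_apply]

theorem hwLin_comp_K {v : V} {α : ℂ} (hK : σ (Ubar.K r) v = qPow r (α + r - 1) • v) :
    hwLin σ v ∘ₗ hwRep r α (Ubar.K r) = σ (Ubar.K r) ∘ₗ hwLin σ v := by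
  refine hwVec_ext r fun i => ?_
  rw [LinearMap.comp_apply, LinearMap.comp_apply, hwLin_hwVec, hwRep_K, vK_hwVec, map_smul,
    hwLin_hwVec, act_K_F_pow σ hK]

theorem hwLin_comp_Kinv {v : V} {α : ℂ} (hK : σ (Ubar.K r) v = qPow r (α + r - 1) • v) :
    hwLin σ v ∘ₗ hwRep r α (Ubar.Kinv r) = σ (Ubar.Kinv r) ∘ₗ hwLin σ v := by
  refine hwVec_ext r fun i => ?_
  rw [LinearMap.comp_apply, LinearMap.comp_apply, hwLin_hwVec, hwRep_Kinv, vKinv_hwVec, map_smul,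
    hwLin_hwVec, act_Kinv_of_K σ (act_K_F_pow σ hK i)]

/-- The map `V → V_γ` with coordinates `x ↦ φ (E ^ i x) / ∏_{1 ≤ j ≤ i} ({j} {γ + r - j} / {1}²)`;
the map is `Ū`-linear when `φ` is a form of weight `γ + r - 1` that vanishes on the image of `F`. -/
def hwColin (φ : V →ₗ[ℂ] ℂ) (γ : ℂ) : V →ₗ[ℂ] (Fin r → ℂ) :=
  LinearMap.pi fun i => (∏ j ∈ Finset.range i, vCoeff r γ (j + 1))⁻¹ •
    (φ ∘ₗ σ (Ubar.E r) ^ (i : ℕ))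

omit [r.AtLeastTwo] in
theorem hwColin_apply (φ : V →ₗ[ℂ] ℂ) (γ : ℂ) (v : V) (i : Fin r) : hwColin σ φ γ v i =
    (∏ j ∈ Finset.range i, vCoeff r γ (j + 1))⁻¹ * φ ((σ (Ubar.E r) ^ (i : ℕ)) v) := rfl

variable {φ : V →ₗ[ℂ] ℂ} {γ : ℂ} (hφF : ∀ v, φ (σ (Ubar.F r) v) = 0)
  (hφK : ∀ v, φ (σ (Ubar.K r) v) = qPow r (γ + r - 1) * φ v)

omit [r.AtLeastTwo] in
include hφK in
theorem form_E_pow_K (i : ℕ) (v : V) : φ ((σ (Ubar.E r) ^ i) (σ (Ubar.K r) v)) =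
    qPow r (γ + r - 1 - 2 * i) * φ ((σ (Ubar.E r) ^ i) v) := by
  induction i generalizing v with
  | zero => simpa using hφK v
  | succ i ih =>
    have h : σ (Ubar.E r) (σ (Ubar.K r) v) = qPow r (-2) • σ (Ubar.K r) (σ (Ubar.E r) v) := by
      rw [← Module.End.mul_apply, ← Module.End.mul_apply, ← map_mul, ← map_mul, Ubar.K_E,
        map_smul, LinearMap.smul_apply, qPow_neg_two,
        inv_smul_smul₀ (pow_ne_zero _ (qPow_ne_zero r 1))]
    rw [pow_succ, Module.End.mul_apply, h, map_smul, map_smul, ih, smul_eq_mul, ← mul_assoc,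
      ← qPow_add, Module.End.mul_apply]
    congr 2
    push_cast; ring

omit [r.AtLeastTwo] in
include hφK in
theorem form_E_pow_Kinv (i : ℕ) (v : V) : φ ((σ (Ubar.E r) ^ i) (σ (Ubar.Kinv r) v)) =
    qPow r (-(γ + r - 1 - 2 * i)) * φ ((σ (Ubar.E r) ^ i) v) := by
  have h := form_E_pow_K σ hφK i (σ (Ubar.Kinv r) v)
  rw [← Module.End.mul_apply (σ (Ubar.K r)), ← map_mul, Ubar.K_mul_Kinv, map_one,
    Module.End.one_apply] at h
  rw [h, ← mul_assoc, ← qPow_add, neg_add_cancel, qPow_zero, one_mul]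

include hφF hφK in
theorem form_E_pow_F (i : ℕ) (v : V) : φ ((σ (Ubar.E r) ^ (i + 1)) (σ (Ubar.F r) v)) =
    vCoeff r γ (i + 1) * φ ((σ (Ubar.E r) ^ i) v) := by
  induction i generalizing v with
  | zero =>
    have h1 := form_E_pow_K σ hφK 0 v
    have h2 := form_E_pow_Kinv σ hφK 0 v
    have h3 := vCoeff_succ r γ 0
    rw [zero_add, vCoeff_zero, zero_add] at h3
    simp only [pow_zero, Module.End.one_apply] at h1 h2 ⊢
    rw [zero_add, pow_one, act_E_F, map_add, hφF, map_smul, map_sub, h1, h2, h3, smul_eq_mul]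
    ring
  | succ i ih =>
    rw [pow_succ, Module.End.mul_apply, act_E_F, map_add, map_add, ih, map_smul, map_smul, map_sub,
      map_sub, form_E_pow_K σ hφK, form_E_pow_Kinv σ hφK, vCoeff_succ r γ (i + 1),
      ← Module.End.mul_apply, ← pow_succ, smul_eq_mul]
    ring

variable (hγ : γ ∉ Set.range (Int.cast : ℤ → ℂ))

omit [r.AtLeastTwo] in
theorem act_E_pow_of_le {i : ℕ} (h : r ≤ i) (v : V) : (σ (Ubar.E r) ^ i) v = 0 := by
  rw [← map_pow, ← Nat.sub_add_cancel h, pow_add, Ubar.E_pow, mul_zero, map_zero]; rfl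

include hγ in
theorem prod_vCoeff_ne_zero {i : ℕ} (hi : i < r) :
    ∏ j ∈ Finset.range i, vCoeff r γ (j + 1) ≠ 0 :=
  Finset.prod_ne_zero_iff.mpr fun j hj =>
    vCoeff_ne_zero r hγ j.succ_pos (by have := Finset.mem_range.mp hj; omega)

include hγ in
theorem hwColin_comp_E :
    hwColin σ φ γ ∘ₗ σ (Ubar.E r) = hwRep r γ (Ubar.E r) ∘ₗ hwColin σ φ γ := by
  refine LinearMap.ext fun v => funext fun i => ?_
  rw [LinearMap.comp_apply, LinearMap.comp_apply, hwRep_E, vE_apply, hwColin_apply,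
    ← Module.End.mul_apply, ← pow_succ]
  split_ifs with h
  · have h1 := prod_vCoeff_ne_zero hγ h
    rw [Finset.prod_range_succ] at h1
    have h2 := right_ne_zero_of_mul h1
    rw [hwColin_apply, Finset.prod_range_succ, mul_inv]
    field_simp
  · rw [act_E_pow_of_le σ (by omega), map_zero, mul_zero]

include hφF hφK hγ in
theorem hwColin_comp_F :
    hwColin σ φ γ ∘ₗ σ (Ubar.F r) = hwRep r γ (Ubar.F r) ∘ₗ hwColin σ φ γ := by
  refine LinearMap.ext fun v => funext fun ⟨i, hi⟩ => ?_
  rw [LinearMap.comp_apply, LinearMap.comp_apply, hwRep_F, vF_apply, hwColin_apply]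
  cases i with
  | zero => simp [hφF]
  | succ i =>
    have h1 := prod_vCoeff_ne_zero hγ hi
    simp only at h1 ⊢
    rw [Finset.prod_range_succ] at h1 ⊢
    have h2 := right_ne_zero_of_mul h1
    rw [dif_pos i.succ_pos, hwColin_apply, form_E_pow_F σ hφF hφK, mul_inv]
    simp only [add_tsub_cancel_right]
    field_simp

include hφK in
theorem hwColin_comp_K :
    hwColin σ φ γ ∘ₗ σ (Ubar.K r) = hwRep r γ (Ubar.K r) ∘ₗ hwColin σ φ γ := by
  refine LinearMap.ext fun v => funext fun i => ?_
  rw [LinearMap.comp_apply, LinearMap.comp_apply, hwRep_K, vK_apply, hwColin_apply,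
    form_E_pow_K σ hφK, hwColin_apply, mul_left_comm]

include hφK in
theorem hwColin_comp_Kinv :
    hwColin σ φ γ ∘ₗ σ (Ubar.Kinv r) = hwRep r γ (Ubar.Kinv r) ∘ₗ hwColin σ φ γ := by
  refine LinearMap.ext fun v => funext fun i => ?_
  rw [LinearMap.comp_apply, LinearMap.comp_apply, hwRep_Kinv, vKinv_apply, hwColin_apply,
    form_E_pow_Kinv σ hφK, hwColin_apply, mul_left_comm]

end Representations

/-! ### Projectivity -/

namespace WeightModule

variable {r : ℕ}

theorem hom_apply {M N : WeightModule r} (f : Hom M N) (x : Ubar r) (v : M.V) :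
    f.1 (M.ρ x v) = N.ρ x (f.1 v) := DFunLike.congr_fun (f.2 x) v

theorem rho_mul_apply (M : WeightModule r) (x y : Ubar r) (v : M.V) :
    M.ρ (x * y) v = M.ρ x (M.ρ y v) := by rw [map_mul]; rfl

/-- Weight vectors lift along surjective morphisms. -/
theorem exists_weight_lift {M N : WeightModule r} {p : Hom M N} (hp : Function.Surjective p.1)
    {c : ℂ} {n : N.V} (hn : N.ρ (Ubar.K r) n = c • n) :
    ∃ m : M.V, p.1 m = n ∧ M.ρ (Ubar.K r) m = c • m := by
  have key : ∀ x : M.V, ∃ m : M.V, M.ρ (Ubar.K r) m = c • m ∧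
      p.1 x - p.1 m ∈ ⨆ d ≠ c, Module.End.eigenspace (N.ρ (Ubar.K r)) d := by
    intro x
    have hx : x ∈ ⨆ d : ℂ, Module.End.eigenspace (M.ρ (Ubar.K r)) d :=
      M.diagonalizable ▸ Submodule.mem_top
    induction hx using Submodule.iSup_induction' with
    | zero => exact ⟨0, by simp, by simp⟩
    | add x y _ _ hx hy =>
      obtain ⟨m, hm, hm'⟩ := hx
      obtain ⟨m₁, hm₁, hm₁'⟩ := hy
      refine ⟨m + m₁, by rw [map_add, hm, hm₁, smul_add], ?_⟩
      rw [map_add, map_add, add_sub_add_comm]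
      exact add_mem hm' hm₁'
    | mem d x hx =>
      rw [Module.End.mem_eigenspace_iff] at hx
      by_cases hd : d = c
      · exact ⟨x, hd ▸ hx, by simp⟩
      · refine ⟨0, by simp, ?_⟩
        rw [map_zero, sub_zero]
        refine Submodule.mem_iSup_of_mem d (Submodule.mem_iSup_of_mem hd ?_)
        rw [Module.End.mem_eigenspace_iff, ← hom_apply, hx, map_smul]
  obtain ⟨x, rfl⟩ := hp n
  obtain ⟨m, hm, hm'⟩ := key x
  refine ⟨m, ?_, hm⟩
  have h1 : p.1 x - p.1 m ∈ Module.End.eigenspace (N.ρ (Ubar.K r)) c := by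
    rw [Module.End.mem_eigenspace_iff, map_sub, hn, ← hom_apply, hm, map_smul, smul_sub]
  have h2 := (Module.End.eigenspaces_iSupIndep (N.ρ (Ubar.K r)) c).le_bot ⟨h1, hm'⟩
  exact (sub_eq_zero.mp ((Submodule.mem_bot ℂ).mp h2)).symm

variable [r.AtLeastTwo]

/-- The highest weight vector `v_0` of `V_α`. -/
def hwTop (r : ℕ) [r.AtLeastTwo] (α : ℂ) : (highestWeight r α).V := hwVec r 0

variable {M : WeightModule r} {α : ℂ}

/-- The morphism `V_α → M` given by a highest weight vector of `M` of weight `α + r - 1`. -/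
def hwHom (m : M.V) (hE : M.ρ (Ubar.E r) m = 0)
    (hK : M.ρ (Ubar.K r) m = qPow r (α + r - 1) • m) : Hom (highestWeight r α) M :=
  Hom.ofGens (M := highestWeight r α) (hwLin M.ρ m) (hwLin_comp_E M.ρ hE hK)
    (hwLin_comp_F M.ρ m α) (hwLin_comp_K M.ρ hK) (hwLin_comp_Kinv M.ρ hK)

theorem hwHom_top (m : M.V) (hE : M.ρ (Ubar.E r) m = 0)
    (hK : M.ρ (Ubar.K r) m = qPow r (α + r - 1) • m) : (hwHom m hE hK).1 (hwTop r α) = m :=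
  hwLin_hwVec M.ρ m 0

theorem hwTop_E : (highestWeight r α).ρ (Ubar.E r) (hwTop r α) = 0 := by
  have : hwRep r α (Ubar.E r) (hwVec r 0) = 0 := by rw [hwRep_E, vE_hwVec_zero]
  exact this

theorem hwTop_K : (highestWeight r α).ρ (Ubar.K r) (hwTop r α) =
    qPow r (α + r - 1) • hwTop r α := by
  have : hwRep r α (Ubar.K r) (hwVec r 0) = qPow r (α + r - 1) • hwVec r 0 := by
    rw [hwRep_K, vK_hwVec]; simp
  exact this

theorem hwTop_E_pow_F_pow (k : ℕ) :
    (highestWeight r α).ρ (Ubar.E r ^ k * Ubar.F r ^ k) (hwTop r α) =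
      (∏ j ∈ Finset.range k, vCoeff r α (j + 1)) • hwTop r α := by
  have : hwRep r α (Ubar.E r ^ k * Ubar.F r ^ k) (hwVec r 0) =
      (∏ j ∈ Finset.range k, vCoeff r α (j + 1)) • hwVec r 0 := by
    rw [map_mul, map_pow, map_pow, hwRep_E, hwRep_F, Module.End.mul_apply, vF_pow_hwVec, zero_add,
      vE_pow_hwVec]
  exact this

/-- A morphism out of `V_α` is determined by the image of `v_0`. -/
theorem hw_hom_ext {f g : Hom (highestWeight r α) M} (h : f.1 (hwTop r α) = g.1 (hwTop r α)) :
    f = g := by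
  refine Subtype.ext (hwVec_ext (V := M.V) (f := f.1) (g := g.1) r fun i => ?_)
  have e : (hwVec r i : Fin r → ℂ) = hwRep r α (Ubar.F r ^ i) (hwVec r 0) := by
    rw [map_pow, hwRep_F, vF_pow_hwVec, zero_add]
  rw [e]
  exact (hom_apply f _ _).trans ((congrArg _ h).trans (hom_apply g _ _).symm)

/-- `V_α` is projective: `E ^ (r - 1) F ^ (r - 1)` sends a lift of a highest weight vector `n` to a
highest weight vector, whose image is a nonzero multiple of `n`. -/
theorem highestWeight_isProjective (hα : α ∉ Set.range (Int.cast : ℤ → ℂ)) :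
    (highestWeight r α).IsProjective := by
  intro M N p hp f
  have hnK : N.ρ (Ubar.K r) (f.1 (hwTop r α)) = qPow r (α + r - 1) • f.1 (hwTop r α) := by
    rw [← hom_apply, hwTop_K, map_smul]
  obtain ⟨m, hm, hmK⟩ := exists_weight_lift hp hnK
  have hc : ∏ j ∈ Finset.range (r - 1), vCoeff r α (j + 1) ≠ 0 :=
    prod_vCoeff_ne_zero hα (by have := Nat.AtLeastTwo.prop (n := r); omega)
  generalize hcd : ∏ j ∈ Finset.range (r - 1), vCoeff r α (j + 1) = c at hc
  let x := Ubar.E r ^ (r - 1) * Ubar.F r ^ (r - 1)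
  have hxE : Ubar.E r * x = 0 := by
    rw [← mul_assoc, ← pow_succ', Ubar.r_pred, Ubar.E_pow, zero_mul]
  have hxK : Ubar.K r * x = x * Ubar.K r := by
    have h1 : Ubar.K r * Ubar.E r ^ (r - 1) =
        (qPow r 1 ^ 2) ^ (r - 1) • (Ubar.E r ^ (r - 1) * Ubar.K r) :=
      pow_mul_qcomm (Ubar.K_E r) _
    have h2 : Ubar.K r * Ubar.F r ^ (r - 1) =
        ((qPow r 1 ^ 2)⁻¹) ^ (r - 1) • (Ubar.F r ^ (r - 1) * Ubar.K r) :=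
      pow_mul_qcomm (Ubar.K_F r) _
    rw [← mul_assoc, h1, smul_mul_assoc, mul_assoc, h2, mul_smul_comm, smul_smul, ← mul_pow,
      mul_inv_cancel₀ (pow_ne_zero _ (qPow_ne_zero r 1)), one_pow, one_smul, mul_assoc]
  have hE : M.ρ (Ubar.E r) (c⁻¹ • M.ρ x m) = 0 := by
    rw [map_smul, ← rho_mul_apply, hxE, map_zero, LinearMap.zero_apply, smul_zero]
  have hK : M.ρ (Ubar.K r) (c⁻¹ • M.ρ x m) = qPow r (α + r - 1) • (c⁻¹ • M.ρ x m) := by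
    rw [map_smul, ← rho_mul_apply, hxK, rho_mul_apply, hmK, map_smul, smul_comm]
  refine ⟨hwHom _ hE hK, hw_hom_ext ?_⟩
  change p.1 ((hwHom _ hE hK).1 (hwTop r α)) = _
  rw [hwHom_top, map_smul, hom_apply, hm, ← hom_apply, hwTop_E_pow_F_pow, hcd, map_smul,
    inv_smul_smul₀ hc]

/-- The endomorphisms of `V_α` are scalars, since the kernel of `E` in `V_α` is spanned by `v_0`. -/
theorem hw_end_eq_smul (hα : α ∉ Set.range (Int.cast : ℤ → ℂ)) (e : End (highestWeight r α)) :
    e = (show Fin r → ℂ from e.1 (hwTop r α)) ⟨0, Ubar.r_pos r⟩ •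
      Hom.id (highestWeight r α) := by
  refine hw_hom_ext ?_
  have hE : (highestWeight r α).ρ (Ubar.E r) (e.1 (hwTop r α)) = 0 := by
    rw [← hom_apply, hwTop_E, map_zero]
  have key : ∀ x : Fin r → ℂ, hwRep r α (Ubar.E r) x = 0 →
      x = x ⟨0, Ubar.r_pos r⟩ • hwVec r 0 := by
    intro x hx
    funext ⟨i, hi⟩
    rw [Pi.smul_apply, hwVec_apply]
    cases i with
    | zero => simp
    | succ i =>
      have h := congrFun hx ⟨i, by omega⟩
      rw [hwRep_E, vE_apply, dif_pos hi] at h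
      have := (mul_eq_zero.mp h).resolve_left (vCoeff_ne_zero r hα i.succ_pos hi)
      simp [this]
  exact key _ hE

/-- The tensor product of a projective object with any object is projective, since `- ⊗ W` is left
adjoint to the exact functor `- ⊗ W*`. -/
theorem IsProjective.tensor {P : WeightModule r} (hP : P.IsProjective) (W : WeightModule r) :
    (P.tensor W).IsProjective := by
  intro M N p hp f
  let f' : Hom P (N.tensor W.dual) := (f.tensor (Hom.id W.dual)).comp <|
    (assocInv P W W.dual).comp <| ((Hom.id P).tensor (coevLeft W)).comp <| ridInv P
  obtain ⟨l, hl⟩ := hP (M.tensor W.dual) (N.tensor W.dual) (p.tensor (Hom.id W.dual))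
    (TensorProduct.map_surjective hp Function.surjective_id) f'
  refine ⟨(ridHom M).comp <| ((Hom.id M).tensor (evLeft W)).comp <|
    (assocHom M W.dual W).comp (l.tensor (Hom.id W)),
    Subtype.ext (TensorProduct.ext' fun x w => ?_)⟩
  -- `c V` contracts `V ⊗ W*` with `w`; it undoes the passage from `f` to its adjoint `f'`
  let c (V : Type) [AddCommGroup V] [Module ℂ V] : V ⊗[ℂ] Module.Dual ℂ W.V →ₗ[ℂ] V :=
    (TensorProduct.rid ℂ V).toLinearMap ∘ₗ (Module.Dual.eval ℂ W.V w).lTensor V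
  have h1 : ∀ (V : Type) [AddCommGroup V] [Module ℂ V] (z : V ⊗[ℂ] Module.Dual ℂ W.V),
      TensorProduct.rid ℂ V (TensorProduct.map LinearMap.id (contractLeft ℂ W.V)
        (TensorProduct.assoc ℂ V (Module.Dual ℂ W.V) W.V (z ⊗ₜ w))) = c V z := by
    intro V _ _ z
    induction z using TensorProduct.induction_on with
    | zero => simp
    | add a b ha hb => rw [TensorProduct.add_tmul, map_add, map_add, map_add, ha, hb, map_add]
    | tmul a b => simp [c]
  have h2 : ∀ z : M.V ⊗[ℂ] Module.Dual ℂ W.V, p.1 (c M.V z) =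
      c N.V (TensorProduct.map p.1 LinearMap.id z) := by
    intro z
    induction z using TensorProduct.induction_on with
    | zero => simp
    | add a b ha hb => rw [map_add, map_add, ha, hb, map_add, map_add]
    | tmul a b => simp [c]
  have h3 : ((p.tensor (Hom.id W.dual)).comp l).1 x = f'.1 x := by rw [hl]
  change p.1 (TensorProduct.rid ℂ M.V (TensorProduct.map LinearMap.id (contractLeft ℂ W.V)
        (TensorProduct.assoc ℂ M.V (Module.Dual ℂ W.V) W.V (l.1 x ⊗ₜ w)))) = f.1 (x ⊗ₜ w)
  rw [h1, h2]
  change c N.V (((p.tensor (Hom.id W.dual)).comp l).1 x) = _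
  rw [h3]
  change c N.V (TensorProduct.map f.1 LinearMap.id ((TensorProduct.assoc ℂ P.V W.V
    (Module.Dual ℂ W.V)).symm (TensorProduct.map LinearMap.id (coevaluation ℂ W.V)
      ((TensorProduct.rid ℂ P.V).symm x)))) = _
  rw [TensorProduct.rid_symm_apply, TensorProduct.map_tmul, coevaluation_apply_one]
  simp only [LinearMap.id_apply, TensorProduct.tmul_sum, map_sum, TensorProduct.assoc_symm_tmul,
    TensorProduct.map_tmul]
  let b := Module.Basis.ofVectorSpace ℂ W.V
  have h4 : ∀ i, c N.V (f.1 (x ⊗ₜ b i) ⊗ₜ b.coord i) = f.1 (x ⊗ₜ (b.repr w i • b i)) := by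
    intro i
    simp [c]
  refine (Finset.sum_congr rfl fun i _ => h4 i).trans ?_
  rw [← map_sum, ← TensorProduct.tmul_sum, b.sum_repr]

end WeightModule

/-! ### The summand of highest weight of `V_α ⊗ V_β` -/

section TensorProductRep

variable (r : ℕ) [r.AtLeastTwo] (α β : ℂ)

/-- The form `v_0^* ⊗ v_0^*` on `V_α ⊗ V_β`. -/
def topForm : (Fin r → ℂ) ⊗[ℂ] (Fin r → ℂ) →ₗ[ℂ] ℂ :=
  (TensorProduct.lid ℂ ℂ).toLinearMap ∘ₗ
    TensorProduct.map (LinearMap.proj ⟨0, Ubar.r_pos r⟩) (LinearMap.proj ⟨0, Ubar.r_pos r⟩)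

/-- The map `v_0^* ⊗ id` from `V_α ⊗ V_β` to `V_β`. -/
def topSlice : (Fin r → ℂ) ⊗[ℂ] (Fin r → ℂ) →ₗ[ℂ] (Fin r → ℂ) :=
  (TensorProduct.lid ℂ _).toLinearMap ∘ₗ
    TensorProduct.map (LinearMap.proj ⟨0, Ubar.r_pos r⟩) LinearMap.id

theorem topForm_tmul (x y : Fin r → ℂ) : topForm r (x ⊗ₜ y) =
    x ⟨0, Ubar.r_pos r⟩ * y ⟨0, Ubar.r_pos r⟩ := by simp [topForm]

theorem topSlice_tmul (x y : Fin r → ℂ) : topSlice r (x ⊗ₜ y) =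
    x ⟨0, Ubar.r_pos r⟩ • y := by simp [topSlice]

theorem vF_apply_zero (x : Fin r → ℂ) : vF r x ⟨0, Ubar.r_pos r⟩ = 0 :=
  vF_pow_apply r 1 x _ one_pos

/-- The action of `Ū` on `V_α ⊗ V_β`. -/
abbrev hwTensorRep : Ubar r →ₐ[ℂ] Module.End ℂ ((Fin r → ℂ) ⊗[ℂ] (Fin r → ℂ)) :=
  WeightModule.tensorRep (hwRep r α) (hwRep r β)

theorem topForm_F (z : (Fin r → ℂ) ⊗[ℂ] (Fin r → ℂ)) :
    topForm r (hwTensorRep r α β (Ubar.F r) z) = 0 := by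
  rw [WeightModule.tensorRep_F, hwRep_F, hwRep_F, hwRep_Kinv]
  induction z using TensorProduct.induction_on with
  | zero => simp
  | add x y hx hy => rw [map_add, map_add, hx, hy, add_zero]
  | tmul x y =>
    rw [LinearMap.add_apply, map_add, TensorProduct.map_tmul, TensorProduct.map_tmul, topForm_tmul,
      topForm_tmul, vF_apply_zero, vF_apply_zero, mul_zero, zero_mul, add_zero]

theorem topForm_K {γ : ℂ} (h : γ = α + β + r - 1) (z : (Fin r → ℂ) ⊗[ℂ] (Fin r → ℂ)) :
    topForm r (hwTensorRep r α β (Ubar.K r) z) = qPow r (γ + r - 1) * topForm r z := by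
  rw [WeightModule.tensorRep_K, hwRep_K, hwRep_K]
  induction z using TensorProduct.induction_on with
  | zero => simp
  | add x y hx hy => rw [map_add, map_add, hx, hy, map_add, mul_add]
  | tmul x y =>
    rw [TensorProduct.map_tmul, topForm_tmul, topForm_tmul, vK_apply, vK_apply, mul_mul_mul_comm,
      ← qPow_add, h]
    simp only [Nat.cast_zero]
    ring_nf

theorem hwTensor_E_pow (i : ℕ) (w : Fin r → ℂ) :
    (hwTensorRep r α β (Ubar.E r) ^ i) (hwVec r 0 ⊗ₜ w) = hwVec r 0 ⊗ₜ (vE r β ^ i) w := by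
  induction i with
  | zero => rfl
  | succ i ih =>
    rw [pow_succ', Module.End.mul_apply, ih, WeightModule.tensorRep_E, hwRep_E, hwRep_E,
      LinearMap.add_apply, TensorProduct.map_tmul, TensorProduct.map_tmul, vE_hwVec_zero,
      TensorProduct.zero_tmul, zero_add, pow_succ', Module.End.mul_apply, LinearMap.id_apply]

theorem topSlice_F (z : (Fin r → ℂ) ⊗[ℂ] (Fin r → ℂ)) :
    topSlice r (hwTensorRep r α β (Ubar.F r) z) =
      qPow r (-(α + r - 1)) • vF r (topSlice r z) := by
  rw [WeightModule.tensorRep_F, hwRep_F, hwRep_F, hwRep_Kinv]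
  induction z using TensorProduct.induction_on with
  | zero => simp
  | add x y hx hy => rw [map_add, map_add, hx, hy, map_add, map_add, smul_add]
  | tmul x y =>
    rw [LinearMap.add_apply, map_add, TensorProduct.map_tmul, TensorProduct.map_tmul,
      topSlice_tmul, topSlice_tmul, topSlice_tmul, vF_apply_zero, zero_smul, add_zero, vKinv_apply,
      map_smul, smul_smul]
    simp

theorem topSlice_F_pow (i : ℕ) :
    topSlice r ((hwTensorRep r α β (Ubar.F r) ^ i) (hwVec r 0 ⊗ₜ hwVec r 0)) =
      qPow r (-(i * (α + r - 1))) • hwVec r i := by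
  rw [← mul_neg, qPow_nat_mul]
  induction i with
  | zero => simp [topSlice_tmul, hwVec_apply]
  | succ i ih =>
    rw [pow_succ', Module.End.mul_apply, topSlice_F, ih, map_smul, vF_hwVec, smul_smul, pow_succ']

theorem vE_pow_hwVec_add (j k : ℕ) : ∃ c : ℂ, (vE r β ^ j) (hwVec r (k + j)) = c • hwVec r k := by
  induction j with
  | zero => exact ⟨1, by simp⟩
  | succ j ih =>
    obtain ⟨c, hc⟩ := ih
    exact ⟨vCoeff r β (k + j + 1) * c, by
      rw [pow_succ, Module.End.mul_apply, ← add_assoc, vE_hwVec_succ, map_smul, hc, smul_smul]⟩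

/-- The coefficient of `v_0` in `E ^ j v_i`. -/
theorem vE_pow_hwVec_apply_zero (i j : ℕ) :
    (vE r β ^ j) (hwVec r i) ⟨0, Ubar.r_pos r⟩ =
      if j = i then ∏ l ∈ Finset.range i, vCoeff r β (l + 1) else 0 := by
  rcases lt_trichotomy j i with h | rfl | h
  · obtain ⟨k, rfl⟩ : ∃ k, i = k + 1 + j := ⟨i - j - 1, by omega⟩
    obtain ⟨c, hc⟩ := vE_pow_hwVec_add r β j (k + 1)
    rw [hc, if_neg h.ne, Pi.smul_apply, hwVec_apply, if_neg (by simp), smul_zero]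
  · rw [vE_pow_hwVec, if_pos rfl, Pi.smul_apply, hwVec_apply, if_pos rfl, smul_eq_mul, mul_one]
  · obtain ⟨k, rfl⟩ : ∃ k, j = k + 1 + i := ⟨j - i - 1, by omega⟩
    rw [if_neg h.ne', pow_add, Module.End.mul_apply, vE_pow_hwVec, map_smul, pow_succ,
      Module.End.mul_apply, vE_hwVec_zero, map_zero, smul_zero]
    rfl

/-- The retraction of `V_α ⊗ V_β` onto `V_γ` sends `v_0 ⊗ v_i` to a multiple of `v_i`. -/
theorem hwColin_tmul {γ : ℂ} (i : ℕ) :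
    hwColin (hwTensorRep r α β) (topForm r) γ (hwVec r 0 ⊗ₜ hwVec r i) =
      (∏ j ∈ Finset.range i, vCoeff r β (j + 1) / vCoeff r γ (j + 1)) • hwVec r i := by
  funext j
  rw [hwColin_apply, hwTensor_E_pow, topForm_tmul, vE_pow_hwVec_apply_zero, Pi.smul_apply,
    hwVec_apply, hwVec_apply, if_pos rfl, one_mul, Finset.prod_div_distrib, smul_eq_mul]
  split_ifs with h
  · rw [h, mul_one, mul_comm, div_eq_mul_inv]
  · simp

end TensorProductRep

/-! ### Partial traces and the modified dimension -/

namespace WeightModule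

variable {r : ℕ} [r.AtLeastTwo]

/-- A coefficient of a right partial trace is the trace of a linear endomorphism of the factor that
is traced out. -/
theorem partialTraceRight_apply {U V : WeightModule r} (W : WeightModule r)
    (f : Hom (U.tensor W) (V.tensor W)) (θ : V.V →ₗ[ℂ] ℂ) (u : U.V) :
    θ ((partialTraceRight W f).1 u) = LinearMap.trace ℂ W.V
      ((TensorProduct.lid ℂ W.V).toLinearMap ∘ₗ TensorProduct.map θ (W.ρ (Ubar.pivot r)) ∘ₗ f.1 ∘ₗ
        TensorProduct.mk ℂ U.V W.V u) := by
  classical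
  let b := Module.Basis.ofVectorSpace ℂ W.V
  have h1 : ∀ (z : V.V ⊗[ℂ] W.V) (ξ : Module.Dual ℂ W.V),
      θ (TensorProduct.rid ℂ V.V (TensorProduct.map LinearMap.id
        (contractRight ℂ W.V ∘ₗ TensorProduct.map (W.ρ (Ubar.pivot r)) LinearMap.id)
          (TensorProduct.assoc ℂ V.V W.V (Module.Dual ℂ W.V) (z ⊗ₜ ξ)))) =
      ξ (TensorProduct.lid ℂ W.V (TensorProduct.map θ (W.ρ (Ubar.pivot r)) z)) := by
    intro z ξ
    induction z using TensorProduct.induction_on with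
    | zero => simp
    | add x y hx hy =>
      rw [TensorProduct.add_tmul]
      simp only [map_add, hx, hy]
    | tmul x y => simp [mul_comm]
  have h2 : (partialTraceRight W f).1 u = TensorProduct.rid ℂ V.V (TensorProduct.map LinearMap.id
        (contractRight ℂ W.V ∘ₗ TensorProduct.map (W.ρ (Ubar.pivot r)) LinearMap.id)
          (TensorProduct.assoc ℂ V.V W.V (Module.Dual ℂ W.V) (TensorProduct.map f.1 LinearMap.id
            ((TensorProduct.assoc ℂ U.V W.V (Module.Dual ℂ W.V)).symm
              (TensorProduct.map LinearMap.id (coevaluation ℂ W.V)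
                ((TensorProduct.rid ℂ U.V).symm u)))))) := rfl
  rw [h2, TensorProduct.rid_symm_apply, TensorProduct.map_tmul, coevaluation_apply_one,
    LinearMap.trace_eq_matrix_trace ℂ b, Matrix.trace]
  simp only [LinearMap.id_apply, TensorProduct.tmul_sum, map_sum, TensorProduct.assoc_symm_tmul,
    TensorProduct.map_tmul]
  refine Finset.sum_congr rfl fun i _ => ?_
  rw [h1, Matrix.diag_apply, LinearMap.toMatrix_apply]
  rfl

theorem hw_pivot (β : ℂ) (i : ℕ) : hwRep r β (Ubar.pivot r) (hwVec r i) =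
    qPow r (-(r - 1) * (β + r - 1 - 2 * i)) • hwVec r i := by
  have h2 := Nat.AtLeastTwo.prop (n := r)
  have e : (-(r - 1) * (β + r - 1 - 2 * i) : ℂ) = (r - 1 : ℕ) * (-(β + r - 1 - 2 * i)) := by
    rw [Nat.cast_sub (by omega)]; push_cast; ring
  rw [Ubar.pivot, map_pow, hwRep_Kinv, e, qPow_nat_mul]
  generalize r - 1 = n
  induction n with
  | zero => simp
  | succ n ih =>
    rw [pow_succ', Module.End.mul_apply, ih, map_smul, vKinv_hwVec, smul_smul, pow_succ]

variable {α β γ : ℂ}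

/-- The inclusion `V_γ → V_α ⊗ V_β` for `γ = α + β + r - 1`, with `v_0 ↦ v_0 ⊗ v_0`. -/
def summandIncl (h : γ = α + β + r - 1) :
    Hom (highestWeight r γ) ((highestWeight r α).tensor (highestWeight r β)) :=
  hwHom (M := (highestWeight r α).tensor (highestWeight r β)) (hwTop r α ⊗ₜ hwTop r β)
    (by rw [tensorRep_E]; simp [hwTop_E])
    (by
      rw [tensorRep_K, TensorProduct.map_tmul, hwTop_K, hwTop_K, TensorProduct.smul_tmul_smul,
        ← qPow_add, h]
      ring_nf)

/-- The projection `V_α ⊗ V_β → V_γ` for `γ = α + β + r - 1`. -/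
def summandProj (h : γ = α + β + r - 1) (hγ : γ ∉ Set.range (Int.cast : ℤ → ℂ)) :
    Hom ((highestWeight r α).tensor (highestWeight r β)) (highestWeight r γ) :=
  Hom.ofGens (M := (highestWeight r α).tensor (highestWeight r β)) (N := highestWeight r γ)
    (hwColin (hwTensorRep r α β) (topForm r) γ)
    (hwColin_comp_E (hwTensorRep r α β) hγ)
    (hwColin_comp_F (hwTensorRep r α β) (topForm_F r α β) (topForm_K r α β h) hγ)
    (hwColin_comp_K (hwTensorRep r α β) (topForm_K r α β h))
    (hwColin_comp_Kinv (hwTensorRep r α β) (topForm_K r α β h))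

theorem summandIncl_hwVec (h : γ = α + β + r - 1) (i : ℕ) :
    (summandIncl h).1 (hwVec r i : Fin r → ℂ) =
      (hwTensorRep r α β (Ubar.F r) ^ i) (hwVec r 0 ⊗ₜ hwVec r 0) :=
  hwLin_hwVec (hwTensorRep r α β) _ i

theorem summandProj_comp_incl (h : γ = α + β + r - 1) (hγ : γ ∉ Set.range (Int.cast : ℤ → ℂ)) :
    (summandProj h hγ).comp (summandIncl h) = Hom.id (highestWeight r γ) := by
  refine hw_hom_ext ?_
  change (summandProj h hγ).1 ((summandIncl h).1 (hwTop r γ)) = hwTop r γ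
  rw [summandIncl, hwHom_top]
  refine (hwColin_tmul r α β 0).trans ?_
  simp [hwTop]

/-- The partial trace over `V_β` of the projection of `V_α ⊗ V_β` onto its summand `V_γ`. -/
theorem partialTrace_summand (h : γ = α + β + r - 1) (hα : α ∉ Set.range (Int.cast : ℤ → ℂ))
    (hγ : γ ∉ Set.range (Int.cast : ℤ → ℂ)) :
    partialTraceRight (highestWeight r β) ((summandIncl h).comp (summandProj h hγ)) =
      (qBr r γ * qBr r (r * α) / (qBr r (r * γ) * qBr r α)) • Hom.id (highestWeight r α) := by
  rw [hw_end_eq_smul hα (partialTraceRight _ _)]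
  congr 1
  have h0 := partialTraceRight_apply (highestWeight r β) ((summandIncl h).comp (summandProj h hγ))
    (LinearMap.proj (R := ℂ) (φ := fun _ : Fin r => ℂ) ⟨0, Ubar.r_pos r⟩) (hwTop r α)
  refine h0.trans ?_
  have h1 : ∀ i : Fin r, (hwRep r β (Ubar.pivot r) (topSlice r ((summandIncl h).1
      (hwColin (hwTensorRep r α β) (topForm r) γ (hwVec r 0 ⊗ₜ hwVec r i)))) : Fin r → ℂ) i =
      qPow r (-(r - 1) * (β + r - 1 - 2 * (i : ℕ))) * qPow r (-((i : ℕ) * (α + r - 1))) *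
        ∏ j ∈ Finset.range i, (qBr r (β + r - 1 - j) / qBr r (γ + r - 1 - j)) := by
    intro i
    have e : ∀ j ∈ Finset.range (i : ℕ), vCoeff r β (j + 1) / vCoeff r γ (j + 1) =
        qBr r (β + r - 1 - j) / qBr r (γ + r - 1 - j) := by
      intro j hj
      have hji := Finset.mem_range.mp hj
      have h1 := qBr_one_ne_zero r
      have h2 : qBr r ((j + 1 : ℕ) : ℂ) ≠ 0 := qBr_nat_ne_zero r j.succ_pos (by omega)
      rw [vCoeff, vCoeff, div_div_div_cancel_right₀ (pow_ne_zero _ h1), mul_div_mul_left _ _ h2]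
      push_cast
      ring_nf
    rw [hwColin_tmul, Finset.prod_congr rfl e]
    erw [map_smul]
    rw [summandIncl_hwVec]
    erw [map_smul, topSlice_F_pow]
    rw [map_smul, map_smul, hw_pivot, Pi.smul_apply, Pi.smul_apply, Pi.smul_apply, hwVec_self,
      smul_eq_mul, smul_eq_mul, smul_eq_mul]
    ring
  rw [← partialTrace_scalar r hα hγ h, ← Fin.sum_univ_eq_sum_range (fun i : ℕ =>
    qPow r (-(r - 1) * (β + r - 1 - 2 * i)) * qPow r (-(i * (α + r - 1))) *
        ∏ j ∈ Finset.range i, (qBr r (β + r - 1 - j) / qBr r (γ + r - 1 - j)))]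
  -- the trace over `V_β` in the basis `v_i`, on which `h1` gives the diagonal entries
  have h2 : ∀ S : Module.End ℂ (Fin r → ℂ), LinearMap.trace ℂ (Fin r → ℂ) S =
      ∑ i : Fin r, S (hwVec r i) i := by
    intro S
    rw [LinearMap.trace_eq_matrix_trace ℂ (Pi.basisFun ℂ (Fin r)), Matrix.trace]
    refine Finset.sum_congr rfl fun i _ => ?_
    rw [Matrix.diag_apply, LinearMap.toMatrix_apply, Pi.basisFun_repr, Pi.basisFun_apply,
      ← hwVec_coe]
  refine (h2 _).trans (Finset.sum_congr rfl fun i _ => ?_)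
  rw [← h1]
  have h3 : ∀ z : (Fin r → ℂ) ⊗[ℂ] (Fin r → ℂ), TensorProduct.lid ℂ (Fin r → ℂ)
      (TensorProduct.map (LinearMap.proj (R := ℂ) (φ := fun _ : Fin r => ℂ) ⟨0, Ubar.r_pos r⟩)
        (hwRep r β (Ubar.pivot r)) z) = hwRep r β (Ubar.pivot r) (topSlice r z) := by
    intro z
    induction z using TensorProduct.induction_on with
    | zero => simp
    | add x y hx hy => simp only [map_add, hx, hy]
    | tmul x y => simp [topSlice_tmul]
  exact congrFun (h3 _) i

/-- The change of the modified dimension along the summand `V_γ` of `V_α ⊗ V_β`. -/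
theorem modifiedDim_step (t : ModifiedTrace r) (hα : α ∉ Set.range (Int.cast : ℤ → ℂ))
    (hγ : γ ∉ Set.range (Int.cast : ℤ → ℂ))
    (hPα : (highestWeight r α).IsProjective) (hPγ : (highestWeight r γ).IsProjective) :
    t.tr _ hPγ (Hom.id _) * (qBr r (r * γ) / qBr r γ) =
      t.tr _ hPα (Hom.id _) * (qBr r (r * α) / qBr r α) := by
  -- `β = γ - α - r + 1` may be an integer: only `V_α` and `V_γ` have to be projective
  have h : γ = α + (γ - α - r + 1) + r - 1 := by ring
  have hPT := hPα.tensor (highestWeight r (γ - α - r + 1))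
  rw [← summandProj_comp_incl h hγ, t.cyclic _ _ hPγ hPT, t.right_partial _ _ hPα hPT,
    partialTrace_summand h hα hγ, map_smul, smul_eq_mul]
  have h1 := qBr_ne_zero r hα
  have h2 := qBr_ne_zero r hγ
  have h3 := qBr_mul_r_ne_zero r hγ
  field_simp

/-- The modified dimensions of the modules `V_α` are determined by a single constant. -/
theorem exists_modifiedDim (t : ModifiedTrace r) : ∃ d₀ : ℂ, ∀ (α : ℂ)
    (_ : α ∉ Set.range (Int.cast : ℤ → ℂ)) (hP : (highestWeight r α).IsProjective),
    t.tr _ hP (Hom.id _) = d₀ * (r * qBr r α / qBr r (r * α)) := by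
  have hhalf := half_notMem_int
  have hP0 := highestWeight_isProjective (r := r) hhalf
  refine ⟨t.tr _ hP0 (Hom.id _) * (qBr r (r * (1 / 2)) / qBr r (1 / 2)) / r, fun α hα hP => ?_⟩
  have h := modifiedDim_step t hhalf hα hP0 hP
  rw [← h]
  have h1 := qBr_ne_zero r hα
  have h2 := qBr_mul_r_ne_zero r hα
  have h3 := cast_r_ne_zero r
  field_simp

end WeightModule

end

end QuantumSl2

open QuantumSl2 in
theorem mainTheorem8 (r : ℕ) [r.AtLeastTwo]
    (μ : ∀ a : G, U r a →ₗ[ℂ] ℂ) (hμ : U.IsRightGIntegral r μ)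
    (η : ℂ) (hη : η = μ 0 (U.proj r 0 (Ubar.E r ^ (r - 1) * Ubar.F r ^ (r - 1) * Ubar.K r))) :
    (∀ (a : G) (k : ℕ), k ≤ r - 2 →
      U.symmetrised r μ a (U.proj r a (Ubar.casimir r) ^ k) = 0) ∧
    (∀ a : G, U.symmetrised r μ a (U.proj r a (Ubar.casimir r) ^ (r - 1)) = η) ∧
    (∀ α : ℂ, α ∉ Set.range (Int.cast : ℤ → ℂ) →
      (WeightModule.highestWeight r α).IsProjective) ∧
    ∀ t : WeightModule.ModifiedTrace r, ∃ d₀ : ℂ,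
      (∀ (α : ℂ) (_ : α ∉ Set.range (Int.cast : ℤ → ℂ))
        (hP : (WeightModule.highestWeight r α).IsProjective),
        t.tr (WeightModule.highestWeight r α) hP (WeightModule.Hom.id _) =
            d₀ * ∏ k ∈ Finset.Icc 1 (r - 1), qBr r k / qBr r (α + r - k) ∧
        t.tr (WeightModule.highestWeight r α) hP (WeightModule.Hom.id _) =
            d₀ * (r * qBr r α / qBr r (r * α))) ∧
      (∀ (α : ℂ) (_ : α ∉ Set.range (Int.cast : ℤ → ℂ))
        (hP : (WeightModule.highestWeight r α).IsProjective) (a : G),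
        (d₀ ≠ 0 →
          U.symmetrised r μ a (Polynomial.aeval (U.proj r a (Ubar.casimir r)) (lagrangePoly r α)) =
            (-1) ^ (r - 1) * qBr r 1 ^ (2 * r - 2) * η / (r ^ 3 * d₀) *
              (r * t.tr (WeightModule.highestWeight r α) hP (WeightModule.Hom.id _))) ∧
        (d₀ = (-1) ^ (r - 1) * qBr r 1 ^ (2 * r - 2) * η / r ^ 3 →
          U.symmetrised r μ a (Polynomial.aeval (U.proj r a (Ubar.casimir r)) (lagrangePoly r α)) =
            r * t.tr (WeightModule.highestWeight r α) hP (WeightModule.Hom.id _))) := by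
  have hr := Nat.AtLeastTwo.prop (n := r)
  have hη' : ∀ a : G, ∀ p : Polynomial ℂ, p.natDegree ≤ r - 1 →
      U.symmetrised r μ a (Polynomial.aeval (U.proj r a (Ubar.casimir r)) p) =
        p.coeff (r - 1) * η := fun a p hp => by
    rw [hη]; exact U.symmetrised_aeval hμ a hp
  refine ⟨fun a k hk => U.symmetrised_casimir_pow hμ a (by omega), fun a => ?_,
    fun α hα => WeightModule.highestWeight_isProjective hα, fun t => ?_⟩
  · rw [hη]; exact U.symmetrised_casimir_pow_top hμ a
  obtain ⟨d₀, hd⟩ := WeightModule.exists_modifiedDim t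
  -- `∏ {k} = prodConst r * r` stands in a denominator on the left and in a numerator on the right;
  -- the sign `(-1) ^ (r - 1) = prodConst r ^ 2` and `prodConst r ^ 4 = 1` make up for this
  have key : ∀ α : ℂ, α ∉ Set.range (Int.cast : ℤ → ℂ) → ∀ a : G,
      U.symmetrised r μ a (Polynomial.aeval (U.proj r a (Ubar.casimir r)) (lagrangePoly r α)) =
        (-1) ^ (r - 1) * qBr r 1 ^ (2 * r - 2) * η / r ^ 3 *
          (r * (r * qBr r α / qBr r (r * α))) := by
    intro α hα a
    have h1 : ∏ k ∈ Finset.Icc 1 (r - 1), qBr r (α + r - k) ≠ 0 :=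
      Finset.prod_ne_zero_iff.mpr fun k _ => qBr_add_r_sub_ne_zero r hα k
    have h2 := prodConst_ne_zero r
    have h3 := cast_r_ne_zero r
    have h4 : (-1 : ℂ) ^ (r - 1) = prodConst r ^ 2 := (prodConst_sq r).symm
    have h5 := qBr_one_ne_zero r
    rw [hη' a _ (lagrangePoly_natDegree_le r α), lagrangePoly_coeff, prod_casimirScalar_sub,
      ← prod_ratio r hα, Finset.prod_div_distrib, prod_qBr_nat, h4]
    have h6 := pow_ne_zero (2 * r - 2) h5
    generalize qBr r 1 ^ (2 * r - 2) = b at h6 ⊢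
    generalize ∏ k ∈ Finset.Icc 1 (r - 1), qBr r (α + r - k) = P at h1 ⊢
    have h7 : prodConst r ^ 4 = 1 := by
      rw [show 4 = 2 * 2 by rfl, pow_mul, prodConst_sq, ← pow_mul, mul_comm, pow_mul]
      simp
    field_simp
    rw [h7, one_mul]
  refine ⟨d₀, fun α hα hP => ⟨?_, hd α hα hP⟩, fun α hα hP a => ⟨fun h0 => ?_, fun h0 => ?_⟩⟩
  · rw [hd α hα hP, prod_ratio r hα]
  · rw [key α hα a, hd α hα hP]
    field_simp
  · rw [key α hα a, hd α hα hP, h0]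
    ring
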